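/- Let $a\in(0,\infty]$ and let $V:(-a,a)\to\mathbb R$ be smooth and even. Let $H=-\frac{d^2}{dx^2}+V$ be a symmetric operator in $L^2(-a,a)$, whose domain consists of $C^2$ functions and is given by boundary conditions imposed at $-a$ and at $a$ separately (that is, the domain is stable under multiplication by smooth functions that are constant near each endpoint); assume that the boundary conditions respect the symmetry, i.e. that $x\mapsto f(-x)$ is in the domain whenever $f$ is. Assume that $H$ has pure-point spectrum: there are real nonzero square-integrable eigenfunctions $\varphi_0,\varphi_1,\dots$ in the domain, $-\varphi_n''+V\varphi_n=E_n\varphi_n$ with $E_0<E_1<\cdots$, which are complete in $L^2(-a,a)$; assume also that $\varphi_n(x)\to0$ as $x\to\pm a$. For integers $0\le\lambda_1\le\dots\le\lambda_\ell$ (a partition $\lambda$ of length $\ell\ge 0$) put $k_j=\lambda_j+j-1$, $\varphi_\lambda=\operatorname{Wr}[\varphi_{k_1},\dots,\varphi_{k_\ell}]$ (with $\varphi_\lambda=1$ for $\ell=0$) and $\varphi_{\lambda,m}=\operatorname{Wr}[\varphi_{k_1},\dots,\varphi_{k_\ell},\varphi_m]$. Assume that the sequence $\{\varphi_n\}$ is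 semi-degenerate: for every partition $\lambda$ and all distinct integers $m,n\ge0$ not among $k_1,\dots,k_\ell$, a point $x^*\in(-a,a)$ with $\varphi_\lambda(x^*)=\varphi_{\lambda,m}(x^*)=0$ or with $\varphi_{\lambda,m}(x^*)=\varphi_{\lambda,n}(x^*)=0$ must be $x^*=0$. Then for every partition $\lambda=(\lambda_1,\dots,\lambda_\ell)$, with $d_\lambda$ the number of odd $k_j$ minus the number of even $k_j$: (i) $\varphi_\lambda$ vanishes at $x=0$ to order exactly $\frac{d_\lambda(d_\lambda+1)}2$ (order $0$ meaning that $0$ is not a root); (ii) $\varphi_\lambda$ has exactly $$n_+(\varphi_\lambda)=\frac12\left(\sum_{i=1}^{\ell}(-1)^{\ell-i}\lambda_i-\frac{\left|d_\lambda+\left(\ell-2\lfloor \ell/2\rfloor\right)\right|}{2}\right)$$ roots in $(0,a)$, and all of them are simple; (iii) $\varphi_\lambda$ has exactly $n_+(\varphi_\lambda)$ roots in $(-a,0)$, and all of them are simple. -/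

import Mathlib

open Filter Topology MeasureTheory
open scoped ContDiff

/-- The open interval `(a, b)` of real numbers; the endpoints may be infinite. -/
def realIoo (a b : EReal) : Set ℝ := {x : ℝ | a < (x : EReal) ∧ (x : EReal) < b}

/-- The filter of real numbers tending to the left endpoint `a` from inside
(`𝓝[>] a` for real `a`, `atBot` for `a = -∞`). -/
noncomputable def leftEnd (a : EReal) : Filter ℝ := comap ((↑) : ℝ → EReal) (𝓝[>] a)

/-- The filter of real numbers tending to the right endpoint `b` from inside
(`𝓝[<] b` for real `b`, `atTop` for `b = +∞`). -/
noncomputable def rightEnd (b : EReal) : Filter ℝ := comap ((↑) : ℝ → EReal) (𝓝[<] b)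

/-- The Schrödinger differential expression `H[f] = -f'' + V f`. -/
noncomputable def schrodingerOp (V f : ℝ → ℝ) (x : ℝ) : ℝ :=
  -deriv (deriv f) x + V x * f x

/-- A Hamiltonian on `L²(a, b)`: the expression `H[f] = -f'' + V f` on a domain of `C²` functions
on which it is a symmetric operator, the boundary conditions that cut out the domain being
conditions at each of the two endpoints separately. The latter is the field `cutoff_mem`:
multiplying by a smooth function that is constant near either endpoint does not leave the domain.
(Functions live on `ℝ`; their values outside `(a, b)` play no role.) -/
structure Hamiltonian (V : ℝ → ℝ) (a b : EReal) where
  /-- the domain of the operator -/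
  domain : Submodule ℝ (ℝ → ℝ)
  contDiffOn : ∀ f ∈ domain, ContDiffOn ℝ 2 f (realIoo a b)
  memLp : ∀ f ∈ domain, MemLp f 2 (volume.restrict (realIoo a b))
  memLp_op : ∀ f ∈ domain, MemLp (schrodingerOp V f) 2 (volume.restrict (realIoo a b))
  symm : ∀ f ∈ domain, ∀ g ∈ domain,
    ∫ x in realIoo a b, schrodingerOp V f x * g x = ∫ x in realIoo a b, f x * schrodingerOp V g x
  cutoff_mem : ∀ f ∈ domain, ∀ χ : ℝ → ℝ, ContDiff ℝ ∞ χ → HasCompactSupport (deriv χ) →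
    tsupport (deriv χ) ⊆ realIoo a b → (fun x => χ x * f x) ∈ domain

/-- `H` has pure-point spectrum, given by the square integrable eigenfunctions `φ 0, φ 1, …` with
eigenvalues `E 0 < E 1 < …`, and the eigenfunctions vanish (as limits) at both endpoints.
Pure-point spectrum means that the eigenfunctions are complete in `L²(a, b)`; they are orthogonal
because `H` is symmetric, and `H` is then essentially self-adjoint. -/
structure IsEigenfunctionSequence {V : ℝ → ℝ} {a b : EReal} (H : Hamiltonian V a b)
    (E : ℕ → ℝ) (φ : ℕ → ℝ → ℝ) : Prop where
  strictMono : StrictMono E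
  mem_domain : ∀ n, φ n ∈ H.domain
  ne_zero : ∀ n, ∃ x ∈ realIoo a b, φ n x ≠ 0
  eigen : ∀ n, ∀ x ∈ realIoo a b, schrodingerOp V (φ n) x = E n * φ n x
  tendsto_left : ∀ n, Tendsto (φ n) (leftEnd a) (𝓝 0)
  tendsto_right : ∀ n, Tendsto (φ n) (rightEnd b) (𝓝 0)
  complete : ∀ f : ℝ → ℝ, MemLp f 2 (volume.restrict (realIoo a b)) →
    (∀ n, ∫ x in realIoo a b, f x * φ n x = 0) → f =ᵐ[volume.restrict (realIoo a b)] 0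

/-- The Wronskian determinant `Wr[f_{k 0}, …, f_{k (ℓ-1)}]` (equal to `1` for `ℓ = 0`). -/
noncomputable def wronskian (f : ℕ → ℝ → ℝ) {ℓ : ℕ} (k : Fin ℓ → ℕ) (x : ℝ) : ℝ :=
  (Matrix.of fun i j : Fin ℓ => iteratedDeriv (i : ℕ) (f (k j)) x).det

/-- The indices `k_j = λ_j + j - 1` (with `j = 1, …, ℓ`) attached to the partition
`λ_1 ≤ … ≤ λ_ℓ`; here `j` is counted from `0`. -/
def partitionIndex {ℓ : ℕ} (lam : Fin ℓ → ℕ) (j : Fin ℓ) : ℕ := lam j + j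

/-- `f_λ`. -/
noncomputable def wronskianPartition (f : ℕ → ℝ → ℝ) {ℓ : ℕ} (lam : Fin ℓ → ℕ) : ℝ → ℝ :=
  wronskian f (partitionIndex lam)

/-- `f_{λ,m} = Wr[f_{k_1}, …, f_{k_ℓ}, f_m]`. -/
noncomputable def wronskianPartitionSnoc (f : ℕ → ℝ → ℝ) {ℓ : ℕ} (lam : Fin ℓ → ℕ) (m : ℕ) :
    ℝ → ℝ :=
  wronskian f (Fin.snoc (α := fun _ => ℕ) (partitionIndex lam) m)

/-- Semi-degenerate sequences of functions on `(-a, a)`. The integers `m ≠ n` are taken outside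
`{k_1, …, k_ℓ}`: otherwise `f_{λ,m}` vanishes identically or the two functions coincide. -/
def SemiDegenerate (a : EReal) (f : ℕ → ℝ → ℝ) : Prop :=
  ∀ (ℓ : ℕ) (lam : Fin ℓ → ℕ), Monotone lam →
    ∀ m n : ℕ, m ∉ Set.range (partitionIndex lam) → n ∉ Set.range (partitionIndex lam) → m ≠ n →
      (∀ x ∈ realIoo (-a) a,
        wronskianPartition f lam x = 0 → wronskianPartitionSnoc f lam m x = 0 → x = 0) ∧
      (∀ x ∈ realIoo (-a) a,
        wronskianPartitionSnoc f lam m x = 0 → wronskianPartitionSnoc f lam n x = 0 → x = 0)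

/-- `d_λ`: the number of odd `k_j` minus the number of even `k_j`. -/
def dIndex {ℓ : ℕ} (lam : Fin ℓ → ℕ) : ℤ :=
  ((Finset.univ.filter fun j => Odd (partitionIndex lam j)).card : ℤ) -
    ((Finset.univ.filter fun j => Even (partitionIndex lam j)).card : ℤ)

/-- `n_+ = (∑_{i=1}^ℓ (-1)^(ℓ-i) λ_i - |d_λ + (ℓ - 2⌊ℓ/2⌋)| / 2) / 2`. -/
def nPlus {ℓ : ℕ} (lam : Fin ℓ → ℕ) : ℚ :=
  1 / 2 * ((∑ i : Fin ℓ, (-1 : ℚ) ^ (ℓ - ((i : ℕ) + 1)) * (lam i : ℚ)) -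
    |(dIndex lam : ℚ) + ((ℓ : ℚ) - 2 * ((ℓ / 2 : ℕ) : ℚ))| / 2)

/-- `f` vanishes at `x` to order exactly `m` (multiplicity `0` means that `x` is not a root). -/
def HasRootOfMultiplicity (f : ℝ → ℝ) (x : ℝ) (m : ℕ) : Prop :=
  ContDiffAt ℝ m f x ∧ (∀ i < m, iteratedDeriv i f x = 0) ∧ iteratedDeriv m f x ≠ 0

/-- `f` has exactly `N` roots in the set `S`, and all of them are simple. -/
def HasSimpleRootsIn (f : ℝ → ℝ) (S : Set ℝ) (N : ℕ) : Prop :=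
  {x ∈ S | f x = 0}.Finite ∧ {x ∈ S | f x = 0}.ncard = N ∧
    ∀ x ∈ S, f x = 0 → HasRootOfMultiplicity f x 1

/-! ### Determinants bordered by one or two rows and columns -/

/-- The minor of the array `A` with rows `ρ` and columns `k`. -/
noncomputable def minorDet (A : ℕ → ℕ → ℝ) {ℓ : ℕ} (ρ k : Fin ℓ → ℕ) : ℝ :=
  (Matrix.of fun i j : Fin ℓ => A (ρ i) (k j)).det

/-- Append `m` to the tuple `k`. -/
abbrev tupleSnoc {ℓ : ℕ} (k : Fin ℓ → ℕ) (m : ℕ) : Fin (ℓ + 1) → ℕ :=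
  Fin.snoc (α := fun _ => ℕ) k m

theorem exists_minorDet_snoc (A : ℕ → ℕ → ℝ) {ℓ : ℕ} (ρ k : Fin ℓ → ℕ)
    (h : minorDet A ρ k ≠ 0) :
    ∃ s : ℕ → ℕ → ℝ,
      (∀ r m, minorDet A (tupleSnoc ρ r) (tupleSnoc k m) = minorDet A ρ k * s r m) ∧
      (∀ r r' n m, minorDet A (tupleSnoc (tupleSnoc ρ r) r') (tupleSnoc (tupleSnoc k n) m) =
        minorDet A ρ k * (s r n * s r' m - s r m * s r' n)) := by
  set M : Matrix (Fin ℓ) (Fin ℓ) ℝ := Matrix.of fun i j : Fin ℓ => A (ρ i) (k j) with hM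
  have : Invertible M := Matrix.invertibleOfIsUnitDet M (Ne.isUnit h)
  refine ⟨fun r m => A r m - ∑ j, (∑ i, A r (k i) * (⅟M) i j) * A (ρ j) m, ?_, ?_⟩
  · intro r m
    have key := Matrix.det_fromBlocks₁₁ M (Matrix.of fun (i : Fin ℓ) (_ : Fin 1) => A (ρ i) m)
      (Matrix.of fun (_ : Fin 1) (j : Fin ℓ) => A r (k j))
      (Matrix.of fun (_ : Fin 1) (_ : Fin 1) => A r m)
    rw [Matrix.det_fin_one] at key
    have e : minorDet A (tupleSnoc ρ r) (tupleSnoc k m) = (Matrix.fromBlocks M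
        (Matrix.of fun (i : Fin ℓ) (_ : Fin 1) => A (ρ i) m)
        (Matrix.of fun (_ : Fin 1) (j : Fin ℓ) => A r (k j))
        (Matrix.of fun (_ : Fin 1) (_ : Fin 1) => A r m)).det := by
      rw [minorDet, ← Matrix.det_submatrix_equiv_self finSumFinEquiv]
      congr 1
      ext i j
      have hc : ∀ i : Fin ℓ, Fin.castAdd 1 i = i.castSucc := fun i => rfl
      have hl : ∀ i : Fin 1, Fin.natAdd ℓ i = Fin.last ℓ := fun i => by
        have := Subsingleton.elim i 0
        subst this; rfl
      rcases i with i | i <;> rcases j with j | j <;>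
        simp [hM, hc, hl, tupleSnoc]
    rw [e, key]
    simp [minorDet, hM, Matrix.mul_apply]
  · intro r r' n m
    have key := Matrix.det_fromBlocks₁₁ M
      (Matrix.of fun (i : Fin ℓ) (c : Fin 2) => A (ρ i) (![n, m] c))
      (Matrix.of fun (c : Fin 2) (j : Fin ℓ) => A (![r, r'] c) (k j))
      (Matrix.of fun (c : Fin 2) (d : Fin 2) => A (![r, r'] c) (![n, m] d))
    rw [Matrix.det_fin_two] at key
    have e : minorDet A (tupleSnoc (tupleSnoc ρ r) r') (tupleSnoc (tupleSnoc k n) m) =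
        (Matrix.fromBlocks M
        (Matrix.of fun (i : Fin ℓ) (c : Fin 2) => A (ρ i) (![n, m] c))
        (Matrix.of fun (c : Fin 2) (j : Fin ℓ) => A (![r, r'] c) (k j))
        (Matrix.of fun (c : Fin 2) (d : Fin 2) => A (![r, r'] c) (![n, m] d))).det := by
      rw [minorDet, ← Matrix.det_submatrix_equiv_self
        (finSumFinEquiv : Fin ℓ ⊕ Fin 2 ≃ Fin (ℓ + 1 + 1))]
      congr 1
      ext i j
      have hc : ∀ i : Fin ℓ, Fin.castAdd 2 i = i.castSucc.castSucc := fun i => rfl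
      have h0 : Fin.natAdd ℓ (0 : Fin 2) = (Fin.last ℓ).castSucc := rfl
      have h1 : Fin.natAdd ℓ (1 : Fin 2) = Fin.last (ℓ + 1) := rfl
      rcases i with i | i <;> rcases j with j | j
      · simp [hM, hc, tupleSnoc]
      · fin_cases j <;> simp [hc, h0, h1, tupleSnoc]
      · fin_cases i <;> simp [hc, h0, h1, tupleSnoc]
      · fin_cases i <;> fin_cases j <;> simp [h0, h1, tupleSnoc]
    rw [e, key]
    simp [minorDet, hM, Matrix.mul_apply]

/-- The derivative of a Wronskian raises the order of differentiation in the last row. -/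
theorem hasDerivAt_wronskian (f : ℕ → ℝ → ℝ) {ℓ : ℕ} (k : Fin (ℓ + 1) → ℕ) (x : ℝ)
    (hf : ∀ i j, HasDerivAt (iteratedDeriv i (f j)) (iteratedDeriv (i + 1) (f j) x) x) :
    HasDerivAt (wronskian f k)
      (minorDet (fun i j => iteratedDeriv i (f j) x)
        (tupleSnoc (fun i : Fin ℓ => (i : ℕ)) (ℓ + 1)) k) x := by
  set M : ℝ → Matrix (Fin (ℓ + 1)) (Fin (ℓ + 1)) ℝ :=
    fun y => Matrix.of fun i j => iteratedDeriv (i : ℕ) (f (k j)) y with hM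
  set R : Fin (ℓ + 1) → Fin (ℓ + 1) → ℝ := fun i j => iteratedDeriv ((i : ℕ) + 1) (f (k j)) x
  have h1 : HasDerivAt (wronskian f k) (∑ i, ((M x).updateRow i (R i)).det) x := by
    have h2 : wronskian f k = fun y => ∑ σ : Equiv.Perm (Fin (ℓ + 1)),
        ((Equiv.Perm.sign σ : ℤ) : ℝ) * ∏ i, M y i (σ i) := by
      funext y
      rw [wronskian, ← Matrix.det_transpose, Matrix.det_apply']
      simp [hM, Matrix.transpose_apply]
    have h3 : ∑ i, ((M x).updateRow i (R i)).det = ∑ σ : Equiv.Perm (Fin (ℓ + 1)),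
        ((Equiv.Perm.sign σ : ℤ) : ℝ) *
          ∑ i, (∏ j ∈ Finset.univ.erase i, M x j (σ j)) • R i (σ i) := by
      simp_rw [Finset.mul_sum]
      rw [Finset.sum_comm]
      refine Finset.sum_congr rfl fun i _ => ?_
      rw [← Matrix.det_transpose, Matrix.det_apply']
      refine Finset.sum_congr rfl fun σ _ => ?_
      congr 1
      rw [← Finset.prod_erase_mul _ _ (Finset.mem_univ i), smul_eq_mul]
      congr 1
      · refine Finset.prod_congr rfl fun j hj => ?_
        rw [Matrix.transpose_apply, Matrix.updateRow_ne (Finset.ne_of_mem_erase hj)]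
      · rw [Matrix.transpose_apply, Matrix.updateRow_self]
    rw [h2, h3]
    refine HasDerivAt.fun_sum fun σ _ => HasDerivAt.const_mul _ ?_
    exact HasDerivAt.fun_finsetProd fun i _ => hf i (k (σ i))
  convert h1 using 1
  rw [Fin.sum_univ_castSucc, Finset.sum_eq_zero, zero_add]
  · rw [minorDet]
    congr 1
    ext i j
    refine Fin.lastCases ?_ (fun i => ?_) i
    · simp [R]
    · rw [Matrix.updateRow_ne (Fin.castSucc_lt_last i).ne]
      simp [hM]
  · intro i _
    refine Matrix.det_zero_of_row_eq (i := i.castSucc) (j := i.succ) ?_ ?_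
    · exact (Fin.castSucc_lt_succ (i := i)).ne
    · funext j
      rw [Matrix.updateRow_self, Matrix.updateRow_ne (Fin.castSucc_lt_succ (i := i)).ne']
      simp [hM, R]

theorem tupleSnoc_val (ℓ : ℕ) :
    (fun i : Fin (ℓ + 1) => (i : ℕ)) = tupleSnoc (fun i : Fin ℓ => (i : ℕ)) ℓ := by
  funext i
  refine Fin.lastCases ?_ (fun i => ?_) i <;> simp [tupleSnoc]

theorem wronskian_eq_minorDet (f : ℕ → ℝ → ℝ) {ℓ : ℕ} (k : Fin ℓ → ℕ) (x : ℝ) :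
    wronskian f k x = minorDet (fun i j => iteratedDeriv i (f j) x) (fun i => (i : ℕ)) k := rfl

/-- The Jacobi identity for Wronskians at a point where the smallest one is nonzero. -/
theorem wronskian_jacobi_of_ne_zero (f : ℕ → ℝ → ℝ) {ℓ : ℕ} (k : Fin ℓ → ℕ) (n m : ℕ) (x : ℝ)
    (hf : ∀ i j, HasDerivAt (iteratedDeriv i (f j)) (iteratedDeriv (i + 1) (f j) x) x)
    (h : wronskian f k x ≠ 0) :
    wronskian f (tupleSnoc k n) x * deriv (wronskian f (tupleSnoc k m)) x -
      deriv (wronskian f (tupleSnoc k n)) x * wronskian f (tupleSnoc k m) x =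
    wronskian f k x * wronskian f (tupleSnoc (tupleSnoc k n) m) x := by
  rw [(hasDerivAt_wronskian f (tupleSnoc k n) x hf).deriv,
    (hasDerivAt_wronskian f (tupleSnoc k m) x hf).deriv]
  simp only [wronskian_eq_minorDet, tupleSnoc_val] at h ⊢
  obtain ⟨s, h1, h2⟩ := exists_minorDet_snoc _ _ _ h
  rw [h1, h1, h1, h1, h2]
  ring

theorem wronskian_zero (f : ℕ → ℝ → ℝ) (k : Fin 0 → ℕ) : wronskian f k = fun _ => 1 := by
  funext x
  simp [wronskian]

theorem wronskian_one (f : ℕ → ℝ → ℝ) (k : Fin 1 → ℕ) : wronskian f k = f (k 0) := by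
  funext x
  simp [wronskian]

theorem wronskian_snoc_swap (f : ℕ → ℝ → ℝ) {ℓ : ℕ} (k : Fin ℓ → ℕ) (n m : ℕ) (x : ℝ) :
    wronskian f (tupleSnoc (tupleSnoc k n) m) x =
      -wronskian f (tupleSnoc (tupleSnoc k m) n) x := by
  have h := Matrix.det_permute' (Equiv.swap (Fin.last ℓ).castSucc (Fin.last (ℓ + 1)))
    (Matrix.of fun i j : Fin (ℓ + 1 + 1) =>
      iteratedDeriv (i : ℕ) (f (tupleSnoc (tupleSnoc k m) n j)) x)
  have hne : (Fin.last ℓ).castSucc ≠ Fin.last (ℓ + 1) := (Fin.castSucc_lt_last _).ne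
  rw [Equiv.Perm.sign_swap hne] at h
  simp only [Units.val_neg, Units.val_one, Int.cast_neg, Int.cast_one, neg_mul, one_mul] at h
  rw [wronskian, wronskian, ← h]
  congr 1
  ext i j
  simp only [Matrix.of_apply, Matrix.submatrix_apply, id]
  congr 2
  refine Fin.lastCases ?_ (fun j => ?_) j
  · simp [tupleSnoc]
  · refine Fin.lastCases ?_ (fun j => ?_) j
    · simp [tupleSnoc]
    · rw [Equiv.swap_apply_of_ne_of_ne]
      · simp [tupleSnoc]
      · exact fun e => (Fin.castSucc_lt_last j).ne (Fin.castSucc_injective _ e)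
      · exact (Fin.castSucc_lt_last _).ne

/-! ### Smooth functions on an open set -/

theorem ContDiffOn.deriv_smooth {I : Set ℝ} (hI : IsOpen I) {f : ℝ → ℝ}
    (hf : ContDiffOn ℝ ∞ f I) : ContDiffOn ℝ ∞ (deriv f) I :=
  hf.deriv_of_isOpen hI (by simp)

theorem ContDiffOn.iteratedDeriv_smooth {I : Set ℝ} (hI : IsOpen I) {f : ℝ → ℝ}
    (hf : ContDiffOn ℝ ∞ f I) (n : ℕ) : ContDiffOn ℝ ∞ (iteratedDeriv n f) I := by
  induction n with
  | zero => simpa using hf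
  | succ n ih => rw [iteratedDeriv_succ]; exact ih.deriv_smooth hI

theorem ContDiffOn.hasDerivAt_smooth {I : Set ℝ} (hI : IsOpen I) {f : ℝ → ℝ}
    (hf : ContDiffOn ℝ ∞ f I) {x : ℝ} (hx : x ∈ I) : HasDerivAt f (deriv f x) x :=
  ((hf.contDiffAt (hI.mem_nhds hx)).differentiableAt (by simp)).hasDerivAt

theorem ContDiffOn.wronskian_smooth {I : Set ℝ} (hI : IsOpen I) {f : ℕ → ℝ → ℝ}
    (hf : ∀ n, ContDiffOn ℝ ∞ (f n) I) {ℓ : ℕ} (k : Fin ℓ → ℕ) :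
    ContDiffOn ℝ ∞ (wronskian f k) I := by
  have h : wronskian f k = fun y => ∑ σ : Equiv.Perm (Fin ℓ),
      ((Equiv.Perm.sign σ : ℤ) : ℝ) * ∏ i, iteratedDeriv ((σ i : Fin ℓ) : ℕ) (f (k i)) y := by
    funext y
    rw [wronskian, Matrix.det_apply']
    simp
  rw [h]
  refine ContDiffOn.sum fun σ _ => contDiffOn_const.mul (contDiffOn_prod fun i _ => ?_)
  exact (hf (k i)).iteratedDeriv_smooth hI _

/-! ### Functions that are nonzero on a dense subset -/

/-- `f` does not vanish identically near any point of `I`. -/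
def FrequentlyNonzero (I : Set ℝ) (f : ℝ → ℝ) : Prop := ∀ x ∈ I, ∃ᶠ y in 𝓝 x, f y ≠ 0

theorem FrequentlyNonzero.mul {I : Set ℝ} (hI : IsOpen I) {f g : ℝ → ℝ}
    (hfc : ContinuousOn f I) (hf : FrequentlyNonzero I f) (hg : FrequentlyNonzero I g) :
    FrequentlyNonzero I fun y => f y * g y := by
  intro x hx h
  have h1 := h.eventually_nhds.and (hI.mem_nhds hx)
  obtain ⟨y, hy1, hy2, hy3⟩ := ((hf x hx).and_eventually h1).exists
  refine hg y hy3 ?_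
  filter_upwards [hy2, (hfc.continuousAt (hI.mem_nhds hy3)).eventually_ne hy1] with z hz1 hz2
  simpa [hz2] using hz1

theorem FrequentlyNonzero.eq_of_mul_eq {I : Set ℝ} (hI : IsOpen I) {f g h : ℝ → ℝ}
    (hf : FrequentlyNonzero I f) (hg : ContinuousOn g I) (hh : ContinuousOn h I)
    (H : ∀ x ∈ I, f x ≠ 0 → g x = h x) {x : ℝ} (hx : x ∈ I) : g x = h x := by
  by_contra hne
  have h1 : ∀ᶠ y in 𝓝 x, g y - h y ≠ 0 :=
    ((hg.sub hh).continuousAt (hI.mem_nhds hx)).eventually_ne (sub_ne_zero.2 hne)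
  obtain ⟨y, hy1, hy2, hy3⟩ := ((hf x hx).and_eventually (h1.and (hI.mem_nhds hx))).exists
  exact hy2 (sub_eq_zero.2 (H y hy3 hy1))

/-! ### Wronskians of eigenfunctions -/

/-- A sequence of solutions of `-f'' + V f = E n f` on the open set `I`, with distinct `E n`. -/
structure EigenSystem (I : Set ℝ) (V : ℝ → ℝ) (E : ℕ → ℝ) (φ : ℕ → ℝ → ℝ) : Prop where
  isOpen : IsOpen I
  smooth : ∀ n, ContDiffOn ℝ ∞ (φ n) I
  ode : ∀ n, ∀ x ∈ I, deriv (deriv (φ n)) x = (V x - E n) * φ n x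
  injective : Function.Injective E
  nonzero : ∀ n, FrequentlyNonzero I (φ n)

namespace EigenSystem

variable {I : Set ℝ} {V : ℝ → ℝ} {E : ℕ → ℝ} {φ : ℕ → ℝ → ℝ}

theorem wr_smooth (h : EigenSystem I V E φ) {ℓ : ℕ} (k : Fin ℓ → ℕ) :
    ContDiffOn ℝ ∞ (wronskian φ k) I :=
  ContDiffOn.wronskian_smooth h.isOpen h.smooth k

theorem wr_cont (h : EigenSystem I V E φ) {ℓ : ℕ} (k : Fin ℓ → ℕ) :
    ContinuousOn (wronskian φ k) I := (h.wr_smooth k).continuousOn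

theorem wr_deriv_cont (h : EigenSystem I V E φ) {ℓ : ℕ} (k : Fin ℓ → ℕ) :
    ContinuousOn (deriv (wronskian φ k)) I := ((h.wr_smooth k).deriv_smooth h.isOpen).continuousOn

theorem wr_hasDerivAt (h : EigenSystem I V E φ) {ℓ : ℕ} (k : Fin ℓ → ℕ) {x : ℝ} (hx : x ∈ I) :
    HasDerivAt (wronskian φ k) (deriv (wronskian φ k) x) x :=
  (h.wr_smooth k).hasDerivAt_smooth h.isOpen hx

theorem jacobi_of_nonzero (h : EigenSystem I V E φ) {ℓ : ℕ} (k : Fin ℓ → ℕ)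
    (hk : FrequentlyNonzero I (wronskian φ k)) (n m : ℕ) {x : ℝ} (hx : x ∈ I) :
    wronskian φ (tupleSnoc k n) x * deriv (wronskian φ (tupleSnoc k m)) x -
      deriv (wronskian φ (tupleSnoc k n)) x * wronskian φ (tupleSnoc k m) x =
    wronskian φ k x * wronskian φ (tupleSnoc (tupleSnoc k n) m) x := by
  refine hk.eq_of_mul_eq (g := fun x => wronskian φ (tupleSnoc k n) x *
      deriv (wronskian φ (tupleSnoc k m)) x -
      deriv (wronskian φ (tupleSnoc k n)) x * wronskian φ (tupleSnoc k m) x)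
    (h := fun x => wronskian φ k x * wronskian φ (tupleSnoc (tupleSnoc k n) m) x)
    h.isOpen ?_ ?_ ?_ hx
  · exact ((h.wr_cont _).mul (h.wr_deriv_cont _)).sub ((h.wr_deriv_cont _).mul (h.wr_cont _))
  · exact (h.wr_cont _).mul (h.wr_cont _)
  · intro y hy hne
    refine wronskian_jacobi_of_ne_zero φ k n m y (fun i j => ?_) hne
    rw [iteratedDeriv_succ]
    exact ((h.smooth j).iteratedDeriv_smooth h.isOpen i).hasDerivAt_smooth h.isOpen hy

theorem snoc_injective {ℓ : ℕ} {k : Fin ℓ → ℕ} {m : ℕ} :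
    Function.Injective (tupleSnoc k m) ↔ Function.Injective k ∧ m ∉ Set.range k :=
  Fin.snoc_injective_iff

theorem snoc_self {ℓ : ℕ} (k : Fin (ℓ + 1) → ℕ) :
    k = tupleSnoc (fun i : Fin ℓ => k i.castSucc) (k (Fin.last ℓ)) :=
  (Fin.snoc_init_self (α := fun _ => ℕ) k).symm

theorem notMem_of_notMem_snoc {ℓ : ℕ} {k : Fin ℓ → ℕ} {l m : ℕ}
    (hm : m ∉ Set.range (tupleSnoc k l)) : m ∉ Set.range k ∧ l ≠ m :=
  ⟨fun ⟨i, hi⟩ => hm ⟨i.castSucc, by simp [tupleSnoc, hi]⟩,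
    fun e => hm ⟨Fin.last ℓ, by simp [tupleSnoc, e]⟩⟩

/-- The Jacobi identity in three added indices, with the derivatives eliminated. -/
theorem three_of_dual {F F' Fl Fm Fn Flm Flm' Fln Fln' Flmn cln clm : ℝ}
    (hFl : Fl ≠ 0)
    (h1 : Flm * Fln' - Flm' * Fln = Fl * Flmn)
    (h2 : F * Flm' - F' * Flm = clm * (Fl * Fm))
    (h3 : F * Fln' - F' * Fln = cln * (Fl * Fn)) :
    F * Flmn = cln * (Fn * Flm) - clm * (Fm * Fln) := by
  apply mul_left_cancel₀ hFl
  linear_combination (-F) * h1 - Fln * h2 + Flm * h3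

/-- The statement that Wronskians of length `ℓ` satisfy the identity dual to Jacobi's. -/
def DualAt (I : Set ℝ) (E : ℕ → ℝ) (φ : ℕ → ℝ → ℝ) (ℓ : ℕ) : Prop :=
  ∀ k : Fin ℓ → ℕ, Function.Injective k → ∀ n m, n ∉ Set.range k → m ∉ Set.range k → n ≠ m →
    ∀ x ∈ I, wronskian φ k x * deriv (wronskian φ (tupleSnoc (tupleSnoc k n) m)) x -
      deriv (wronskian φ k) x * wronskian φ (tupleSnoc (tupleSnoc k n) m) x =
      (E n - E m) * (wronskian φ (tupleSnoc k n) x * wronskian φ (tupleSnoc k m) x)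

theorem nonzero_add_two (h : EigenSystem I V E φ) {ℓ : ℕ} (hd : DualAt I E φ ℓ)
    (h1 : ∀ k : Fin (ℓ + 1) → ℕ, Function.Injective k → FrequentlyNonzero I (wronskian φ k))
    (k : Fin (ℓ + 1 + 1) → ℕ) (hk : Function.Injective k) :
    FrequentlyNonzero I (wronskian φ k) := by
  obtain ⟨k', m, rfl⟩ : ∃ k' m, k = tupleSnoc k' m := ⟨_, _, snoc_self k⟩
  obtain ⟨k, n, rfl⟩ : ∃ k n, k' = tupleSnoc k n := ⟨_, _, snoc_self k'⟩
  obtain ⟨hk1, hm⟩ := snoc_injective.1 hk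
  obtain ⟨hk2, hn⟩ := snoc_injective.1 hk1
  obtain ⟨hm', hnm⟩ := notMem_of_notMem_snoc hm
  have hPQ := FrequentlyNonzero.mul h.isOpen (h.wr_cont (tupleSnoc k n)) (h1 _ hk1)
    (h1 (tupleSnoc k m) (snoc_injective.2 ⟨hk2, hm'⟩))
  intro x hx hG
  simp only [not_not] at hG
  refine hPQ x hx ?_
  filter_upwards [hG, hG.eventually_nhds, h.isOpen.mem_nhds hx] with y hy1 hy2 hy3
  have hy4 : deriv (wronskian φ (tupleSnoc (tupleSnoc k n) m)) y = 0 := by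
    have : wronskian φ (tupleSnoc (tupleSnoc k n) m) =ᶠ[𝓝 y] fun _ => 0 := hy2
    rw [this.deriv_eq]; simp
  have := hd k hk2 n m hn hm' hnm y hy3
  rw [hy4, hy1] at this
  have hc : E n - E m ≠ 0 := sub_ne_zero.2 fun e => hnm (h.injective e)
  rw [mul_zero, mul_zero, sub_zero] at this
  exact not_not.2 ((mul_eq_zero.1 this.symm).resolve_left hc)

theorem dualAt_zero (h : EigenSystem I V E φ) : DualAt I E φ 0 := by
  intro k _ n m _ _ _ x hx
  have e1 : ∀ n, wronskian φ (tupleSnoc k n) = φ n := fun n => by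
    rw [wronskian_one]; rfl
  have e0 := wronskian_zero φ k
  have hG : ∀ y ∈ I, φ n y * deriv (φ m) y - deriv (φ n) y * φ m y =
      wronskian φ (tupleSnoc (tupleSnoc k n) m) y := by
    intro y hy
    have := h.jacobi_of_nonzero k (by rw [e0]; intro x _; simp) n m hy
    simpa [e1, e0] using this
  have hG' : HasDerivAt (fun y => φ n y * deriv (φ m) y - deriv (φ n) y * φ m y)
      ((E n - E m) * (φ n x * φ m x)) x := by
    have a := fun j => (h.smooth j).hasDerivAt_smooth h.isOpen hx
    have b := fun j => ((h.smooth j).deriv_smooth h.isOpen).hasDerivAt_smooth h.isOpen hx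
    have := ((a n).fun_mul (b m)).fun_sub ((b n).fun_mul (a m))
    rw [h.ode n x hx, h.ode m x hx] at this
    refine this.congr_deriv ?_
    ring
  have hG2 := hG'.congr_of_eventuallyEq (f₁ := wronskian φ (tupleSnoc (tupleSnoc k n) m))
    (by filter_upwards [h.isOpen.mem_nhds hx] with y hy using (hG y hy).symm)
  rw [hG2.deriv, e0, e1, e1]
  simp

theorem three_of_dualAt (h : EigenSystem I V E φ) {ℓ : ℕ} (hd : DualAt I E φ ℓ)
    (h0 : ∀ k : Fin ℓ → ℕ, Function.Injective k → FrequentlyNonzero I (wronskian φ k))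
    (h1 : ∀ k : Fin (ℓ + 1) → ℕ, Function.Injective k → FrequentlyNonzero I (wronskian φ k))
    {k : Fin ℓ → ℕ} {l m n : ℕ} (hk' : Function.Injective (tupleSnoc k l))
    (hm : m ∉ Set.range (tupleSnoc k l)) (hn : n ∉ Set.range (tupleSnoc k l))
    {x : ℝ} (hx : x ∈ I) :
    wronskian φ k x * wronskian φ (tupleSnoc (tupleSnoc (tupleSnoc k l) m) n) x
      = (E l - E n) * (wronskian φ (tupleSnoc k n) x * wronskian φ (tupleSnoc (tupleSnoc k l) m) x)
      - (E l - E m) * (wronskian φ (tupleSnoc k m) x *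
          wronskian φ (tupleSnoc (tupleSnoc k l) n) x) := by
  obtain ⟨hk, hl⟩ := snoc_injective.1 hk'
  obtain ⟨hm', hlm⟩ := notMem_of_notMem_snoc hm
  obtain ⟨hn', hln⟩ := notMem_of_notMem_snoc hn
  have hFF := FrequentlyNonzero.mul h.isOpen (h.wr_cont k) (h0 k hk) (h1 _ hk')
  refine hFF.eq_of_mul_eq h.isOpen
    (g := fun y => wronskian φ k y * wronskian φ (tupleSnoc (tupleSnoc (tupleSnoc k l) m) n) y)
    (h := fun y => (E l - E n) * (wronskian φ (tupleSnoc k n) y *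
      wronskian φ (tupleSnoc (tupleSnoc k l) m) y)
    - (E l - E m) * (wronskian φ (tupleSnoc k m) y *
        wronskian φ (tupleSnoc (tupleSnoc k l) n) y)) ?_ ?_ ?_ hx
  · exact (h.wr_cont _).mul (h.wr_cont _)
  · exact (continuousOn_const.mul ((h.wr_cont _).mul (h.wr_cont _))).sub
      (continuousOn_const.mul ((h.wr_cont _).mul (h.wr_cont _)))
  · intro z hz hne
    exact three_of_dual (right_ne_zero_of_mul hne)
      (h.jacobi_of_nonzero (tupleSnoc k l) (h1 _ hk') m n hz)
      (hd k hk l m hl hm' hlm z hz) (hd k hk l n hl hn' hln z hz)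

theorem dualAt_succ (h : EigenSystem I V E φ) {ℓ : ℕ} (hd : DualAt I E φ ℓ)
    (h0 : ∀ k : Fin ℓ → ℕ, Function.Injective k → FrequentlyNonzero I (wronskian φ k))
    (h1 : ∀ k : Fin (ℓ + 1) → ℕ, Function.Injective k → FrequentlyNonzero I (wronskian φ k)) :
    DualAt I E φ (ℓ + 1) := by
  intro k' hk' m n hm hn hmn
  obtain ⟨k, l, rfl⟩ : ∃ k n, k' = tupleSnoc k n := ⟨_, _, snoc_self k'⟩
  obtain ⟨hk, hl⟩ := snoc_injective.1 hk'
  obtain ⟨hm', hlm⟩ := notMem_of_notMem_snoc hm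
  obtain ⟨hn', hln⟩ := notMem_of_notMem_snoc hn
  have hFF := FrequentlyNonzero.mul h.isOpen (h.wr_cont k) (h0 k hk) (h1 _ hk')
  have three := fun y hy => h.three_of_dualAt hd h0 h1 hk' hm hn (x := y) hy
  intro x hx
  refine hFF.eq_of_mul_eq h.isOpen
    (g := fun x => wronskian φ (tupleSnoc k l) x *
      deriv (wronskian φ (tupleSnoc (tupleSnoc (tupleSnoc k l) m) n)) x -
      deriv (wronskian φ (tupleSnoc k l)) x *
        wronskian φ (tupleSnoc (tupleSnoc (tupleSnoc k l) m) n) x)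
    (h := fun x => (E m - E n) * (wronskian φ (tupleSnoc (tupleSnoc k l) m) x *
      wronskian φ (tupleSnoc (tupleSnoc k l) n) x)) ?_ ?_ ?_ hx
  · exact ((h.wr_cont _).mul (h.wr_deriv_cont _)).sub ((h.wr_deriv_cont _).mul (h.wr_cont _))
  · exact continuousOn_const.mul ((h.wr_cont _).mul (h.wr_cont _))
  · intro y hy hne
    have hF := left_ne_zero_of_mul hne
    have t := three y hy
    have t' : deriv (wronskian φ k) y * wronskian φ (tupleSnoc (tupleSnoc (tupleSnoc k l) m) n) y +
        wronskian φ k y * deriv (wronskian φ (tupleSnoc (tupleSnoc (tupleSnoc k l) m) n)) y =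
        (E l - E n) * (deriv (wronskian φ (tupleSnoc k n)) y *
          wronskian φ (tupleSnoc (tupleSnoc k l) m) y + wronskian φ (tupleSnoc k n) y *
          deriv (wronskian φ (tupleSnoc (tupleSnoc k l) m)) y) -
        (E l - E m) * (deriv (wronskian φ (tupleSnoc k m)) y *
          wronskian φ (tupleSnoc (tupleSnoc k l) n) y + wronskian φ (tupleSnoc k m) y *
          deriv (wronskian φ (tupleSnoc (tupleSnoc k l) n)) y) := by
      have d1 := (h.wr_hasDerivAt k hy).mul
        (h.wr_hasDerivAt (tupleSnoc (tupleSnoc (tupleSnoc k l) m) n) hy)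
      have d2 := (((h.wr_hasDerivAt (tupleSnoc k n) hy).mul
          (h.wr_hasDerivAt (tupleSnoc (tupleSnoc k l) m) hy)).const_mul (E l - E n)).sub
        (((h.wr_hasDerivAt (tupleSnoc k m) hy).mul
          (h.wr_hasDerivAt (tupleSnoc (tupleSnoc k l) n) hy)).const_mul (E l - E m))
      refine d1.unique (d2.congr_of_eventuallyEq ?_)
      filter_upwards [h.isOpen.mem_nhds hy] with z hz using three z hz
    have j1 := h.jacobi_of_nonzero k (h0 k hk) l m hy
    have j2 := h.jacobi_of_nonzero k (h0 k hk) l n hy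
    have e1 := hd k hk l m hl hm' hlm y hy
    have e2 := hd k hk l n hl hn' hln y hy
    generalize wronskian φ k y = F at *
    generalize deriv (wronskian φ k) y = F' at *
    generalize wronskian φ (tupleSnoc k l) y = Fl at *
    generalize deriv (wronskian φ (tupleSnoc k l)) y = Fl' at *
    generalize wronskian φ (tupleSnoc k m) y = Fm at *
    generalize deriv (wronskian φ (tupleSnoc k m)) y = Fm' at *
    generalize wronskian φ (tupleSnoc k n) y = Fn at *
    generalize deriv (wronskian φ (tupleSnoc k n)) y = Fn' at *
    generalize wronskian φ (tupleSnoc (tupleSnoc k l) m) y = Flm at *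
    generalize deriv (wronskian φ (tupleSnoc (tupleSnoc k l) m)) y = Flm' at *
    generalize wronskian φ (tupleSnoc (tupleSnoc k l) n) y = Fln at *
    generalize deriv (wronskian φ (tupleSnoc (tupleSnoc k l) n)) y = Fln' at *
    generalize wronskian φ (tupleSnoc (tupleSnoc (tupleSnoc k l) m) n) y = G at *
    generalize deriv (wronskian φ (tupleSnoc (tupleSnoc (tupleSnoc k l) m) n)) y = G' at *
    have hF2 : F * F ≠ 0 := mul_ne_zero hF hF
    apply mul_left_cancel₀ hF2
    linear_combination (F * Fl) * t' - (Fl * F' + F * Fl') * t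
      + (E l - E n) * F * Flm * j2 - (E l - E m) * F * Fln * j1
      + (E l - E n) * Fl * Fn * e1 - (E l - E m) * Fl * Fm * e2

theorem dual_and_nonzero (h : EigenSystem I V E φ) (ℓ : ℕ) :
    DualAt I E φ ℓ ∧
    (∀ k : Fin ℓ → ℕ, Function.Injective k → FrequentlyNonzero I (wronskian φ k)) ∧
    (∀ k : Fin (ℓ + 1) → ℕ, Function.Injective k → FrequentlyNonzero I (wronskian φ k)) := by
  induction ℓ with
  | zero =>
    refine ⟨h.dualAt_zero, fun k _ => ?_, fun k _ => ?_⟩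
    · rw [wronskian_zero]; intro x _; simp
    · rw [wronskian_one]; exact h.nonzero _
  | succ ℓ ih =>
    obtain ⟨hd, h0, h1⟩ := ih
    exact ⟨h.dualAt_succ hd h0 h1, h1, h.nonzero_add_two hd h1⟩

theorem wr_nonzero (h : EigenSystem I V E φ) {ℓ : ℕ} {k : Fin ℓ → ℕ}
    (hk : Function.Injective k) : FrequentlyNonzero I (wronskian φ k) :=
  (h.dual_and_nonzero ℓ).2.1 k hk

/-- The Jacobi identity `Q P' - Q' P = F G`. -/
theorem jacobi (h : EigenSystem I V E φ) {ℓ : ℕ} {k : Fin ℓ → ℕ}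
    (hk : Function.Injective k) (n m : ℕ) {x : ℝ} (hx : x ∈ I) :
    wronskian φ (tupleSnoc k n) x * deriv (wronskian φ (tupleSnoc k m)) x -
      deriv (wronskian φ (tupleSnoc k n)) x * wronskian φ (tupleSnoc k m) x =
    wronskian φ k x * wronskian φ (tupleSnoc (tupleSnoc k n) m) x :=
  h.jacobi_of_nonzero k (h.wr_nonzero hk) n m hx

/-- The dual identity `F G' - F' G = (E n - E m) Q P`. -/
theorem dual (h : EigenSystem I V E φ) {ℓ : ℕ} {k : Fin ℓ → ℕ}
    (hk : Function.Injective k) {n m : ℕ} (hn : n ∉ Set.range k) (hm : m ∉ Set.range k)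
    (hnm : n ≠ m) {x : ℝ} (hx : x ∈ I) :
    wronskian φ k x * deriv (wronskian φ (tupleSnoc (tupleSnoc k n) m)) x -
      deriv (wronskian φ k) x * wronskian φ (tupleSnoc (tupleSnoc k n) m) x =
      (E n - E m) * (wronskian φ (tupleSnoc k n) x * wronskian φ (tupleSnoc k m) x) :=
  (h.dual_and_nonzero ℓ).1 k hk n m hn hm hnm x hx

/-- The Jacobi identity for three added indices, `F F_{lmn} = …`. -/
theorem three_term (h : EigenSystem I V E φ) {ℓ : ℕ} {k : Fin ℓ → ℕ} {l m n : ℕ}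
    (hk' : Function.Injective (tupleSnoc k l))
    (hm : m ∉ Set.range (tupleSnoc k l)) (hn : n ∉ Set.range (tupleSnoc k l))
    {x : ℝ} (hx : x ∈ I) :
    wronskian φ k x * wronskian φ (tupleSnoc (tupleSnoc (tupleSnoc k l) m) n) x
      = (E l - E n) * (wronskian φ (tupleSnoc k n) x * wronskian φ (tupleSnoc (tupleSnoc k l) m) x)
      - (E l - E m) * (wronskian φ (tupleSnoc k m) x *
          wronskian φ (tupleSnoc (tupleSnoc k l) n) x) :=
  have hd := h.dual_and_nonzero ℓ
  h.three_of_dualAt hd.1 hd.2.1 hd.2.2 hk' hm hn hx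

end EigenSystem

/-! ### The right endpoint of an interval -/

theorem eventually_rightEnd_iff {a : EReal} (ha : ⊥ < a) {p : ℝ → Prop} :
    (∀ᶠ x in rightEnd a, p x) ↔ ∃ c : ℝ, (c : EReal) < a ∧ ∀ x ∈ realIoo c a, p x := by
  rw [rightEnd, eventually_comap, eventually_iff, mem_nhdsLT_iff_exists_Ioo_subset' ha]
  constructor
  · rintro ⟨l, hl, hs⟩
    obtain ⟨c, hc1, hc2⟩ := EReal.lt_iff_exists_real_btwn.1 hl
    exact ⟨c, hc2, fun x hx => hs ⟨hc1.trans hx.1, hx.2⟩ x rfl⟩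
  · rintro ⟨c, hc, h⟩
    refine ⟨c, hc, ?_⟩
    rintro _ ⟨h1, h2⟩ x rfl
    exact h x ⟨h1, h2⟩

theorem exists_mem_realIoo {a b : EReal} (h : a < b) : (realIoo a b).Nonempty := by
  obtain ⟨c, hc1, hc2⟩ := EReal.lt_iff_exists_real_btwn.1 h
  exact ⟨c, hc1, hc2⟩

theorem rightEnd_neBot {a : EReal} (ha : ⊥ < a) : (rightEnd a).NeBot := by
  rw [← frequently_true_iff_neBot]
  intro h
  obtain ⟨c, hc, h⟩ := (eventually_rightEnd_iff ha).1 h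
  obtain ⟨x, hx⟩ := exists_mem_realIoo hc
  exact h x hx trivial

theorem isOpen_realIoo (a b : EReal) : IsOpen (realIoo a b) :=
  isOpen_Ioo.preimage continuous_coe_real_ereal

theorem ordConnected_realIoo (a b : EReal) : (realIoo a b).OrdConnected :=
  ⟨fun _ hx _ hy _ hz => ⟨hx.1.trans_le (EReal.coe_le_coe_iff.2 hz.1),
    (EReal.coe_le_coe_iff.2 hz.2).trans_lt hy.2⟩⟩

theorem convex_realIoo (a b : EReal) : Convex ℝ (realIoo a b) :=
  (ordConnected_realIoo a b).convex

theorem mem_realIoo_coe {c x : ℝ} {a : EReal} : x ∈ realIoo c a ↔ c < x ∧ (x : EReal) < a := by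
  simp [realIoo]

/-- A function with nonvanishing derivative on an interval is strictly monotone there. -/
theorem strictMonoOn_or_strictAntiOn_of_deriv_ne_zero {s : Set ℝ} (hs : Convex ℝ s)
    {u u' : ℝ → ℝ} (hu : ContinuousOn u s) (hd : ∀ x ∈ interior s, HasDerivAt u (u' x) x)
    (hne : ∀ x ∈ interior s, u' x ≠ 0) :
    ((∀ x ∈ interior s, 0 < u' x) ∧ StrictMonoOn u s) ∨
      ((∀ x ∈ interior s, u' x < 0) ∧ StrictAntiOn u s) := by
  rcases hasDerivWithinAt_forall_lt_or_forall_gt_of_forall_ne (m := 0) hs.interior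
    (fun x hx => (hd x hx).hasDerivWithinAt) hne with h | h
  · right
    exact ⟨h, strictAntiOn_of_deriv_neg hs hu fun x hx => by rw [(hd x hx).deriv]; exact h x hx⟩
  · left
    exact ⟨h, strictMonoOn_of_deriv_pos hs hu fun x hx => by rw [(hd x hx).deriv]; exact h x hx⟩

/-- Rolle's theorem on `[x, a)` for a function that vanishes at `x` and tends to `0` at `a`. -/
theorem exists_deriv_eq_zero_of_tendsto_rightEnd {a : EReal} (ha : ⊥ < a) {u u' : ℝ → ℝ} {x : ℝ}
    (hxa : (x : EReal) < a) (hux : u x = 0) (hd : ∀ t, x ≤ t → (t : EReal) < a → HasDerivAt u (u' t) t)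
    (hlim : Tendsto u (rightEnd a) (𝓝 0)) : ∃ t ∈ realIoo x a, u' t = 0 := by
  by_contra! hne
  set s : Set ℝ := {t | x ≤ t ∧ (t : EReal) < a} with hs
  have hconv : Convex ℝ s := Set.OrdConnected.convex
    ⟨fun p hp q hq r hr => ⟨hp.1.trans hr.1, (EReal.coe_le_coe_iff.2 hr.2).trans_lt hq.2⟩⟩
  have hint : interior s ⊆ realIoo x a := fun t ht => by
    have h1 : t ∈ interior (Set.Ici x) := interior_mono (fun t ht => ht.1) ht
    rw [interior_Ici] at h1
    exact mem_realIoo_coe.2 ⟨h1, (interior_subset ht).2⟩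
  obtain ⟨y, hy⟩ := exists_mem_realIoo hxa
  have hy' := mem_realIoo_coe.1 hy
  have := rightEnd_neBot ha
  have hev : ∀ᶠ t in rightEnd a, y < t ∧ (t : EReal) < a :=
    (eventually_rightEnd_iff ha).2 ⟨y, hy.2, fun t ht => mem_realIoo_coe.1 ht⟩
  rcases strictMonoOn_or_strictAntiOn_of_deriv_ne_zero (u := u) (u' := u') hconv
    (fun t ht => (hd t ht.1 ht.2).continuousAt.continuousWithinAt)
    (fun t ht => hd t (mem_realIoo_coe.1 (hint ht)).1.le (hint ht).2)
    (fun t ht => hne t (hint ht)) with ⟨-, h⟩ | ⟨-, h⟩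
  · have h1 : u x < u y := h ⟨le_rfl, hxa⟩ ⟨hy'.1.le, hy'.2⟩ hy'.1
    have h2 : u y ≤ 0 := ge_of_tendsto hlim (hev.mono fun t ht =>
      (h ⟨hy'.1.le, hy'.2⟩ ⟨hy'.1.le.trans ht.1.le, ht.2⟩ ht.1).le)
    linarith
  · have h1 : u y < u x := h ⟨le_rfl, hxa⟩ ⟨hy'.1.le, hy'.2⟩ hy'.1
    have h2 : 0 ≤ u y := le_of_tendsto hlim (hev.mono fun t ht =>
      (h ⟨hy'.1.le, hy'.2⟩ ⟨hy'.1.le.trans ht.1.le, ht.2⟩ ht.1).le)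
    linarith

/-- If `u → 0` at the right end and `u' ≠ 0`, then `|u|` is decreasing. -/
theorem mul_deriv_neg_of_tendsto_rightEnd {a : EReal} (ha : ⊥ < a) {u u' : ℝ → ℝ} {c : ℝ}
    (hd : ∀ t ∈ realIoo c a, HasDerivAt u (u' t) t) (hne : ∀ t ∈ realIoo c a, u' t ≠ 0)
    (hlim : Tendsto u (rightEnd a) (𝓝 0)) : ∀ x ∈ realIoo c a, u x * u' x < 0 := by
  intro x hx
  have hsub : ∀ t, x ≤ t → (t : EReal) < a → t ∈ realIoo c a := fun t h1 h2 =>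
    mem_realIoo_coe.2 ⟨(mem_realIoo_coe.1 hx).1.trans_le h1, h2⟩
  have hux : u x ≠ 0 := fun h0 => by
    obtain ⟨t, ht, h⟩ := exists_deriv_eq_zero_of_tendsto_rightEnd ha hx.2 h0
      (fun t h1 h2 => hd t (hsub t h1 h2)) hlim
    exact hne t (hsub t (mem_realIoo_coe.1 ht).1.le ht.2) h
  have := rightEnd_neBot ha
  have hev : ∀ᶠ t in rightEnd a, x < t ∧ t ∈ realIoo c a :=
    (eventually_rightEnd_iff ha).2 ⟨x, hx.2, fun t ht =>
      ⟨(mem_realIoo_coe.1 ht).1, hsub t (mem_realIoo_coe.1 ht).1.le ht.2⟩⟩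
  have hint : interior (realIoo c a) = realIoo c a := (isOpen_realIoo _ _).interior_eq
  rcases strictMonoOn_or_strictAntiOn_of_deriv_ne_zero (u := u) (u' := u') (convex_realIoo c a)
    (fun t ht => (hd t ht).continuousAt.continuousWithinAt)
    (by rwa [hint]) (by rwa [hint]) with ⟨h, hm⟩ | ⟨h, hm⟩
  · have h2 : u x ≤ 0 := ge_of_tendsto hlim (hev.mono fun t ht => (hm hx ht.2 ht.1).le)
    exact mul_neg_of_neg_of_pos (lt_of_le_of_ne h2 hux) (h x (by rwa [hint]))
  · have h2 : 0 ≤ u x := le_of_tendsto hlim (hev.mono fun t ht => (hm hx ht.2 ht.1).le)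
    exact mul_neg_of_pos_of_neg (lt_of_le_of_ne h2 hux.symm) (h x (by rwa [hint]))

/-- If `w, v → 0` at the right end with `v' = r w'`, where `w'` and `r'` do not vanish and
`r ≠ 0`, then `r w → 0` as well. -/
theorem tendsto_mul_of_deriv_eq_mul {a : EReal} (ha : ⊥ < a) {v w g r r' : ℝ → ℝ} {c : ℝ}
    (hca : (c : EReal) < a)
    (hv : ∀ t ∈ realIoo c a, HasDerivAt v (r t * g t) t)
    (hw : ∀ t ∈ realIoo c a, HasDerivAt w (g t) t)
    (hr : ∀ t ∈ realIoo c a, HasDerivAt r (r' t) t)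
    (hg : ∀ t ∈ realIoo c a, g t ≠ 0) (hr0 : ∀ t ∈ realIoo c a, r t ≠ 0)
    (hr' : ∀ t ∈ realIoo c a, r' t ≠ 0)
    (hv0 : Tendsto v (rightEnd a) (𝓝 0)) (hw0 : Tendsto w (rightEnd a) (𝓝 0)) :
    Tendsto (fun t => r t * w t) (rightEnd a) (𝓝 0) := by
  have hint : interior (realIoo c a) = realIoo c a := (isOpen_realIoo _ _).interior_eq
  have hev : ∀ᶠ t in rightEnd a, t ∈ realIoo c a :=
    (eventually_rightEnd_iff ha).2 ⟨c, hca, fun t ht => ht⟩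
  have hsq : ∀ t ∈ realIoo c a, HasDerivAt (fun t => r t ^ 2) (2 * r t * r' t) t := by
    intro t ht
    simpa using (hr t ht).fun_pow 2
  rcases strictMonoOn_or_strictAntiOn_of_deriv_ne_zero (u := fun t => r t ^ 2)
    (u' := fun t => 2 * r t * r' t) (convex_realIoo c a)
    (fun t ht => (hsq t ht).continuousAt.continuousWithinAt)
    (by rwa [hint])
    (by
      rw [hint]
      exact fun t ht => mul_ne_zero (mul_ne_zero two_ne_zero (hr0 t ht)) (hr' t ht))
    with ⟨-, hm⟩ | ⟨-, hm⟩
  · refine squeeze_zero_norm' ?_ (by simpa using hv0.norm)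
    filter_upwards [hev] with x hx
    have hsub : ∀ t, x ≤ t → (t : EReal) < a → t ∈ realIoo c a := fun t h1 h2 =>
      mem_realIoo_coe.2 ⟨(mem_realIoo_coe.1 hx).1.trans_le h1, h2⟩
    obtain ⟨t, ht, h⟩ := exists_deriv_eq_zero_of_tendsto_rightEnd ha
      (u := fun t => v x * w t - w x * v t) (u' := fun t => v x * g t - w x * (r t * g t))
      hx.2 (by ring)
      (fun t h1 h2 => ((hw t (hsub t h1 h2)).const_mul _).sub ((hv t (hsub t h1 h2)).const_mul _))
      (by simpa using (hw0.const_mul (v x)).sub (hv0.const_mul (w x)))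
    have ht' := hsub t (mem_realIoo_coe.1 ht).1.le ht.2
    have h3 : v x = r t * w x := by
      apply mul_right_cancel₀ (hg t ht')
      linarith
    have h4 : |r x| ≤ |r t| := sq_le_sq.1 (hm hx ht' (mem_realIoo_coe.1 ht).1).le
    rw [h3, norm_mul, abs_mul]
    exact mul_le_mul_of_nonneg_right h4 (norm_nonneg _)
  · obtain ⟨y, hy⟩ := exists_mem_realIoo hca
    have hev' : ∀ᶠ t in rightEnd a, y < t ∧ (t : EReal) < a :=
      (eventually_rightEnd_iff ha).2 ⟨y, hy.2, fun t ht => mem_realIoo_coe.1 ht⟩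
    refine squeeze_zero_norm' (a := fun t => |r y| * ‖w t‖) ?_ (by simpa using hw0.norm.const_mul |r y|)
    filter_upwards [hev'] with x hx
    have hx' : x ∈ realIoo c a := mem_realIoo_coe.2 ⟨(mem_realIoo_coe.1 hy).1.trans hx.1, hx.2⟩
    rw [norm_mul]
    exact mul_le_mul_of_nonneg_right (sq_le_sq.1 (hm hy hx' hx.1).le) (norm_nonneg _)

/-! ### Wronskians of eigenfunctions near the right endpoint -/

/-- An eigensystem on `(-a, a)` whose members are eventually nonzero at `a` and whose
pairwise Wronskians vanish at `a`. -/
structure RightEndSystem (a : EReal) (V : ℝ → ℝ) (E : ℕ → ℝ) (φ : ℕ → ℝ → ℝ) : Prop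
    extends EigenSystem (realIoo (-a) a) V E φ where
  pos : 0 < a
  eventually_ne : ∀ n, ∀ᶠ x in rightEnd a, φ n x ≠ 0
  tendsto_wr : ∀ n m, Tendsto (fun x => φ n x * deriv (φ m) x - deriv (φ n) x * φ m x)
    (rightEnd a) (𝓝 0)

namespace RightEndSystem

variable {a : EReal} {V : ℝ → ℝ} {E : ℕ → ℝ} {φ : ℕ → ℝ → ℝ}

theorem bot_lt (h : RightEndSystem a V E φ) : ⊥ < a := EReal.bot_lt_zero.trans h.pos

theorem eventually_mem (h : RightEndSystem a V E φ) :
    ∀ᶠ x in rightEnd a, x ∈ realIoo (-a) a :=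
  (eventually_rightEnd_iff h.bot_lt).2 ⟨0, h.pos, fun _ hx =>
    ⟨(EReal.neg_lt_zero.2 h.pos).trans hx.1, hx.2⟩⟩

theorem hasDerivAt_div_dual (h : RightEndSystem a V E φ) {ℓ : ℕ} {k : Fin ℓ → ℕ}
    (hk : Function.Injective k) {n m : ℕ} (hn : n ∉ Set.range k) (hm : m ∉ Set.range k)
    (hnm : n ≠ m) {x : ℝ} (hx : x ∈ realIoo (-a) a) (hF : wronskian φ k x ≠ 0) :
    HasDerivAt (fun x => wronskian φ (tupleSnoc (tupleSnoc k n) m) x / wronskian φ k x)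
      ((E n - E m) * (wronskian φ (tupleSnoc k n) x * wronskian φ (tupleSnoc k m) x) /
        wronskian φ k x ^ 2) x := by
  refine ((h.wr_hasDerivAt _ hx).fun_div (h.wr_hasDerivAt k hx) hF).congr_deriv ?_
  rw [← h.dual hk hn hm hnm hx]
  ring

theorem hasDerivAt_div_jacobi (h : RightEndSystem a V E φ) {ℓ : ℕ} {k : Fin ℓ → ℕ}
    (hk : Function.Injective k) {n m : ℕ} {x : ℝ} (hx : x ∈ realIoo (-a) a)
    (hQ : wronskian φ (tupleSnoc k n) x ≠ 0) :
    HasDerivAt (fun x => wronskian φ (tupleSnoc k m) x / wronskian φ (tupleSnoc k n) x)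
      (wronskian φ k x * wronskian φ (tupleSnoc (tupleSnoc k n) m) x /
        wronskian φ (tupleSnoc k n) x ^ 2) x := by
  refine ((h.wr_hasDerivAt _ hx).fun_div (h.wr_hasDerivAt (tupleSnoc k n) hx) hQ).congr_deriv ?_
  rw [← h.jacobi hk n m hx]
  ring

/-- The ratio `F_{nm} / F` tends to `0` at the endpoint. -/
def TendstoAt (a : EReal) (φ : ℕ → ℝ → ℝ) (ℓ : ℕ) : Prop :=
  ∀ k : Fin ℓ → ℕ, Function.Injective k → ∀ n m, n ∉ Set.range k → m ∉ Set.range k → n ≠ m →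
    Tendsto (fun x => wronskian φ (tupleSnoc (tupleSnoc k n) m) x / wronskian φ k x)
      (rightEnd a) (𝓝 0)

/-- Wronskians of length `ℓ` do not vanish near the endpoint. -/
def NonzeroAt (a : EReal) (φ : ℕ → ℝ → ℝ) (ℓ : ℕ) : Prop :=
  ∀ k : Fin ℓ → ℕ, Function.Injective k → ∀ᶠ x in rightEnd a, wronskian φ k x ≠ 0

theorem mul_neg_of_tendstoAt (h : RightEndSystem a V E φ) {ℓ : ℕ} (h0 : NonzeroAt a φ ℓ)
    (h1 : NonzeroAt a φ (ℓ + 1)) (ht : TendstoAt a φ ℓ) {k : Fin ℓ → ℕ}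
    (hk : Function.Injective k) {n m : ℕ} (hn : n ∉ Set.range k) (hm : m ∉ Set.range k)
    (hnm : n ≠ m) :
    ∀ᶠ x in rightEnd a, (E n - E m) * (wronskian φ k x *
      wronskian φ (tupleSnoc (tupleSnoc k n) m) x *
      (wronskian φ (tupleSnoc k n) x * wronskian φ (tupleSnoc k m) x)) < 0 := by
  have hc : E n - E m ≠ 0 := sub_ne_zero.2 fun e => hnm (h.injective e)
  have hev := (h.eventually_mem.and (h0 k hk)).and
    ((h1 _ (EigenSystem.snoc_injective.2 ⟨hk, hn⟩)).and
      (h1 _ (EigenSystem.snoc_injective.2 ⟨hk, hm⟩)))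
  obtain ⟨c, hc1, hc2⟩ := (eventually_rightEnd_iff h.bot_lt).1 hev
  refine (eventually_rightEnd_iff h.bot_lt).2 ⟨c, hc1, fun x hx => ?_⟩
  have key := mul_deriv_neg_of_tendsto_rightEnd h.bot_lt
    (fun t ht => h.hasDerivAt_div_dual hk hn hm hnm (hc2 t ht).1.1 (hc2 t ht).1.2)
    (fun t ht => div_ne_zero (mul_ne_zero hc (mul_ne_zero (hc2 t ht).2.1 (hc2 t ht).2.2))
      (pow_ne_zero 2 (hc2 t ht).1.2)) (ht k hk n m hn hm hnm) x hx
  have hF := (hc2 x hx).1.2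
  have hF4 : 0 < wronskian φ k x ^ 4 := by positivity
  refine lt_of_eq_of_lt ?_ (mul_neg_of_pos_of_neg hF4 key)
  field_simp

theorem nonzeroAt_add_two (h : RightEndSystem a V E φ) {ℓ : ℕ} (h0 : NonzeroAt a φ ℓ)
    (h1 : NonzeroAt a φ (ℓ + 1)) (ht : TendstoAt a φ ℓ) : NonzeroAt a φ (ℓ + 1 + 1) := by
  intro k hk
  obtain ⟨k', m, rfl⟩ : ∃ k' m, k = tupleSnoc k' m := ⟨_, _, EigenSystem.snoc_self k⟩
  obtain ⟨k, n, rfl⟩ : ∃ k n, k' = tupleSnoc k n := ⟨_, _, EigenSystem.snoc_self k'⟩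
  obtain ⟨hk1, hm⟩ := EigenSystem.snoc_injective.1 hk
  obtain ⟨hk2, hn⟩ := EigenSystem.snoc_injective.1 hk1
  obtain ⟨hm', hnm⟩ := EigenSystem.notMem_of_notMem_snoc hm
  filter_upwards [h.mul_neg_of_tendstoAt h0 h1 ht hk2 hn hm' hnm] with x hx hG
  simp [hG] at hx

theorem tendstoAt_succ (h : RightEndSystem a V E φ) {ℓ : ℕ} (h0 : NonzeroAt a φ ℓ)
    (h1 : NonzeroAt a φ (ℓ + 1)) (h2 : NonzeroAt a φ (ℓ + 1 + 1)) (ht : TendstoAt a φ ℓ) :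
    TendstoAt a φ (ℓ + 1) := by
  intro k' hk' n m hn hm hnm
  obtain ⟨k, l, rfl⟩ : ∃ k n, k' = tupleSnoc k n := ⟨_, _, EigenSystem.snoc_self k'⟩
  obtain ⟨hk, hl⟩ := EigenSystem.snoc_injective.1 hk'
  have aux : ∀ n m, n ∉ Set.range (tupleSnoc k l) → m ∉ Set.range (tupleSnoc k l) → n ≠ m →
      Tendsto (fun x => wronskian φ (tupleSnoc k n) x / wronskian φ (tupleSnoc k l) x *
        (wronskian φ (tupleSnoc (tupleSnoc k l) m) x / wronskian φ k x)) (rightEnd a) (𝓝 0) := by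
    intro n m hn hm hnm
    obtain ⟨hn', hln⟩ := EigenSystem.notMem_of_notMem_snoc hn
    obtain ⟨hm', hlm⟩ := EigenSystem.notMem_of_notMem_snoc hm
    have hcnm : E n - E m ≠ 0 := sub_ne_zero.2 fun e => hnm (h.injective e)
    have hclm : E l - E m ≠ 0 := sub_ne_zero.2 fun e => hlm (h.injective e)
    have hev := (h.eventually_mem.and (h0 k hk)).and (((h1 _ hk').and
      (h1 _ (EigenSystem.snoc_injective.2 ⟨hk, hn'⟩))).and
      ((h1 _ (EigenSystem.snoc_injective.2 ⟨hk, hm'⟩)).and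
      (h2 _ (EigenSystem.snoc_injective.2 ⟨hk', hn⟩))))
    obtain ⟨c, hc1, hc2⟩ := (eventually_rightEnd_iff h.bot_lt).1 hev
    have key := tendsto_mul_of_deriv_eq_mul h.bot_lt (c := c)
      (v := fun x => (E n - E m)⁻¹ *
        (wronskian φ (tupleSnoc (tupleSnoc k n) m) x / wronskian φ k x))
      (w := fun x => (E l - E m)⁻¹ *
        (wronskian φ (tupleSnoc (tupleSnoc k l) m) x / wronskian φ k x))
      (g := fun x => wronskian φ (tupleSnoc k l) x * wronskian φ (tupleSnoc k m) x /
        wronskian φ k x ^ 2)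
      (r := fun x => wronskian φ (tupleSnoc k n) x / wronskian φ (tupleSnoc k l) x)
      (r' := fun x => wronskian φ k x * wronskian φ (tupleSnoc (tupleSnoc k l) n) x /
        wronskian φ (tupleSnoc k l) x ^ 2) hc1 ?_ ?_ ?_ ?_ ?_ ?_ ?_ ?_
    · have := key.const_mul (E l - E m)
      rw [mul_zero] at this
      refine this.congr fun x => ?_
      field_simp
    · intro t ht'
      obtain ⟨⟨hI, hF⟩, ⟨hl0, hn0⟩, hm0, hln0⟩ := hc2 t ht'
      refine ((h.hasDerivAt_div_dual hk hn' hm' hnm hI hF).const_mul _).congr_deriv ?_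
      field_simp
    · intro t ht'
      obtain ⟨⟨hI, hF⟩, ⟨hl0, hn0⟩, hm0, hln0⟩ := hc2 t ht'
      refine ((h.hasDerivAt_div_dual hk hl hm' hlm hI hF).const_mul _).congr_deriv ?_
      field_simp
    · intro t ht'
      obtain ⟨⟨hI, hF⟩, ⟨hl0, hn0⟩, hm0, hln0⟩ := hc2 t ht'
      exact h.hasDerivAt_div_jacobi hk hI hl0
    · intro t ht'
      obtain ⟨⟨hI, hF⟩, ⟨hl0, hn0⟩, hm0, hln0⟩ := hc2 t ht'
      positivity
    · intro t ht'
      obtain ⟨⟨hI, hF⟩, ⟨hl0, hn0⟩, hm0, hln0⟩ := hc2 t ht'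
      positivity
    · intro t ht'
      obtain ⟨⟨hI, hF⟩, ⟨hl0, hn0⟩, hm0, hln0⟩ := hc2 t ht'
      positivity
    · simpa using (ht k hk n m hn' hm' hnm).const_mul (E n - E m)⁻¹
    · simpa using (ht k hk l m hl hm' hlm).const_mul (E l - E m)⁻¹
  have key := ((aux m n hm hn hnm.symm).const_mul (E l - E m)).sub
    ((aux n m hn hm hnm).const_mul (E l - E n))
  simp only [mul_zero, sub_zero] at key
  refine key.congr' ?_
  filter_upwards [h.eventually_mem, h0 k hk, h1 _ hk'] with x hx hF hl0
  have h3 := h.three_term hk' hn hm hx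
  field_simp
  linear_combination -h3

theorem nonzeroAt_and_tendstoAt (h : RightEndSystem a V E φ) (ℓ : ℕ) :
    NonzeroAt a φ ℓ ∧ NonzeroAt a φ (ℓ + 1) ∧ TendstoAt a φ ℓ := by
  induction ℓ with
  | zero =>
    refine ⟨fun k _ => ?_, fun k _ => ?_, fun k hk n m _ _ _ => ?_⟩
    · simp [wronskian_zero]
    · rw [wronskian_one]; exact h.eventually_ne _
    · refine (h.tendsto_wr n m).congr' ?_
      filter_upwards [h.eventually_mem] with x hx
      have := h.jacobi hk n m hx
      rw [wronskian_one, wronskian_one, wronskian_zero] at this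
      rw [wronskian_zero, div_one]
      simpa [tupleSnoc, Fin.snoc] using this
  | succ ℓ ih =>
    obtain ⟨h0, h1, ht⟩ := ih
    have h2 := h.nonzeroAt_add_two h0 h1 ht
    exact ⟨h1, h2, h.tendstoAt_succ h0 h1 h2 ht⟩

/-- The sign of `F G Q P` near the endpoint. -/
theorem eventually_mul_neg (h : RightEndSystem a V E φ) {ℓ : ℕ} {k : Fin ℓ → ℕ}
    (hk : Function.Injective k) {n m : ℕ} (hn : n ∉ Set.range k) (hm : m ∉ Set.range k)
    (hnm : n ≠ m) :
    ∀ᶠ x in rightEnd a, (E n - E m) * (wronskian φ k x *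
      wronskian φ (tupleSnoc (tupleSnoc k n) m) x *
      (wronskian φ (tupleSnoc k n) x * wronskian φ (tupleSnoc k m) x)) < 0 :=
  have h' := h.nonzeroAt_and_tendstoAt ℓ
  h.mul_neg_of_tendstoAt h'.1 h'.2.1 h'.2.2 hk hn hm hnm

end RightEndSystem

/-! ### Counting signed zeros -/

theorem mul_pos_of_forall_ne_zero {D : ℝ → ℝ} {u v : ℝ} (huv : u ≤ v)
    (hc : ContinuousOn D (Set.Icc u v)) (hne : ∀ z ∈ Set.Icc u v, D z ≠ 0) : 0 < D u * D v := by
  by_contra! h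
  have hu := hne u ⟨le_rfl, huv⟩
  have hv := hne v ⟨huv, le_rfl⟩
  have h0 : (0 : ℝ) ∈ Set.uIcc (D u) (D v) := by
    rcases lt_or_gt_of_ne hu with h1 | h1
    · exact Set.mem_uIcc.2 (Or.inl ⟨h1.le, by nlinarith⟩)
    · exact Set.mem_uIcc.2 (Or.inr ⟨by nlinarith, h1.le⟩)
  obtain ⟨z, hz, hz0⟩ := intermediate_value_uIcc (by rwa [Set.uIcc_of_le huv]) h0
  rw [Set.uIcc_of_le huv] at hz
  exact hne z hz hz0

/-- `1` at positive numbers and `0` elsewhere. -/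
noncomputable def posInd (y : ℝ) : ℤ := if 0 < y then 1 else 0

theorem posInd_eq_of_mul_pos {x y : ℝ} (h : 0 < x * y) : posInd x = posInd y := by
  unfold posInd
  rcases pos_and_pos_or_neg_and_neg_of_mul_pos h with ⟨h1, h2⟩ | ⟨h1, h2⟩
  · simp [h1, h2]
  · rw [if_neg h1.le.not_gt, if_neg h2.le.not_gt]

theorem finite_zeros_of_deriv_ne_zero {D : ℝ → ℝ} {u v : ℝ} (hc : ContinuousOn D (Set.Icc u v))
    (hd : ∀ z ∈ Set.Icc u v, D z = 0 → deriv D z ≠ 0) :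
    {z ∈ Set.Icc u v | D z = 0}.Finite := by
  by_contra hinf
  obtain ⟨z, hz, hacc⟩ := Set.Infinite.exists_accPt_of_subset_isCompact (K := Set.Icc u v)
    hinf isCompact_Icc (fun z hz => hz.1)
  have hfr : ∃ᶠ y in 𝓝[≠] z, y ∈ Set.Icc u v ∧ D y = 0 := accPt_iff_frequently_nhdsNE.1 hacc
  have hz0 : D z = 0 := by
    by_contra hne
    have h1 : ∀ᶠ y in 𝓝[Set.Icc u v] z, D y ≠ 0 := (hc z hz).eventually_ne hne
    rw [eventually_nhdsWithin_iff] at h1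
    obtain ⟨y, ⟨hy1, hy2⟩, hy3⟩ := (hfr.and_eventually (h1.filter_mono nhdsWithin_le_nhds)).exists
    exact hy3 hy1 hy2
  have hdz := hd z hz hz0
  have h2 := (differentiableAt_of_deriv_ne_zero hdz).hasDerivAt.eventually_ne (c := 0) hdz
  obtain ⟨y, ⟨hy1, hy2⟩, hy3⟩ := (hfr.and_eventually h2).exists
  exact hy3 hy2

theorem signed_zeros_finset {D : ℝ → ℝ} {u : ℝ} (hu : D u ≠ 0) (T : Finset ℝ) :
    ∀ v, u < v → ContinuousOn D (Set.Icc u v) → D v ≠ 0 →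
      (∀ z, z ∈ T ↔ z ∈ Set.Icc u v ∧ D z = 0) → (∀ z ∈ T, deriv D z ≠ 0) →
      ((T.filter fun z => deriv D z < 0).card : ℤ) - (T.filter fun z => 0 < deriv D z).card =
        posInd (D u) - posInd (D v) := by
  induction T using Finset.induction_on_max with
  | empty =>
    intro v huv hc hv hT _
    have := posInd_eq_of_mul_pos (mul_pos_of_forall_ne_zero huv.le hc fun z hz h0 => by
      simpa using (hT z).2 ⟨hz, h0⟩)
    simp [this]
  | insert z T hz ih =>
    intro v huv hc hv hT hd
    have hzT : z ∉ T := fun h => lt_irrefl _ (hz z h)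
    have hz1 := (hT z).1 (Finset.mem_insert_self _ _)
    have huz : u < z := lt_of_le_of_ne hz1.1.1 fun e => hu (e ▸ hz1.2)
    have hzv : z < v := lt_of_le_of_ne hz1.1.2 fun e => hv (e ▸ hz1.2)
    have hdz := hd z (Finset.mem_insert_self _ _)
    have hsign : ∀ᶠ x in 𝓝 z, x ≠ z → 0 < D x * (deriv D z * (x - z)) := by
      rcases lt_or_gt_of_ne hdz with h | h
      · filter_upwards [eventually_nhdsWithin_sign_eq_of_deriv_neg h hz1.2] with x hx hxz
        have h1 : z - x ≠ 0 := sub_ne_zero.2 hxz.symm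
        rcases lt_or_gt_of_ne h1 with h2 | h2
        · rw [sign_neg h2, sign_eq_neg_one_iff] at hx
          nlinarith [mul_pos_of_neg_of_neg h h2, mul_pos_of_neg_of_neg hx h, mul_pos_of_neg_of_neg hx h2]
        · rw [sign_pos h2, sign_eq_one_iff] at hx
          have := mul_pos_of_neg_of_neg h (by linarith : x - z < 0)
          positivity
      · filter_upwards [eventually_nhdsWithin_sign_eq_of_deriv_pos h hz1.2] with x hx hxz
        have h1 : x - z ≠ 0 := sub_ne_zero.2 hxz
        rcases lt_or_gt_of_ne h1 with h2 | h2
        · rw [sign_neg h2, sign_eq_neg_one_iff] at hx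
          exact mul_pos_of_neg_of_neg hx (mul_neg_of_pos_of_neg h h2)
        · rw [sign_pos h2, sign_eq_one_iff] at hx
          positivity
    -- a point `v'` just to the left of `z`
    have hleft : ∀ᶠ x in 𝓝[<] z, u < x ∧ x < z ∧ (∀ y ∈ T, y < x) ∧ 0 < D x * (deriv D z * (x - z)) := by
      have h1 : ∀ᶠ x in 𝓝 z, ∀ y ∈ T, y < x :=
        (Filter.eventually_all_finset T).2 fun y hy => eventually_gt_nhds (hz y hy)
      filter_upwards [nhdsWithin_le_nhds (eventually_gt_nhds huz), self_mem_nhdsWithin,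
        nhdsWithin_le_nhds h1, nhdsWithin_le_nhds hsign] with x h1 h2 h3 h4
      exact ⟨h1, h2, h3, h4 (ne_of_lt h2)⟩
    obtain ⟨v', h1, h2, h3, h4⟩ := hleft.exists
    have hright : ∀ᶠ x in 𝓝[>] z, z < x ∧ x < v ∧ 0 < D x * (deriv D z * (x - z)) := by
      filter_upwards [nhdsWithin_le_nhds (eventually_lt_nhds hzv), self_mem_nhdsWithin,
        nhdsWithin_le_nhds hsign] with x h1 h2 h4
      exact ⟨h2, h1, h4 (ne_of_gt h2)⟩
    obtain ⟨w, h5, h6, h7⟩ := hright.exists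
    have hwv := mul_pos_of_forall_ne_zero h6.le
      (hc.mono (Set.Icc_subset_Icc_left (huz.le.trans h5.le))) (fun y hy h0 => by
        have := (hT y).2 ⟨⟨(huz.trans h5).le.trans hy.1, hy.2⟩, h0⟩
        rcases Finset.mem_insert.1 this with rfl | h'
        · exact absurd hy.1 (not_le.2 h5)
        · exact absurd (hz y h') (not_lt.2 (h5.le.trans hy.1)))
    have key := ih v' h1 (hc.mono (Set.Icc_subset_Icc_right (h2.le.trans hzv.le)))
      (left_ne_zero_of_mul h4.ne') (fun y => by
        constructor
        · intro hy
          have := (hT y).1 (Finset.mem_insert_of_mem hy)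
          exact ⟨⟨this.1.1, (h3 y hy).le⟩, this.2⟩
        · rintro ⟨hy1, hy2⟩
          have := (hT y).2 ⟨⟨hy1.1, hy1.2.trans (h2.le.trans hzv.le)⟩, hy2⟩
          rcases Finset.mem_insert.1 this with rfl | h'
          · exact absurd hy1.2 (not_le.2 h2)
          · exact h')
      (fun y hy => hd y (Finset.mem_insert_of_mem hy))
    rw [← posInd_eq_of_mul_pos hwv, Finset.filter_insert, Finset.filter_insert]
    rcases lt_or_gt_of_ne hdz with h | h
    · have e1 : 0 < D v' := pos_of_mul_pos_left h4 (mul_pos_of_neg_of_neg h (by linarith)).le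
      have e2 : D w < 0 := by
        have := mul_neg_of_neg_of_pos h (sub_pos.2 h5)
        by_contra! h'
        nlinarith [mul_nonpos_of_nonneg_of_nonpos h' this.le]
      rw [if_pos h, if_neg h.le.not_gt, Finset.card_insert_of_notMem (by simp [hzT])]
      simp only [posInd, e1, e2.le.not_gt, if_true, if_false] at key ⊢
      push_cast
      linarith
    · have e1 : D v' < 0 := by
        have := mul_neg_of_pos_of_neg h (sub_neg.2 h2)
        by_contra! h'
        nlinarith [mul_nonpos_of_nonneg_of_nonpos h' this.le]
      have e2 : 0 < D w := pos_of_mul_pos_left h7 (mul_pos h (sub_pos.2 h5)).le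
      rw [if_neg h.le.not_gt, if_pos h, Finset.card_insert_of_notMem (by simp [hzT])]
      simp only [posInd, e1.le.not_gt, e2, if_true, if_false] at key ⊢
      push_cast
      linarith

/-- On a compact interval the zeros of `D` with negative derivative outnumber those with positive
derivative by the change of sign between the endpoints. -/
theorem signed_zeros {D : ℝ → ℝ} {u v : ℝ} (huv : u < v) (hc : ContinuousOn D (Set.Icc u v))
    (hu : D u ≠ 0) (hv : D v ≠ 0) (hd : ∀ z ∈ Set.Icc u v, D z = 0 → deriv D z ≠ 0) :
    {z ∈ Set.Icc u v | D z = 0}.Finite ∧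
    ({z ∈ Set.Icc u v | D z = 0 ∧ deriv D z < 0}.ncard : ℤ) -
      {z ∈ Set.Icc u v | D z = 0 ∧ 0 < deriv D z}.ncard = posInd (D u) - posInd (D v) := by
  have hfin := finite_zeros_of_deriv_ne_zero hc hd
  refine ⟨hfin, ?_⟩
  have key := signed_zeros_finset hu hfin.toFinset v huv hc hv (by simp)
    (fun z hz => by
      simp only [Set.Finite.mem_toFinset, Set.mem_ofPred_eq] at hz
      exact hd z hz.1 hz.2)
  rw [← key]
  congr 2
  · rw [← Set.ncard_coe_finset]
    congr 1
    ext z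
    simp [and_assoc]
  · rw [← Set.ncard_coe_finset]
    congr 1
    ext z
    simp [and_assoc]

/-! ### Four functions with dual Jacobi identities -/

/-- The right half of the interval `(-a, a)`. -/
abbrev posHalf (a : EReal) : Set ℝ := {x ∈ realIoo (-a) a | 0 < x}

theorem mem_posHalf {a : EReal} {x : ℝ} : x ∈ posHalf a ↔ 0 < x ∧ (x : EReal) < a := by
  constructor
  · exact fun h => ⟨h.2, h.1.2⟩
  · refine fun h => ⟨⟨?_, h.2⟩, h.1⟩
    have h0 : (0 : EReal) < x := EReal.coe_pos.2 h.1
    exact (EReal.neg_lt_zero.2 (h0.trans h.2)).trans h0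

/-- `Q P' - Q' P = F G` and `F G' - F' G = c Q P` on `(0, a)`, without common zeros other than those
of `F` and `G`, and with known sign of `F G Q P` at `a`. -/
structure JacobiQuad (a : EReal) (c : ℝ) (F Q P G : ℝ → ℝ) : Prop where
  pos : 0 < a
  neg : c < 0
  dF : ∀ x ∈ posHalf a, HasDerivAt F (deriv F x) x
  dQ : ∀ x ∈ posHalf a, HasDerivAt Q (deriv Q x) x
  dP : ∀ x ∈ posHalf a, HasDerivAt P (deriv P x) x
  dG : ∀ x ∈ posHalf a, HasDerivAt G (deriv G x) x
  jacobi : ∀ x ∈ posHalf a, Q x * deriv P x - deriv Q x * P x = F x * G x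
  dual : ∀ x ∈ posHalf a, F x * deriv G x - deriv F x * G x = c * (Q x * P x)
  neFQ : ∀ x ∈ posHalf a, F x = 0 → Q x ≠ 0
  neFP : ∀ x ∈ posHalf a, F x = 0 → P x ≠ 0
  neQP : ∀ x ∈ posHalf a, Q x = 0 → P x ≠ 0
  neQG : ∀ x ∈ posHalf a, Q x = 0 → G x ≠ 0
  nePG : ∀ x ∈ posHalf a, P x = 0 → G x ≠ 0
  atEnd : ∀ᶠ x in rightEnd a, c * (F x * G x * (Q x * P x)) < 0

namespace JacobiQuad

variable {a : EReal} {c : ℝ} {F Q P G : ℝ → ℝ}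

theorem neFG (h : JacobiQuad a c F Q P G) {x : ℝ} (hx : x ∈ posHalf a) (hF : F x = 0) :
    G x ≠ 0 := fun hG => by
  have := h.dual x hx
  rw [hF, hG] at this
  simp only [zero_mul, mul_zero, sub_zero] at this
  rcases mul_eq_zero.1 ((mul_eq_zero.1 this.symm).resolve_left h.neg.ne) with h1 | h1
  · exact h.neFQ x hx hF h1
  · exact h.neFP x hx hF h1

theorem deriv_prod (h : JacobiQuad a c F Q P G) {x : ℝ} (hx : x ∈ posHalf a) :
    deriv (fun x => F x * G x * (Q x * P x)) x =
      (deriv F x * G x + F x * deriv G x) * (Q x * P x) +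
        F x * G x * (deriv Q x * P x + Q x * deriv P x) :=
  (((h.dF x hx).fun_mul (h.dG x hx)).fun_mul ((h.dQ x hx).fun_mul (h.dP x hx))).deriv

theorem zero_cases (h : JacobiQuad a c F Q P G) {x : ℝ} (hx : x ∈ posHalf a)
    (h0 : F x * G x * (Q x * P x) = 0) :
    ((F x = 0 ∨ P x = 0) ∧ G x ≠ 0 ∧ Q x ≠ 0 ∧ 0 < deriv (fun x => F x * G x * (Q x * P x)) x) ∨
    ((G x = 0 ∨ Q x = 0) ∧ F x ≠ 0 ∧ P x ≠ 0 ∧ deriv (fun x => F x * G x * (Q x * P x)) x < 0) := by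
  have hj := h.jacobi x hx
  have hd := h.dual x hx
  rw [h.deriv_prod hx]
  by_cases hF : F x = 0
  · have h1 := h.neFQ x hx hF
    have h2 := h.neFP x hx hF
    have h3 := h.neFG hx hF
    refine Or.inl ⟨Or.inl hF, h3, h1, ?_⟩
    have : (deriv F x * G x + F x * deriv G x) * (Q x * P x) +
        F x * G x * (deriv Q x * P x + Q x * deriv P x) = -c * (Q x * P x) ^ 2 := by
      rw [hF] at hd ⊢
      linear_combination -(Q x * P x) * hd
    rw [this]
    have := neg_pos.2 h.neg
    positivity
  by_cases hP : P x = 0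
  · have h1 : Q x ≠ 0 := fun hQ => h.neQP x hx hQ hP
    have h2 := h.nePG x hx hP
    refine Or.inl ⟨Or.inr hP, h2, h1, ?_⟩
    have : (deriv F x * G x + F x * deriv G x) * (Q x * P x) +
        F x * G x * (deriv Q x * P x + Q x * deriv P x) = (F x * G x) ^ 2 := by
      rw [hP] at hj ⊢
      linear_combination (F x * G x) * hj
    rw [this]
    positivity
  refine Or.inr ⟨?_, hF, hP, ?_⟩
  · rcases mul_eq_zero.1 h0 with h' | h'
    · exact Or.inl ((mul_eq_zero.1 h').resolve_left hF)
    · exact Or.inr ((mul_eq_zero.1 h').resolve_right hP)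
  by_cases hG : G x = 0
  · have hQ : Q x ≠ 0 := fun hQ => h.neQG x hx hQ hG
    have : (deriv F x * G x + F x * deriv G x) * (Q x * P x) +
        F x * G x * (deriv Q x * P x + Q x * deriv P x) = c * (Q x * P x) ^ 2 := by
      rw [hG] at hd ⊢
      linear_combination (Q x * P x) * hd
    rw [this]
    exact mul_neg_of_neg_of_pos h.neg (by positivity)
  · have hQ : Q x = 0 := by
      by_contra hQ
      exact mul_ne_zero (mul_ne_zero hF hG) (mul_ne_zero hQ hP) h0
    have : (deriv F x * G x + F x * deriv G x) * (Q x * P x) +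
        F x * G x * (deriv Q x * P x + Q x * deriv P x) = -(F x * G x) ^ 2 := by
      rw [hQ] at hj ⊢
      linear_combination -(F x * G x) * hj
    rw [this]
    exact neg_neg_of_pos (by positivity)

/-- The zeros of `G` in `(0, a)` are simple. -/
theorem deriv_ne_zero (h : JacobiQuad a c F Q P G) {x : ℝ} (hx : x ∈ posHalf a) (hG : G x = 0) :
    deriv G x ≠ 0 := fun h' => by
  have := h.dual x hx
  rw [hG, h'] at this
  simp only [mul_zero, sub_zero] at this
  rcases mul_eq_zero.1 ((mul_eq_zero.1 this.symm).resolve_left h.neg.ne) with h1 | h1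
  · exact h.neQG x hx h1 hG
  · exact h.nePG x hx h1 hG

/-- The relation between the numbers of zeros of the four functions. -/
theorem count (h : JacobiQuad a c F Q P G) {σ : ℝ}
    (h0 : ∀ᶠ x in 𝓝[>] 0, 0 < σ * (F x * G x * (Q x * P x))) :
    {x ∈ posHalf a | F x = 0}.Finite ∧ {x ∈ posHalf a | Q x = 0}.Finite ∧
    {x ∈ posHalf a | P x = 0}.Finite ∧ {x ∈ posHalf a | G x = 0}.Finite ∧
    ({x ∈ posHalf a | G x = 0}.ncard : ℤ) + {x ∈ posHalf a | Q x = 0}.ncard + 1 =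
      {x ∈ posHalf a | F x = 0}.ncard + {x ∈ posHalf a | P x = 0}.ncard + posInd σ := by
  set D : ℝ → ℝ := fun x => F x * G x * (Q x * P x) with hD
  have hbot : ⊥ < a := EReal.bot_lt_zero.trans h.pos
  have hDc : ∀ x ∈ posHalf a, HasDerivAt D (deriv D x) x := fun x hx =>
    (((h.dF x hx).fun_mul (h.dG x hx)).fun_mul
      ((h.dQ x hx).fun_mul (h.dP x hx))).differentiableAt.hasDerivAt
  obtain ⟨e, hea, he⟩ := (eventually_rightEnd_iff hbot).1 h.atEnd
  obtain ⟨δ, hδ0, hδ⟩ := (mem_nhdsGT_iff_exists_Ioo_subset).1 h0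
  replace hδ0 : 0 < δ := hδ0
  -- compact subinterval containing all zeros
  obtain ⟨v, hv1, hv2⟩ : ∃ v, v ∈ realIoo e a ∧ 0 < v := by
    have : ((max e 0 : ℝ) : EReal) < a := by
      rcases max_cases e 0 with ⟨h1, -⟩ | ⟨h1, -⟩ <;> rw [h1]
      · exact hea
      · exact h.pos
    obtain ⟨v, hv⟩ := exists_mem_realIoo this
    have hv' := mem_realIoo_coe.1 hv
    exact ⟨v, mem_realIoo_coe.2 ⟨(le_max_left _ _).trans_lt hv'.1, hv'.2⟩,
      (le_max_right _ _).trans_lt hv'.1⟩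
  obtain ⟨u, hu0, hu⟩ : ∃ u, 0 < u ∧ u < min δ v := exists_between (lt_min hδ0 hv2)
  have huδ := hu.trans_le (min_le_left _ _)
  have huv := hu.trans_le (min_le_right _ _)
  have hsub : Set.Icc u v ⊆ posHalf a := fun x hx =>
    mem_posHalf.2 ⟨hu0.trans_le hx.1, (EReal.coe_le_coe_iff.2 hx.2).trans_lt hv1.2⟩
  have hmem : ∀ x ∈ posHalf a, D x = 0 → x ∈ Set.Icc u v := by
    intro x hx hx0
    rw [mem_posHalf] at hx
    constructor
    · by_contra! hlt
      have h1 : 0 < σ * D x := hδ ⟨hx.1, hlt.trans huδ⟩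
      rw [hx0, mul_zero] at h1
      exact lt_irrefl _ h1
    · by_contra! hlt
      have h1 := he x (mem_realIoo_coe.2 ⟨(mem_realIoo_coe.1 hv1).1.trans hlt, hx.2⟩)
      change c * D x < 0 at h1
      rw [hx0, mul_zero] at h1
      exact lt_irrefl _ h1
  have hDu : 0 < σ * D u := hδ ⟨hu0, huδ⟩
  have hDv : 0 < D v := by
    have : c * D v < 0 := he v hv1
    by_contra! h'
    nlinarith [mul_nonneg_of_nonpos_of_nonpos h.neg.le h']
  have hne : ∀ z ∈ Set.Icc u v, D z = 0 → deriv D z ≠ 0 := fun z hz hz0 => by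
    rcases h.zero_cases (hsub hz) hz0 with ⟨_, _, _, h'⟩ | ⟨_, _, _, h'⟩
    · exact h'.ne'
    · exact h'.ne
  obtain ⟨hfin, hcount⟩ := signed_zeros huv
    (fun x hx => (hDc x (hsub hx)).continuousAt.continuousWithinAt)
    (right_ne_zero_of_mul hDu.ne') hDv.ne' hne
  rw [← posInd_eq_of_mul_pos hDu] at hcount
  have fin : ∀ f : ℝ → ℝ, (∀ x, f x = 0 → D x = 0) → {x ∈ posHalf a | f x = 0}.Finite :=
    fun f hf => hfin.subset fun x hx => ⟨hmem x hx.1 (hf x hx.2), hf x hx.2⟩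
  have fF := fin F fun x hx => by simp [hD, hx]
  have fQ := fin Q fun x hx => by simp [hD, hx]
  have fP := fin P fun x hx => by simp [hD, hx]
  have fG := fin G fun x hx => by simp [hD, hx]
  refine ⟨fF, fQ, fP, fG, ?_⟩
  have eneg : {z ∈ Set.Icc u v | D z = 0 ∧ deriv D z < 0} =
      {x ∈ posHalf a | G x = 0} ∪ {x ∈ posHalf a | Q x = 0} := by
    ext x
    constructor
    · rintro ⟨hx, hx0, hx1⟩
      rcases h.zero_cases (hsub hx) hx0 with ⟨_, _, _, h'⟩ | ⟨h', _⟩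
      · exact absurd hx1 (not_lt.2 h'.le)
      · exact h'.imp (fun h' => ⟨hsub hx, h'⟩) fun h' => ⟨hsub hx, h'⟩
    · intro hx
      have hx' : x ∈ posHalf a ∧ (G x = 0 ∨ Q x = 0) := by
        rcases hx with hx | hx
        · exact ⟨hx.1, Or.inl hx.2⟩
        · exact ⟨hx.1, Or.inr hx.2⟩
      have hx0 : D x = 0 := by rcases hx'.2 with h' | h' <;> simp [hD, h']
      refine ⟨hmem x hx'.1 hx0, hx0, ?_⟩
      rcases h.zero_cases hx'.1 hx0 with ⟨_, h1, h2, _⟩ | ⟨_, _, _, h'⟩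
      · rcases hx'.2 with h' | h'
        · exact absurd h' h1
        · exact absurd h' h2
      · exact h'
  have epos : {z ∈ Set.Icc u v | D z = 0 ∧ 0 < deriv D z} =
      {x ∈ posHalf a | F x = 0} ∪ {x ∈ posHalf a | P x = 0} := by
    ext x
    constructor
    · rintro ⟨hx, hx0, hx1⟩
      rcases h.zero_cases (hsub hx) hx0 with ⟨h', _⟩ | ⟨_, _, _, h'⟩
      · exact h'.imp (fun h' => ⟨hsub hx, h'⟩) fun h' => ⟨hsub hx, h'⟩
      · exact absurd hx1 (not_lt.2 h'.le)
    · intro hx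
      have hx' : x ∈ posHalf a ∧ (F x = 0 ∨ P x = 0) := by
        rcases hx with hx | hx
        · exact ⟨hx.1, Or.inl hx.2⟩
        · exact ⟨hx.1, Or.inr hx.2⟩
      have hx0 : D x = 0 := by rcases hx'.2 with h' | h' <;> simp [hD, h']
      refine ⟨hmem x hx'.1 hx0, hx0, ?_⟩
      rcases h.zero_cases hx'.1 hx0 with ⟨_, _, _, h'⟩ | ⟨_, h1, h2, _⟩
      · exact h'
      · rcases hx'.2 with h' | h'
        · exact absurd h' h1
        · exact absurd h' h2
  rw [eneg, epos, Set.ncard_union_eq _ fG fQ, Set.ncard_union_eq _ fF fP] at hcount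
  · have : posInd (D v) = 1 := if_pos hDv
    rw [this] at hcount
    push_cast at hcount
    linarith
  · exact Set.disjoint_left.2 fun x hx hx' => h.neFP x hx.1 hx.2 hx'.2
  · exact Set.disjoint_left.2 fun x hx hx' => h.neQG x hx.1 hx'.2 hx.2

end JacobiQuad

/-! ### Taylor series at the origin -/

/-- The formal Taylor series of `f` at `0`. -/
noncomputable def taylorSeries (f : ℝ → ℝ) : PowerSeries ℝ :=
  PowerSeries.mk fun n => iteratedDeriv n f 0 / (n.factorial : ℝ)

theorem taylorSeries_congr {f g : ℝ → ℝ} (h : f =ᶠ[𝓝 0] g) : taylorSeries f = taylorSeries g := by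
  ext n
  simp [taylorSeries, h.iteratedDeriv_eq n]

theorem taylorSeries_mul {f g : ℝ → ℝ} (hf : ContDiffAt ℝ ∞ f 0) (hg : ContDiffAt ℝ ∞ g 0) :
    taylorSeries (fun x => f x * g x) = taylorSeries f * taylorSeries g := by
  ext n
  rw [PowerSeries.coeff_mul, Finset.Nat.sum_antidiagonal_eq_sum_range_succ_mk]
  simp only [taylorSeries, PowerSeries.coeff_mk]
  rw [iteratedDeriv_fun_mul (hf.of_le (by exact_mod_cast le_top))
    (hg.of_le (by exact_mod_cast le_top)), Finset.sum_div]
  refine Finset.sum_congr rfl fun i hi => ?_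
  rw [Nat.cast_choose ℝ (Nat.lt_succ_iff.1 (Finset.mem_range.1 hi))]
  have h1 : (n.factorial : ℝ) ≠ 0 := by positivity
  have h2 : (i.factorial : ℝ) ≠ 0 := by positivity
  have h3 : ((n - i).factorial : ℝ) ≠ 0 := by positivity
  field_simp

theorem taylorSeries_sub {f g : ℝ → ℝ} (hf : ContDiffAt ℝ ∞ f 0) (hg : ContDiffAt ℝ ∞ g 0) :
    taylorSeries (fun x => f x - g x) = taylorSeries f - taylorSeries g := by
  ext n
  simp only [taylorSeries, PowerSeries.coeff_mk, map_sub]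
  rw [iteratedDeriv_fun_sub (hf.of_le (by exact_mod_cast le_top))
    (hg.of_le (by exact_mod_cast le_top)), sub_div]

theorem taylorSeries_const_mul {f : ℝ → ℝ} (c : ℝ) :
    taylorSeries (fun x => c * f x) = PowerSeries.C c * taylorSeries f := by
  ext n
  simp [taylorSeries, mul_div_assoc]

theorem taylorSeries_deriv (f : ℝ → ℝ) :
    taylorSeries (deriv f) = PowerSeries.derivative ℝ (taylorSeries f) := by
  ext n
  rw [PowerSeries.coeff_derivative]
  simp only [taylorSeries, PowerSeries.coeff_mk]
  rw [iteratedDeriv_succ', Nat.factorial_succ]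
  have h1 : (n.factorial : ℝ) ≠ 0 := by positivity
  have h2 : ((n : ℝ) + 1) ≠ 0 := by positivity
  push_cast
  field_simp

/-- The series `A` has order `p` with leading coefficient `c`. -/
def HasLead (A : PowerSeries ℝ) (p : ℕ) (c : ℝ) : Prop :=
  c ≠ 0 ∧ ∃ U : PowerSeries ℝ, A = PowerSeries.X ^ p * U ∧ PowerSeries.constantCoeff U = c

theorem exists_hasLead {A : PowerSeries ℝ} (hA : A ≠ 0) : ∃ p c, HasLead A p c :=
  ⟨A.order.toNat, PowerSeries.constantCoeff A.divXPowOrder,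
    PowerSeries.constantCoeff_divXPowOrder_eq_zero_iff.not.2 hA, A.divXPowOrder,
    PowerSeries.X_pow_order_mul_divXPowOrder.symm, rfl⟩

theorem HasLead.unique {A : PowerSeries ℝ} {p q : ℕ} {c d : ℝ} (h : HasLead A p c)
    (h' : HasLead A q d) : p = q ∧ c = d := by
  obtain ⟨hc, U, hU, rfl⟩ := h
  obtain ⟨hd, W, hW, rfl⟩ := h'
  rw [hU] at hW
  have aux : ∀ {p r : ℕ} {U W : PowerSeries ℝ}, PowerSeries.constantCoeff U ≠ 0 →
      PowerSeries.X ^ p * U = PowerSeries.X ^ (p + r) * W → r = 0 ∧ U = W := by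
    intro p r U W hU h
    rw [pow_add, mul_assoc] at h
    have h1 := mul_left_cancel₀ (pow_ne_zero p PowerSeries.X_ne_zero) h
    rcases Nat.eq_zero_or_pos r with h0 | h0
    · subst h0
      exact ⟨rfl, by simpa using h1⟩
    · rw [h1] at hU
      simp [h0.ne'] at hU
  rcases le_total p q with hpq | hpq
  · obtain ⟨r, rfl⟩ := Nat.exists_eq_add_of_le hpq
    obtain ⟨rfl, rfl⟩ := aux hc hW
    simp
  · obtain ⟨r, rfl⟩ := Nat.exists_eq_add_of_le hpq
    obtain ⟨rfl, rfl⟩ := aux hd hW.symm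
    simp

theorem HasLead.mul {A B : PowerSeries ℝ} {p q : ℕ} {c d : ℝ} (h : HasLead A p c)
    (h' : HasLead B q d) : HasLead (A * B) (p + q) (c * d) := by
  obtain ⟨hc, U, rfl, rfl⟩ := h
  obtain ⟨hd, W, rfl, rfl⟩ := h'
  exact ⟨mul_ne_zero hc hd, U * W, by ring, by simp⟩

theorem HasLead.X_mul {A : PowerSeries ℝ} {p : ℕ} {c : ℝ} (h : HasLead A p c) :
    HasLead (PowerSeries.X * A) (p + 1) c := by
  obtain ⟨hc, U, rfl, rfl⟩ := h
  exact ⟨hc, U, by ring, rfl⟩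

theorem HasLead.C_mul {A : PowerSeries ℝ} {p : ℕ} {c d : ℝ} (h : HasLead A p c) (hd : d ≠ 0) :
    HasLead (PowerSeries.C d * A) p (d * c) := by
  obtain ⟨hc, U, rfl, rfl⟩ := h
  exact ⟨mul_ne_zero hd hc, PowerSeries.C d * U, by ring, by simp⟩

theorem X_mul_derivative_X_pow_mul (p : ℕ) (U : PowerSeries ℝ) :
    PowerSeries.X * PowerSeries.derivative ℝ (PowerSeries.X ^ p * U) =
      PowerSeries.X ^ p * ((p : PowerSeries ℝ) * U +
        PowerSeries.X * PowerSeries.derivative ℝ U) := by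
  rw [Derivation.leibniz, Derivation.leibniz_pow, PowerSeries.derivative_X]
  cases p with
  | zero => simp
  | succ p => simp; ring

/-- The leading term of `X (A B' - A' B)`. -/
theorem HasLead.wronskian {A B : PowerSeries ℝ} {p q : ℕ} {c d : ℝ} (h : HasLead A p c)
    (h' : HasLead B q d) (hpq : p ≠ q) :
    HasLead (PowerSeries.X * (A * PowerSeries.derivative ℝ B - PowerSeries.derivative ℝ A * B))
      (p + q) (((q : ℝ) - p) * (c * d)) := by
  obtain ⟨hc, U, rfl, rfl⟩ := h
  obtain ⟨hd, W, rfl, rfl⟩ := h'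
  refine ⟨mul_ne_zero (sub_ne_zero.2 (by exact_mod_cast hpq.symm)) (mul_ne_zero hc hd),
    U * ((q : PowerSeries ℝ) * W + PowerSeries.X * PowerSeries.derivative ℝ W) -
    ((p : PowerSeries ℝ) * U + PowerSeries.X * PowerSeries.derivative ℝ U) * W, ?_, ?_⟩
  · have h1 := X_mul_derivative_X_pow_mul p U
    have h2 := X_mul_derivative_X_pow_mul q W
    linear_combination (PowerSeries.X ^ p * U) * h2 - (PowerSeries.X ^ q * W) * h1
  · simp
    ring

theorem HasLead.deriv_of_succ {f : ℝ → ℝ} {p : ℕ} {c : ℝ} (h : HasLead (taylorSeries f) (p + 1) c) :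
    f 0 = 0 ∧ HasLead (taylorSeries (deriv f)) p ((p + 1) * c) := by
  obtain ⟨hc, U, hU, hUc⟩ := h
  constructor
  · have : PowerSeries.constantCoeff (taylorSeries f) = 0 := by rw [hU]; simp
    rw [← PowerSeries.coeff_zero_eq_constantCoeff_apply] at this
    simpa [taylorSeries] using this
  · refine ⟨by positivity, ((p + 1 : ℕ) : PowerSeries ℝ) * U +
      PowerSeries.X * PowerSeries.derivative ℝ U, ?_, by simp [hUc]⟩
    rw [taylorSeries_deriv, hU]
    apply mul_left_cancel₀ (PowerSeries.X_ne_zero (R := ℝ))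
    rw [X_mul_derivative_X_pow_mul]
    ring

theorem HasLead.hasRootOfMultiplicity {f : ℝ → ℝ} (hf : ContDiffAt ℝ ∞ f 0) {p : ℕ} {c : ℝ}
    (h : HasLead (taylorSeries f) p c) : HasRootOfMultiplicity f 0 p := by
  obtain ⟨hc, U, hU, hUc⟩ := h
  have hcoef : ∀ n, iteratedDeriv n f 0 = n.factorial * PowerSeries.coeff n (PowerSeries.X ^ p * U) := by
    intro n
    rw [← hU]
    have h1 : (n.factorial : ℝ) ≠ 0 := by positivity
    simp [taylorSeries]
    field_simp
  refine ⟨hf.of_le (by exact_mod_cast le_top), fun i hi => ?_, ?_⟩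
  · rw [hcoef, PowerSeries.coeff_X_pow_mul', if_neg (not_le.2 hi), mul_zero]
  · rw [hcoef, PowerSeries.coeff_X_pow_mul', if_pos le_rfl, Nat.sub_self,
      PowerSeries.coeff_zero_eq_constantCoeff_apply, hUc]
    positivity

/-- The sign of a function to the right of `0` is that of its leading Taylor coefficient. -/
theorem HasLead.eventually_pos {p : ℕ} : ∀ {f : ℝ → ℝ} {c : ℝ}, ContDiffAt ℝ ∞ f 0 →
    HasLead (taylorSeries f) p c → ∀ᶠ x in 𝓝[>] 0, 0 < c * f x := by
  induction p with
  | zero =>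
    intro f c hf h
    obtain ⟨hc, U, hU, hUc⟩ := h
    have h0 : f 0 = c := by
      have : PowerSeries.coeff 0 (taylorSeries f) = c := by rw [hU]; simpa using hUc
      simpa [taylorSeries] using this
    have : ContinuousAt (fun x => c * f x) 0 := continuousAt_const.mul hf.continuousAt
    refine nhdsWithin_le_nhds (this.eventually (lt_mem_nhds ?_))
    change 0 < c * f 0
    rw [h0]
    exact mul_self_pos.2 hc
  | succ p ih =>
    intro f c hf h
    obtain ⟨h0, h1⟩ := h.deriv_of_succ
    have hf' : ContDiffAt ℝ ∞ (deriv f) 0 := by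
      exact hf.derivWithin (by simp)
    have hpos := ih hf' h1
    have hdiff : ∀ᶠ x in 𝓝 (0 : ℝ), DifferentiableAt ℝ f x :=
      ((hf.of_le (m := 1) (by simp)).eventually (by simp)).mono fun x hx =>
        hx.differentiableAt (by simp)
    obtain ⟨δ, hδ0, hδ⟩ := mem_nhdsGT_iff_exists_Ioo_subset.1
      (hpos.and (hdiff.filter_mono nhdsWithin_le_nhds))
    replace hδ0 : 0 < δ := hδ0
    refine mem_nhdsGT_iff_exists_Ioo_subset.2 ⟨δ, hδ0, fun x hx => ?_⟩
    have hmono : StrictMonoOn (fun x => c * f x) (Set.Icc 0 x) := by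
      refine strictMonoOn_of_deriv_pos (convex_Icc 0 x) (fun y hy => ?_) fun y hy => ?_
      · refine (continuousAt_const.mul ?_).continuousWithinAt
        rcases hy.1.eq_or_lt with rfl | h'
        · exact hf.continuousAt
        · exact (hδ ⟨h', hy.2.trans_lt hx.2⟩).2.continuousAt
      · rw [interior_Icc] at hy
        have h3 := hδ ⟨hy.1, hy.2.trans hx.2⟩
        rw [deriv_const_mul _ h3.2]
        have h4 : 0 < (p + 1) * c * deriv f y := h3.1
        rw [mul_assoc] at h4
        exact pos_of_mul_pos_right h4 (by positivity)
    have := hmono ⟨le_rfl, hx.1.le⟩ ⟨hx.1.le, le_rfl⟩ hx.1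
    simpa [h0] using this

theorem HasLead.parity {f : ℝ → ℝ} {p : ℕ} {c ε : ℝ} (h : HasLead (taylorSeries f) p c)
    (hf : ∀ᶠ x in 𝓝 (0 : ℝ), f (-x) = ε * f x) : ε = (-1) ^ p := by
  obtain ⟨hc, U, hU, hUc⟩ := h
  have h1 : iteratedDeriv p (fun x => f (-x)) 0 = iteratedDeriv p (fun x => ε * f x) 0 :=
    Filter.EventuallyEq.iteratedDeriv_eq p hf
  rw [iteratedDeriv_comp_neg, iteratedDeriv_const_mul_field, neg_zero, smul_eq_mul] at h1
  have h2 : iteratedDeriv p f 0 ≠ 0 := by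
    have : PowerSeries.coeff p (taylorSeries f) = c := by
      rw [hU, PowerSeries.coeff_X_pow_mul', if_pos le_rfl]
      simpa using hUc
    intro h0
    simp [taylorSeries, h0] at this
    exact hc this.symm
  exact (mul_right_cancel₀ h2 h1).symm

theorem HasLead.ne_zero {A : PowerSeries ℝ} {p : ℕ} {c : ℝ} (h : HasLead A p c) : A ≠ 0 := by
  obtain ⟨hc, U, rfl, rfl⟩ := h
  refine mul_ne_zero (pow_ne_zero _ PowerSeries.X_ne_zero) ?_
  rintro rfl
  simp at hc

/-! ### Orders of vanishing at the origin -/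

/-- A system of even or odd eigenfunctions on `(-a, a)`; `e n` is the order of `φ n` at `0`. -/
structure ParitySystem (a : EReal) (V : ℝ → ℝ) (E : ℕ → ℝ) (φ : ℕ → ℝ → ℝ) (e : ℕ → ℕ) : Prop
    extends RightEndSystem a V E φ where
  e_le : ∀ n, e n ≤ 1
  parity : ∀ n, ∀ x ∈ realIoo (-a) a, φ n (-x) = (-1) ^ e n * φ n x
  lead : ∀ n, ∃ c, HasLead (taylorSeries (φ n)) (e n) c

/-- The number of indices with `e = 1` minus the number of indices with `e = 0`. -/
def parityDiff (e : ℕ → ℕ) {ℓ : ℕ} (k : Fin ℓ → ℕ) : ℤ := ∑ j, (2 * (e (k j) : ℤ) - 1)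

theorem parityDiff_snoc (e : ℕ → ℕ) {ℓ : ℕ} (k : Fin ℓ → ℕ) (m : ℕ) :
    parityDiff e (tupleSnoc k m) = parityDiff e k + (2 * (e m : ℤ) - 1) := by
  simp only [parityDiff, Fin.sum_univ_castSucc, tupleSnoc, Fin.snoc_castSucc, Fin.snoc_last]

theorem neg_mem_realIoo {a : EReal} {x : ℝ} (hx : x ∈ realIoo (-a) a) : -x ∈ realIoo (-a) a := by
  refine ⟨?_, ?_⟩
  · rw [EReal.coe_neg]; exact EReal.neg_lt_neg_iff.2 hx.2
  · rw [EReal.coe_neg]; exact EReal.neg_lt_comm.1 hx.1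

theorem zero_mem_realIoo {a : EReal} (ha : 0 < a) : (0 : ℝ) ∈ realIoo (-a) a :=
  ⟨EReal.neg_lt_zero.2 ha, ha⟩

theorem deriv_neg_of_parity {a : EReal} {f : ℝ → ℝ} {ε : ℝ}
    (h : ∀ x ∈ realIoo (-a) a, f (-x) = ε * f x) {x : ℝ} (hx : x ∈ realIoo (-a) a) :
    deriv f (-x) = -(ε * deriv f x) := by
  have h1 : (fun x => f (-x)) =ᶠ[𝓝 x] fun x => ε * f x := by
    filter_upwards [(isOpen_realIoo (-a) a).mem_nhds hx] with y hy using h y hy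
  have h2 := h1.deriv_eq
  rw [deriv_comp_neg, deriv_const_mul_field] at h2
  rw [← h2, neg_neg]

namespace ParitySystem

variable {a : EReal} {V : ℝ → ℝ} {E : ℕ → ℝ} {φ : ℕ → ℝ → ℝ} {e : ℕ → ℕ}

theorem contDiffAt_zero (h : ParitySystem a V E φ e) {ℓ : ℕ} (k : Fin ℓ → ℕ) :
    ContDiffAt ℝ ∞ (wronskian φ k) 0 :=
  (h.wr_smooth k).contDiffAt (h.isOpen.mem_nhds (zero_mem_realIoo h.pos))

theorem contDiffAt_deriv_zero (h : ParitySystem a V E φ e) {ℓ : ℕ} (k : Fin ℓ → ℕ) :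
    ContDiffAt ℝ ∞ (deriv (wronskian φ k)) 0 :=
  (h.contDiffAt_zero k).derivWithin (by simp)

theorem mem_nhds (h : ParitySystem a V E φ e) : realIoo (-a) a ∈ 𝓝 (0 : ℝ) :=
  h.isOpen.mem_nhds (zero_mem_realIoo h.pos)

theorem taylor_jacobi (h : ParitySystem a V E φ e) {ℓ : ℕ} {k : Fin ℓ → ℕ}
    (hk : Function.Injective k) (n m : ℕ) :
    taylorSeries (wronskian φ (tupleSnoc k n)) *
        PowerSeries.derivative ℝ (taylorSeries (wronskian φ (tupleSnoc k m))) -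
      PowerSeries.derivative ℝ (taylorSeries (wronskian φ (tupleSnoc k n))) *
        taylorSeries (wronskian φ (tupleSnoc k m)) =
    taylorSeries (wronskian φ k) * taylorSeries (wronskian φ (tupleSnoc (tupleSnoc k n) m)) := by
  rw [← taylorSeries_deriv, ← taylorSeries_deriv,
    ← taylorSeries_mul (h.contDiffAt_zero _) (h.contDiffAt_deriv_zero _),
    ← taylorSeries_mul (h.contDiffAt_deriv_zero _) (h.contDiffAt_zero _),
    ← taylorSeries_mul (h.contDiffAt_zero _) (h.contDiffAt_zero _),
    ← taylorSeries_sub ((h.contDiffAt_zero _).mul (h.contDiffAt_deriv_zero _))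
      ((h.contDiffAt_deriv_zero _).mul (h.contDiffAt_zero _))]
  refine taylorSeries_congr ?_
  filter_upwards [h.mem_nhds] with x hx using h.jacobi hk n m hx

theorem taylor_dual (h : ParitySystem a V E φ e) {ℓ : ℕ} {k : Fin ℓ → ℕ}
    (hk : Function.Injective k) {n m : ℕ} (hn : n ∉ Set.range k) (hm : m ∉ Set.range k)
    (hnm : n ≠ m) :
    taylorSeries (wronskian φ k) *
        PowerSeries.derivative ℝ (taylorSeries (wronskian φ (tupleSnoc (tupleSnoc k n) m))) -
      PowerSeries.derivative ℝ (taylorSeries (wronskian φ k)) *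
        taylorSeries (wronskian φ (tupleSnoc (tupleSnoc k n) m)) =
    PowerSeries.C (E n - E m) * (taylorSeries (wronskian φ (tupleSnoc k n)) *
      taylorSeries (wronskian φ (tupleSnoc k m))) := by
  rw [← taylorSeries_deriv, ← taylorSeries_deriv,
    ← taylorSeries_mul (h.contDiffAt_zero _) (h.contDiffAt_deriv_zero _),
    ← taylorSeries_mul (h.contDiffAt_deriv_zero _) (h.contDiffAt_zero _),
    ← taylorSeries_mul (h.contDiffAt_zero _) (h.contDiffAt_zero _),
    ← taylorSeries_const_mul,
    ← taylorSeries_sub ((h.contDiffAt_zero _).mul (h.contDiffAt_deriv_zero _))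
      ((h.contDiffAt_deriv_zero _).mul (h.contDiffAt_zero _))]
  refine taylorSeries_congr ?_
  filter_upwards [h.mem_nhds] with x hx using h.dual hk hn hm hnm hx

/-- `wronskian φ k` has order `p` and leading coefficient `c` at `0`, and the parity of `p`. -/
structure LeadAt (a : EReal) (φ : ℕ → ℝ → ℝ) {ℓ : ℕ} (k : Fin ℓ → ℕ) (p : ℕ) (c : ℝ) : Prop where
  hasLead : HasLead (taylorSeries (wronskian φ k)) p c
  parity : ∀ x ∈ realIoo (-a) a, wronskian φ k (-x) = (-1) ^ p * wronskian φ k x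

theorem exists_leadAt_snoc_snoc (h : ParitySystem a V E φ e) {ℓ : ℕ} {k : Fin ℓ → ℕ}
    (hk : Function.Injective k) {n m : ℕ} (hn : n ∉ Set.range k) (hm : m ∉ Set.range k)
    (hnm : n ≠ m) {f q p : ℕ} {cf cq cp : ℝ} (hF : LeadAt a φ k f cf)
    (hQ : LeadAt a φ (tupleSnoc k n) q cq) (hP : LeadAt a φ (tupleSnoc k m) p cp) :
    ∃ g cg, LeadAt a φ (tupleSnoc (tupleSnoc k n) m) g cg ∧
      (q ≠ p → f + g + 1 = q + p ∧ cf * cg = ((p : ℝ) - q) * (cq * cp)) ∧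
      (q = p → f + g = q + p + 1 ∧ ((g : ℝ) - f) * (cf * cg) = (E n - E m) * (cq * cp)) := by
  have hc : E n - E m ≠ 0 := sub_ne_zero.2 fun e => hnm (h.injective e)
  have hj := h.taylor_jacobi hk n m
  have hd := h.taylor_dual hk hn hm hnm
  have hG0 : taylorSeries (wronskian φ (tupleSnoc (tupleSnoc k n) m)) ≠ 0 := by
    intro h0
    rw [h0] at hd
    simp only [map_zero, mul_zero, sub_zero] at hd
    exact ((hQ.hasLead.mul hP.hasLead).C_mul hc).ne_zero hd.symm
  obtain ⟨g, cg, hG⟩ := exists_hasLead hG0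
  have hpar : ∀ x ∈ realIoo (-a) a, wronskian φ (tupleSnoc (tupleSnoc k n) m) (-x) =
      -(-1) ^ (f + q + p) * wronskian φ (tupleSnoc (tupleSnoc k n) m) x := by
    intro x hx
    refine (h.wr_nonzero hk).eq_of_mul_eq h.isOpen
      (g := fun x => wronskian φ (tupleSnoc (tupleSnoc k n) m) (-x))
      (h := fun x => -(-1) ^ (f + q + p) * wronskian φ (tupleSnoc (tupleSnoc k n) m) x)
      ?_ ?_ ?_ hx
    · exact (h.wr_cont _).comp continuous_neg.continuousOn fun x hx => neg_mem_realIoo hx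
    · exact continuousOn_const.mul (h.wr_cont _)
    · intro y hy hy0
      have h1 := h.jacobi hk n m hy
      have h2 := h.jacobi hk n m (neg_mem_realIoo hy)
      rw [hQ.parity y hy, hP.parity y hy, hF.parity y hy, deriv_neg_of_parity hQ.parity hy,
        deriv_neg_of_parity hP.parity hy] at h2
      have hs : ((-1 : ℝ) ^ f) * (-1) ^ f = 1 := by rw [← mul_pow]; simp
      apply mul_left_cancel₀ hy0
      rw [pow_add, pow_add]
      linear_combination (-(-1) ^ f) * h2 - (-1) ^ f * (-1) ^ q * (-1) ^ p * h1 -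
        wronskian φ k y * wronskian φ (tupleSnoc (tupleSnoc k n) m) (-y) * hs
  have hε := hG.parity (by filter_upwards [h.mem_nhds] with x hx using hpar x hx)
  refine ⟨g, cg, ⟨hG, fun x hx => by rw [hpar x hx, hε]⟩, fun hqp => ?_, fun hqp => ?_⟩
  · have h1 := hQ.hasLead.wronskian hP.hasLead hqp
    rw [hj] at h1
    obtain ⟨h2, h3⟩ := (hF.hasLead.mul hG).X_mul.unique h1
    exact ⟨h2, h3⟩
  · have hfg : f ≠ g := by
      rintro rfl
      rw [hqp, add_assoc, pow_add, ← two_mul, pow_mul] at hε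
      have : ((-1 : ℝ) ^ f) ≠ 0 := pow_ne_zero _ (by norm_num)
      simp at hε
      apply this
      linarith
    have h1 := hF.hasLead.wronskian hG hfg
    rw [hd] at h1
    obtain ⟨h2, h3⟩ := h1.unique ((hQ.hasLead.mul hP.hasLead).C_mul hc).X_mul
    exact ⟨h2, h3⟩

theorem exists_leadAt_zero (k : Fin 0 → ℕ) : LeadAt a φ k 0 1 := by
  refine ⟨?_, fun x _ => by simp [wronskian_zero]⟩
  rw [wronskian_zero]
  refine ⟨one_ne_zero, 1, ?_, by simp⟩
  ext n
  rw [pow_zero, one_mul, PowerSeries.coeff_one]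
  simp only [taylorSeries, PowerSeries.coeff_mk, iteratedDeriv_const]
  split_ifs with h <;> simp [h]

theorem exists_leadAt_one (h : ParitySystem a V E φ e) (k : Fin 1 → ℕ) :
    ∃ c, LeadAt a φ k (e (k 0)) c := by
  obtain ⟨c, hc⟩ := h.lead (k 0)
  exact ⟨c, by rwa [wronskian_one], by rw [wronskian_one]; exact h.parity _⟩

theorem e_cases (h : ParitySystem a V E φ e) (n : ℕ) : e n = 0 ∨ e n = 1 := by
  have := h.e_le n
  omega

/-- The order of `wronskian φ k` at the origin is a triangular number. -/
theorem exists_leadAt (h : ParitySystem a V E φ e) (ℓ : ℕ) :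
    (∀ k : Fin ℓ → ℕ, Function.Injective k → ∃ p c, LeadAt a φ k p c ∧
      2 * (p : ℤ) = parityDiff e k * (parityDiff e k + 1)) ∧
    (∀ k : Fin (ℓ + 1) → ℕ, Function.Injective k → ∃ p c, LeadAt a φ k p c ∧
      2 * (p : ℤ) = parityDiff e k * (parityDiff e k + 1)) := by
  induction ℓ with
  | zero =>
    refine ⟨fun k _ => ⟨0, 1, exists_leadAt_zero k, by simp [parityDiff]⟩, fun k _ => ?_⟩
    obtain ⟨c, hc⟩ := h.exists_leadAt_one k
    refine ⟨_, c, hc, ?_⟩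
    rcases h.e_cases (k 0) with h' | h' <;> simp [parityDiff, h']
  | succ ℓ ih =>
    refine ⟨ih.2, fun k'' hk'' => ?_⟩
    obtain ⟨k', m, rfl⟩ : ∃ k' m, k'' = tupleSnoc k' m := ⟨_, _, EigenSystem.snoc_self k''⟩
    obtain ⟨k, n, rfl⟩ : ∃ k n, k' = tupleSnoc k n := ⟨_, _, EigenSystem.snoc_self k'⟩
    obtain ⟨hk1, hm⟩ := EigenSystem.snoc_injective.1 hk''
    obtain ⟨hk, hn⟩ := EigenSystem.snoc_injective.1 hk1
    obtain ⟨hm', hnm⟩ := EigenSystem.notMem_of_notMem_snoc hm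
    obtain ⟨f, cf, hF, hf⟩ := ih.1 k hk
    obtain ⟨q, cq, hQ, hq⟩ := ih.2 _ hk1
    obtain ⟨p, cp, hP, hp⟩ := ih.2 _ (EigenSystem.snoc_injective.2 ⟨hk, hm'⟩)
    obtain ⟨g, cg, hG, h1, h2⟩ := h.exists_leadAt_snoc_snoc hk hn hm' hnm hF hQ hP
    refine ⟨g, cg, hG, ?_⟩
    rw [parityDiff_snoc] at hq hp
    rw [parityDiff_snoc, parityDiff_snoc]
    generalize parityDiff e k = d at *
    rcases h.e_cases n with en | en <;> rcases h.e_cases m with em | em <;>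
      rw [en] at hq ⊢ <;> rw [em] at hp ⊢ <;> push_cast at hq hp ⊢
    · have e1 : q = p := by zify; linarith
      have e2 : (f : ℤ) + g = q + p + 1 := by exact_mod_cast (h2 e1).1
      linear_combination 2 * e2 - hf + hq + hp
    · have e1 : q ≠ p := by
        rintro rfl
        have : 2 * (2 * d + 1) = 0 := by linear_combination hq - hp
        omega
      have e2 : (f : ℤ) + g + 1 = q + p := by exact_mod_cast (h1 e1).1
      linear_combination 2 * e2 - hf + hq + hp
    · have e1 : q ≠ p := by
        rintro rfl
        have : 2 * (2 * d + 1) = 0 := by linear_combination hp - hq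
        omega
      have e2 : (f : ℤ) + g + 1 = q + p := by exact_mod_cast (h1 e1).1
      linear_combination 2 * e2 - hf + hq + hp
    · have e1 : q = p := by zify; linarith
      have e2 : (f : ℤ) + g = q + p + 1 := by exact_mod_cast (h2 e1).1
      linear_combination 2 * e2 - hf + hq + hp

/-- The sign of `F G Q P` to the right of `0`. -/
theorem exists_sign (h : ParitySystem a V E φ e) {ℓ : ℕ} {k : Fin ℓ → ℕ}
    (hk : Function.Injective k) {n m : ℕ} (hn : n ∉ Set.range k) (hm : m ∉ Set.range k)
    (hnm : E n < E m) :
    ∃ σ : ℝ, (∀ᶠ x in 𝓝[>] 0, 0 < σ * (wronskian φ k x *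
        wronskian φ (tupleSnoc (tupleSnoc k n) m) x *
        (wronskian φ (tupleSnoc k n) x * wronskian φ (tupleSnoc k m) x))) ∧
      (0 < σ ↔ 0 < -(2 * (e n : ℤ) - 1) * (2 * parityDiff e k + 1 + (2 * (e m : ℤ) - 1)) - 1) := by
  have hnm' : n ≠ m := fun e => hnm.ne (by rw [e])
  obtain ⟨f, cf, hF, hf⟩ := (h.exists_leadAt ℓ).1 k hk
  obtain ⟨q, cq, hQ, hq⟩ := (h.exists_leadAt ℓ).2 _ (EigenSystem.snoc_injective.2 ⟨hk, hn⟩)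
  obtain ⟨p, cp, hP, hp⟩ := (h.exists_leadAt ℓ).2 _ (EigenSystem.snoc_injective.2 ⟨hk, hm⟩)
  obtain ⟨g, cg, hG, h1, h2⟩ := h.exists_leadAt_snoc_snoc hk hn hm hnm' hF hQ hP
  refine ⟨cf * cg * (cq * cp), ?_, ?_⟩
  · filter_upwards [hF.hasLead.eventually_pos (h.contDiffAt_zero _),
      hG.hasLead.eventually_pos (h.contDiffAt_zero _),
      hQ.hasLead.eventually_pos (h.contDiffAt_zero _),
      hP.hasLead.eventually_pos (h.contDiffAt_zero _)] with x x1 x2 x3 x4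
    have := mul_pos (mul_pos x1 x2) (mul_pos x3 x4)
    calc 0 < _ := this
      _ = _ := by ring
  · have hqp2 : 0 < (cq * cp) ^ 2 := by
      have := hQ.hasLead.1
      have := hP.hasLead.1
      positivity
    have hfg2 : 0 < (cf * cg) ^ 2 := by
      have := hF.hasLead.1
      have := hG.hasLead.1
      positivity
    rw [parityDiff_snoc] at hq hp
    generalize parityDiff e k = d at *
    have ne_case : q ≠ p → (0 < cf * cg * (cq * cp) ↔ (0 : ℤ) < 2 * p - 2 * q) := by
      intro e1
      have : cf * cg * (cq * cp) = ((p : ℝ) - q) * (cq * cp) ^ 2 := by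
        rw [(h1 e1).2]; ring
      rw [this, mul_pos_iff_of_pos_right hqp2, sub_pos, Nat.cast_lt]
      omega
    have eq_case : q = p → (0 < cf * cg * (cq * cp) ↔ (0 : ℤ) < 2 * f - (2 * q + 1)) := by
      intro e1
      have e2 := (h2 e1).1
      have e3 : (E m - E n) * (cf * cg * (cq * cp)) = ((f : ℝ) - g) * (cf * cg) ^ 2 := by
        linear_combination (cf * cg) * (h2 e1).2
      rw [← mul_pos_iff_of_pos_left (sub_pos.2 hnm), e3, mul_pos_iff_of_pos_right hfg2, sub_pos,
        Nat.cast_lt]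
      omega
    rcases h.e_cases n with en | en <;> rcases h.e_cases m with em | em <;>
      rw [en] at hq ⊢ <;> rw [em] at hp ⊢ <;> push_cast at hq hp ⊢
    · rw [eq_case (by zify; linarith), hf, hq]
      ring_nf
    · rw [ne_case, hp, hq]
      · ring_nf
        omega
      · rintro rfl
        have : 2 * (2 * d + 1) = 0 := by linear_combination hq - hp
        omega
    · rw [ne_case, hp, hq]
      · ring_nf
        omega
      · rintro rfl
        have : 2 * (2 * d + 1) = 0 := by linear_combination hp - hq
        omega
    · rw [eq_case (by zify; linarith), hf, hq]
      ring_nf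

end ParitySystem

/-! ### Counting the zeros of Wronskians on the half interval -/

/-- Semi-degeneracy, with partitions replaced by increasing tuples. -/
def TupleSemiDegenerate (a : EReal) (φ : ℕ → ℝ → ℝ) : Prop :=
  ∀ (ℓ : ℕ) (k : Fin ℓ → ℕ), StrictMono k → ∀ m n, m ∉ Set.range k → n ∉ Set.range k → m ≠ n →
    (∀ x ∈ realIoo (-a) a, wronskian φ k x = 0 → wronskian φ (tupleSnoc k m) x = 0 → x = 0) ∧
    (∀ x ∈ realIoo (-a) a,
      wronskian φ (tupleSnoc k m) x = 0 → wronskian φ (tupleSnoc k n) x = 0 → x = 0)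

/-- The alternating sum `∑ (-1)^(ℓ-i) λ_i`. -/
def altSum {ℓ : ℕ} (k : Fin ℓ → ℕ) : ℤ :=
  ∑ i : Fin ℓ, (-1) ^ (ℓ - ((i : ℕ) + 1)) * ((k i : ℤ) - i)

theorem altSum_snoc {ℓ : ℕ} (k : Fin ℓ → ℕ) (m : ℕ) :
    altSum (tupleSnoc k m) = -altSum k + (m - ℓ) := by
  simp only [altSum, Fin.sum_univ_castSucc, tupleSnoc, Fin.snoc_castSucc, Fin.snoc_last,
    Fin.val_castSucc, Fin.val_last, ← Finset.sum_neg_distrib]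
  congr 1
  · refine Finset.sum_congr rfl fun i _ => ?_
    have : ℓ + 1 - ((i : ℕ) + 1) = (ℓ - ((i : ℕ) + 1)) + 1 := by omega
    rw [this, pow_succ]
    ring
  · simp

theorem strictMono_snoc {ℓ : ℕ} {k : Fin ℓ → ℕ} {m : ℕ} (hk : StrictMono k) (hm : ∀ i, k i < m) :
    StrictMono (tupleSnoc k m) := by
  intro i j hij
  induction j using Fin.lastCases with
  | last =>
    induction i using Fin.lastCases with
    | last => exact absurd hij (lt_irrefl _)
    | cast i => simpa [tupleSnoc] using hm i
  | cast j =>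
    induction i using Fin.lastCases with
    | last => exact absurd hij (not_lt.2 (Fin.le_last _))
    | cast i => simpa [tupleSnoc] using hk (Fin.castSucc_lt_castSucc_iff.1 hij)

theorem strictMono_of_snoc {ℓ : ℕ} {k : Fin ℓ → ℕ} {m : ℕ} (h : StrictMono (tupleSnoc k m)) :
    StrictMono k ∧ ∀ i, k i < m := by
  constructor
  · intro i j hij
    simpa [tupleSnoc] using h (Fin.castSucc_lt_castSucc_iff.2 hij)
  · intro i
    simpa [tupleSnoc] using h (Fin.castSucc_lt_last i)

theorem parityDiff_emod_two (e : ℕ → ℕ) {ℓ : ℕ} (k : Fin ℓ → ℕ) :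
    parityDiff e k % 2 = (ℓ : ℤ) % 2 := by
  have : parityDiff e k = 2 * ∑ j, (e (k j) : ℤ) - ℓ := by
    simp [parityDiff, Finset.mul_sum]
  omega

namespace ParitySystem

variable {a : EReal} {V : ℝ → ℝ} {E : ℕ → ℝ} {φ : ℕ → ℝ → ℝ} {e : ℕ → ℕ}

theorem jacobiQuad (h : ParitySystem a V E φ e) (hE : StrictMono E)
    (hs : TupleSemiDegenerate a φ) {ℓ : ℕ} {k : Fin ℓ → ℕ} {n m : ℕ}
    (hk : StrictMono k) (hn : ∀ i, k i < n) (hnm : n < m) :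
    JacobiQuad a (E n - E m) (wronskian φ k) (wronskian φ (tupleSnoc k n))
      (wronskian φ (tupleSnoc k m)) (wronskian φ (tupleSnoc (tupleSnoc k n) m)) := by
  have hkm : ∀ i, k i < m := fun i => (hn i).trans hnm
  have hn' : n ∉ Set.range k := fun ⟨i, hi⟩ => (hn i).ne hi
  have hm' : m ∉ Set.range k := fun ⟨i, hi⟩ => (hkm i).ne hi
  have hd : ∀ {ℓ : ℕ} (k : Fin ℓ → ℕ), ∀ x ∈ posHalf a,
      HasDerivAt (wronskian φ k) (deriv (wronskian φ k) x) x :=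
    fun k x hx => h.wr_hasDerivAt k hx.1
  have notin : ∀ {n m : ℕ}, (∀ i, k i < m) → n ≠ m → m ∉ Set.range (tupleSnoc k n) := by
    rintro n m hm hne ⟨i, hi⟩
    induction i using Fin.lastCases with
    | last => exact hne (by simpa [tupleSnoc] using hi)
    | cast i => exact (hm i).ne (by simpa [tupleSnoc] using hi)
  obtain ⟨s1, s2⟩ := hs ℓ k hk n m hn' hm' hnm.ne
  obtain ⟨s3, -⟩ := hs ℓ k hk m n hm' hn' hnm.ne'
  obtain ⟨s4, -⟩ := hs _ (tupleSnoc k n) (strictMono_snoc hk hn) m (m + 1)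
    (notin hkm hnm.ne) (notin (fun i => (hkm i).trans (Nat.lt_succ_self m))
      (hnm.trans (Nat.lt_succ_self m)).ne) (Nat.lt_succ_self m).ne
  obtain ⟨s5, -⟩ := hs _ (tupleSnoc k m) (strictMono_snoc hk hkm) n (m + 1)
    (notin hn hnm.ne') (notin (fun i => (hkm i).trans (Nat.lt_succ_self m))
      (Nat.lt_succ_self m).ne) (hnm.trans (Nat.lt_succ_self m)).ne
  exact
    { pos := h.pos
      neg := sub_neg.2 (hE hnm)
      dF := hd _
      dQ := hd _
      dP := hd _
      dG := hd _
      jacobi := fun x hx => h.jacobi hk.injective n m hx.1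
      dual := fun x hx => h.dual hk.injective hn' hm' hnm.ne hx.1
      neFQ := fun x hx h1 h2 => hx.2.ne' (s1 x hx.1 h1 h2)
      neFP := fun x hx h1 h2 => hx.2.ne' (s3 x hx.1 h1 h2)
      neQP := fun x hx h1 h2 => hx.2.ne' (s2 x hx.1 h1 h2)
      neQG := fun x hx h1 h2 => hx.2.ne' (s4 x hx.1 h1 h2)
      nePG := fun x hx h1 h2 => hx.2.ne' (s5 x hx.1 h1
        (by rw [wronskian_snoc_swap, h2, neg_zero]))
      atEnd := h.eventually_mul_neg hk.injective hn' hm' hnm.ne }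

theorem count_step (h : ParitySystem a V E φ e) (hE : StrictMono E)
    (hs : TupleSemiDegenerate a φ) {ℓ : ℕ} {k : Fin ℓ → ℕ} {n m : ℕ}
    (hk : StrictMono k) (hn : ∀ i, k i < n) (hnm : n < m) :
    {x ∈ posHalf a | wronskian φ (tupleSnoc (tupleSnoc k n) m) x = 0}.Finite ∧
    ({x ∈ posHalf a | wronskian φ (tupleSnoc (tupleSnoc k n) m) x = 0}.ncard : ℤ) +
      {x ∈ posHalf a | wronskian φ (tupleSnoc k n) x = 0}.ncard + 1 =
      {x ∈ posHalf a | wronskian φ k x = 0}.ncard +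
      {x ∈ posHalf a | wronskian φ (tupleSnoc k m) x = 0}.ncard +
      if 0 < -(2 * (e n : ℤ) - 1) * (2 * parityDiff e k + 1 + (2 * (e m : ℤ) - 1)) - 1
        then 1 else 0 := by
  have hn' : n ∉ Set.range k := fun ⟨i, hi⟩ => (hn i).ne hi
  have hm' : m ∉ Set.range k := fun ⟨i, hi⟩ => ((hn i).trans hnm).ne hi
  obtain ⟨σ, h1, h2⟩ := h.exists_sign hk.injective hn' hm' (hE hnm)
  obtain ⟨-, -, -, h3, h4⟩ := (h.jacobiQuad hE hs hk hn hnm).count h1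
  refine ⟨h3, ?_⟩
  rw [h4, posInd]
  simp only [h2]

theorem deriv_ne_zero (h : ParitySystem a V E φ e) (hE : StrictMono E)
    (hs : TupleSemiDegenerate a φ) (n : ℕ) {x : ℝ} (hx : x ∈ posHalf a) (h0 : φ n x = 0) :
    deriv (φ n) x ≠ 0 := by
  intro h1
  have hq := h.jacobiQuad hE hs (k := Fin.elim0) (n := n) (m := n + 1)
    (fun i => i.elim0) (fun i => i.elim0) (Nat.lt_succ_self n)
  have hj := hq.jacobi x hx
  have hne := hq.neQG x hx
  have e1 : wronskian φ (tupleSnoc Fin.elim0 n) = φ n := wronskian_one _ _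
  rw [e1] at hj hne
  rw [h0, h1, wronskian_zero] at hj
  exact hne h0 (by simpa using hj.symm)

/-- The eigenfunction `φ n` has at least as many zeros as its index. -/
theorem le_zeros (h : ParitySystem a V E φ e) (hE : StrictMono E)
    (hs : TupleSemiDegenerate a φ) (n : ℕ) :
    n ≤ 2 * {x ∈ posHalf a | φ n x = 0}.ncard + e n := by
  have hmono : StrictMono fun n => 2 * {x ∈ posHalf a | φ n x = 0}.ncard + e n := by
    intro n m hnm
    obtain ⟨-, h1⟩ := h.count_step hE hs (k := Fin.elim0) (n := n) (m := m)
      (fun i => i.elim0) (fun i => i.elim0) hnm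
    have e1 : ∀ n, wronskian φ (tupleSnoc Fin.elim0 n) = φ n := fun n => wronskian_one _ _
    rw [e1, e1, wronskian_zero] at h1
    have e2 : {x ∈ posHalf a | (fun _ => (1 : ℝ)) x = 0} = ∅ := by ext; simp
    have e3 : parityDiff e (Fin.elim0 : Fin 0 → ℕ) = 0 := by simp [parityDiff]
    rw [e2, Set.ncard_empty, e3] at h1
    dsimp only
    generalize {x ∈ posHalf a | φ n x = 0}.ncard = NQ at *
    generalize {x ∈ posHalf a | φ m x = 0}.ncard = NP at *
    rcases h.e_cases n with en | en <;> rcases h.e_cases m with em | em <;>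
      rw [en, em] at h1 ⊢ <;> norm_num at h1 <;> omega
  exact hmono.id_le n

/-- The zeros in `(0, a)` are simple and their number is given by the formula for `n_+`. -/
def CountAt (a : EReal) (φ : ℕ → ℝ → ℝ) (e : ℕ → ℕ) {ℓ : ℕ} (k : Fin ℓ → ℕ) : Prop :=
  {x ∈ posHalf a | wronskian φ k x = 0}.Finite ∧
  (∀ x ∈ posHalf a, wronskian φ k x = 0 → deriv (wronskian φ k) x ≠ 0) ∧
  4 * ({x ∈ posHalf a | wronskian φ k x = 0}.ncard : ℤ) =
    2 * altSum k - |parityDiff e k + (ℓ : ℤ) % 2|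

theorem countAt (h : ParitySystem a V E φ e) (hE : StrictMono E)
    (hs : TupleSemiDegenerate a φ) (hfin : ∀ n, {x ∈ posHalf a | φ n x = 0}.Finite)
    (hcard : ∀ n, 2 * {x ∈ posHalf a | φ n x = 0}.ncard + e n = n) (ℓ : ℕ) :
    (∀ k : Fin ℓ → ℕ, StrictMono k → CountAt a φ e k) ∧
    (∀ k : Fin (ℓ + 1) → ℕ, StrictMono k → CountAt a φ e k) := by
  induction ℓ with
  | zero =>
    refine ⟨fun k _ => ?_, fun k _ => ?_⟩
    · have e2 : {x ∈ posHalf a | (fun _ => (1 : ℝ)) x = 0} = ∅ := by ext; simp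
      rw [CountAt, wronskian_zero, e2]
      simp [altSum, parityDiff]
    · rw [CountAt, wronskian_one]
      refine ⟨hfin _, fun x hx h0 => h.deriv_ne_zero hE hs _ hx h0, ?_⟩
      have h1 := hcard (k 0)
      have e1 : altSum k = k 0 := by simp [altSum]
      have e2 : parityDiff e k = 2 * (e (k 0) : ℤ) - 1 := by simp [parityDiff]
      rw [e1, e2]
      generalize {x ∈ posHalf a | φ (k 0) x = 0}.ncard = N at *
      rw [abs_of_nonneg (by norm_num)]
      norm_num
      omega
  | succ ℓ ih =>
    refine ⟨ih.2, fun k'' hk'' => ?_⟩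
    obtain ⟨k', m, rfl⟩ : ∃ k' m, k'' = tupleSnoc k' m := ⟨_, _, EigenSystem.snoc_self k''⟩
    obtain ⟨k, n, rfl⟩ : ∃ k n, k' = tupleSnoc k n := ⟨_, _, EigenSystem.snoc_self k'⟩
    obtain ⟨hk', hm⟩ := strictMono_of_snoc hk''
    obtain ⟨hk, hn⟩ := strictMono_of_snoc hk'
    have hnm : n < m := by simpa [tupleSnoc] using hm (Fin.last ℓ)
    have hkm : ∀ i, k i < m := fun i => (hn i).trans hnm
    obtain ⟨-, -, hF⟩ := ih.1 k hk
    obtain ⟨-, -, hQ⟩ := ih.2 _ hk'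
    obtain ⟨-, -, hP⟩ := ih.2 _ (strictMono_snoc hk hkm)
    obtain ⟨h1, h2⟩ := h.count_step hE hs hk hn hnm
    refine ⟨h1, fun x hx h0 => (h.jacobiQuad hE hs hk hn hnm).deriv_ne_zero hx h0, ?_⟩
    rw [altSum_snoc, parityDiff_snoc] at hQ hP
    rw [altSum_snoc, altSum_snoc, parityDiff_snoc, parityDiff_snoc]
    have hd := parityDiff_emod_two e k
    generalize parityDiff e k = d at *
    generalize altSum k = s at *
    generalize {x ∈ posHalf a | wronskian φ k x = 0}.ncard = NF at *
    generalize {x ∈ posHalf a | wronskian φ (tupleSnoc k n) x = 0}.ncard = NQ at *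
    generalize {x ∈ posHalf a | wronskian φ (tupleSnoc k m) x = 0}.ncard = NP at *
    generalize {x ∈ posHalf a | wronskian φ (tupleSnoc (tupleSnoc k n) m) x = 0}.ncard = NG at *
    push_cast at *
    rcases h.e_cases n with en | en <;> rcases h.e_cases m with em | em <;>
      rw [en] at h2 hQ ⊢ <;> rw [em] at h2 hP ⊢ <;> norm_num at h2 hQ hP ⊢ <;>
      split_ifs at h2 with h3 <;> rw [abs_eq_max_neg] at * <;> omega

end ParitySystem

/-! ### Solutions of the eigenvalue equation -/

theorem contDiffOn_of_second_deriv {I : Set ℝ} (hI : IsOpen I) {q f : ℝ → ℝ}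
    (hq : ContDiffOn ℝ ∞ q I) (hf : ContDiffOn ℝ 2 f I)
    (hode : ∀ x ∈ I, deriv (deriv f) x = q x * f x) : ContDiffOn ℝ ∞ f I := by
  have key : ∀ k : ℕ, ContDiffOn ℝ k f I ∧ ContDiffOn ℝ k (deriv f) I := by
    have h1 : ContDiffOn ℝ 1 (deriv f) I := hf.deriv_of_isOpen hI (by norm_num)
    have hdf : DifferentiableOn ℝ f I := hf.differentiableOn (by norm_num)
    have hddf : DifferentiableOn ℝ (deriv f) I := h1.differentiableOn (by norm_num)
    intro k
    induction k with
    | zero => exact ⟨hf.of_le (by norm_num), h1.of_le (by norm_num)⟩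
    | succ k ih =>
      push_cast
      refine ⟨(contDiffOn_succ_iff_deriv_of_isOpen hI).2 ⟨hdf, by simp, ih.2⟩,
        (contDiffOn_succ_iff_deriv_of_isOpen hI).2 ⟨hddf, by simp, ?_⟩⟩
      exact ((hq.of_le (by exact_mod_cast le_top)).mul ih.1).congr hode
  exact contDiffOn_infty.2 fun k => (key k).1

/-- Uniqueness for the second order equation `f'' = q f` with vanishing initial data. -/
theorem eq_zero_of_second_deriv {I : Set ℝ} (hI : IsOpen I) (hIc : I.OrdConnected) {q f : ℝ → ℝ}
    (hq : ContinuousOn q I) (hf : ContDiffOn ℝ ∞ f I)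
    (hode : ∀ x ∈ I, deriv (deriv f) x = q x * f x) {z : ℝ} (hz : z ∈ I) (h0 : f z = 0)
    (h1 : deriv f z = 0) : ∀ y ∈ I, f y = 0 := by
  intro y hy
  have hsub : Set.uIcc z y ⊆ I := hIc.uIcc_subset hz hy
  obtain ⟨K, hK⟩ := isCompact_uIcc.exists_bound_of_continuousOn (hq.mono hsub)
  have hK' : ∀ t ∈ Set.uIcc z y, |1 + q t| ≤ 1 + K := fun t ht => by
    refine (abs_add_le _ _).trans ?_
    have := hK t ht
    rw [Real.norm_eq_abs] at this
    simpa using this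
  have hd : ∀ t ∈ I, HasDerivAt (fun t => f t ^ 2 + deriv f t ^ 2)
      (2 * f t * deriv f t * (1 + q t)) t := by
    intro t ht
    have a := (hf.hasDerivAt_smooth hI ht).fun_pow 2
    have b := ((hf.deriv_smooth hI).hasDerivAt_smooth hI ht).fun_pow 2
    rw [hode t ht] at b
    refine (a.fun_add b).congr_deriv ?_
    norm_num
    ring
  have hb : ∀ t ∈ Set.uIcc z y, |2 * f t * deriv f t * (1 + q t)| ≤
      (1 + K) * (f t ^ 2 + deriv f t ^ 2) := by
    intro t ht
    rw [abs_mul, mul_comm]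
    refine mul_le_mul (hK' t ht) ?_ (abs_nonneg _) ((abs_nonneg _).trans (hK' t ht))
    rw [abs_le]
    constructor <;> nlinarith [sq_nonneg (f t + deriv f t), sq_nonneg (f t - deriv f t)]
  -- the energy multiplied by an exponential is monotone
  have hexp : ∀ c : ℝ, ∀ t ∈ I, HasDerivAt (fun t => (f t ^ 2 + deriv f t ^ 2) * Real.exp (c * t))
      ((2 * f t * deriv f t * (1 + q t) + c * (f t ^ 2 + deriv f t ^ 2)) * Real.exp (c * t)) t := by
    intro c t ht
    refine ((hd t ht).fun_mul (((hasDerivAt_id t).const_mul c).exp)).congr_deriv ?_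
    simp
    ring
  have key : (f y ^ 2 + deriv f y ^ 2) ≤ 0 := by
    rcases le_total z y with hzy | hzy
    · rw [Set.uIcc_of_le hzy] at hsub hb
      have hanti : AntitoneOn (fun t => (f t ^ 2 + deriv f t ^ 2) * Real.exp (-(1 + K) * t))
          (Set.Icc z y) := by
        refine antitoneOn_of_deriv_nonpos (convex_Icc z y)
          (fun t ht => (hexp _ t (hsub ht)).continuousAt.continuousWithinAt)
          (fun t ht => (hexp _ t (hsub (interior_subset ht))).differentiableAt.differentiableWithinAt)
          fun t ht => ?_
        rw [(hexp _ t (hsub (interior_subset ht))).deriv]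
        refine mul_nonpos_of_nonpos_of_nonneg ?_ (Real.exp_pos _).le
        have := (abs_le.1 (hb t (interior_subset ht))).2
        linarith
      have h2 := hanti ⟨le_rfl, hzy⟩ ⟨hzy, le_rfl⟩ hzy
      simp only [h0, h1] at h2
      norm_num at h2
      exact nonpos_of_mul_nonpos_left (by simpa using h2) (Real.exp_pos _)
    · rw [Set.uIcc_of_ge hzy] at hsub hb
      have hmono : MonotoneOn (fun t => (f t ^ 2 + deriv f t ^ 2) * Real.exp ((1 + K) * t))
          (Set.Icc y z) := by
        refine monotoneOn_of_deriv_nonneg (convex_Icc y z)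
          (fun t ht => (hexp _ t (hsub ht)).continuousAt.continuousWithinAt)
          (fun t ht => (hexp _ t (hsub (interior_subset ht))).differentiableAt.differentiableWithinAt)
          fun t ht => ?_
        rw [(hexp _ t (hsub (interior_subset ht))).deriv]
        refine mul_nonneg ?_ (Real.exp_pos _).le
        have := (abs_le.1 (hb t (interior_subset ht))).1
        linarith
      have h2 := hmono ⟨le_rfl, hzy⟩ ⟨hzy, le_rfl⟩ hzy
      simp only [h0, h1] at h2
      norm_num at h2
      exact nonpos_of_mul_nonpos_left (by simpa using h2) (Real.exp_pos _)
  have : f y ^ 2 = 0 := le_antisymm (by nlinarith [sq_nonneg (deriv f y)]) (sq_nonneg _)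
  exact pow_eq_zero_iff (two_ne_zero) |>.1 this

/-! ### Eigenfunctions of a Hamiltonian -/

theorem measurableSet_realIoo (a b : EReal) : MeasurableSet (realIoo a b) :=
  (isOpen_realIoo a b).measurableSet

/-- Continuous functions which agree almost everywhere on an open set agree on it. -/
theorem eqOn_of_ae_eq_restrict {I : Set ℝ} (hI : IsOpen I) {f g : ℝ → ℝ} (hf : ContinuousOn f I)
    (hg : ContinuousOn g I) (h : f =ᵐ[volume.restrict I] g) : Set.EqOn f g I :=
  Measure.eqOn_of_ae_eq h hf hg (by rw [hI.interior_eq]; exact subset_closure)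

theorem integrable_mul_of_memLp {μ : Measure ℝ} {f g : ℝ → ℝ} (hf : MemLp f 2 μ)
    (hg : MemLp g 2 μ) : Integrable (fun x => f x * g x) μ := hf.integrable_mul hg

namespace IsEigenfunctionSequence

variable {V : ℝ → ℝ} {a b : EReal} {H : Hamiltonian V a b} {E : ℕ → ℝ} {φ : ℕ → ℝ → ℝ}

theorem second_deriv (h : IsEigenfunctionSequence H E φ) (n : ℕ) {x : ℝ} (hx : x ∈ realIoo a b) :
    deriv (deriv (φ n)) x = (V x - E n) * φ n x := by
  have := h.eigen n x hx
  rw [schrodingerOp] at this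
  linarith

theorem smooth (h : IsEigenfunctionSequence H E φ) (hV : ContDiffOn ℝ ∞ V (realIoo a b)) (n : ℕ) :
    ContDiffOn ℝ ∞ (φ n) (realIoo a b) :=
  contDiffOn_of_second_deriv (isOpen_realIoo a b) (hV.sub contDiffOn_const)
    (H.contDiffOn _ (h.mem_domain n)) fun _ hx => h.second_deriv n hx

theorem not_both_zero (h : IsEigenfunctionSequence H E φ) (hV : ContDiffOn ℝ ∞ V (realIoo a b))
    (n : ℕ) {x : ℝ} (hx : x ∈ realIoo a b) (h0 : φ n x = 0) : deriv (φ n) x ≠ 0 := by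
  intro h1
  obtain ⟨y, hy, hne⟩ := h.ne_zero n
  exact hne (eq_zero_of_second_deriv (isOpen_realIoo a b) (ordConnected_realIoo a b)
    (hV.continuousOn.sub continuousOn_const) (h.smooth hV n)
    (fun _ hx => h.second_deriv n hx) hx h0 h1 y hy)

theorem frequentlyNonzero (h : IsEigenfunctionSequence H E φ)
    (hV : ContDiffOn ℝ ∞ V (realIoo a b)) (n : ℕ) : FrequentlyNonzero (realIoo a b) (φ n) := by
  intro x hx h0
  simp only [not_not] at h0
  have h1 : φ n =ᶠ[𝓝 x] fun _ => 0 := h0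
  exact h.not_both_zero hV n hx h1.eq_of_nhds (by rw [h1.deriv_eq]; simp)

theorem eigenSystem (h : IsEigenfunctionSequence H E φ) (hV : ContDiffOn ℝ ∞ V (realIoo a b)) :
    EigenSystem (realIoo a b) V E φ where
  isOpen := isOpen_realIoo a b
  smooth := h.smooth hV
  ode n _ hx := h.second_deriv n hx
  injective := h.strictMono.injective
  nonzero := h.frequentlyNonzero hV

theorem memLp (h : IsEigenfunctionSequence H E φ) (n : ℕ) :
    MemLp (φ n) 2 (volume.restrict (realIoo a b)) := H.memLp _ (h.mem_domain n)

theorem integral_op_mul (h : IsEigenfunctionSequence H E φ) {f : ℝ → ℝ} (hf : f ∈ H.domain)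
    (n : ℕ) : ∫ x in realIoo a b, schrodingerOp V f x * φ n x =
      E n * ∫ x in realIoo a b, f x * φ n x := by
  rw [H.symm f hf _ (h.mem_domain n), ← integral_const_mul]
  refine setIntegral_congr_fun (measurableSet_realIoo a b) fun x hx => ?_
  rw [h.eigen n x hx]
  ring

theorem orthogonal_of_eigen (h : IsEigenfunctionSequence H E φ) {f : ℝ → ℝ} (hf : f ∈ H.domain)
    {c : ℝ} (hfc : ∀ x ∈ realIoo a b, schrodingerOp V f x = c * f x) {n : ℕ} (hn : c ≠ E n) :
    ∫ x in realIoo a b, f x * φ n x = 0 := by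
  have h1 := h.integral_op_mul hf n
  have h2 : ∫ x in realIoo a b, schrodingerOp V f x * φ n x =
      c * ∫ x in realIoo a b, f x * φ n x := by
    rw [← integral_const_mul]
    refine setIntegral_congr_fun (measurableSet_realIoo a b) fun x hx => ?_
    rw [hfc x hx]
    ring
  rw [h2] at h1
  exact (mul_eq_mul_right_iff.1 h1).resolve_left hn

theorem orthogonal (h : IsEigenfunctionSequence H E φ) {m n : ℕ} (hmn : m ≠ n) :
    ∫ x in realIoo a b, φ m x * φ n x = 0 :=
  h.orthogonal_of_eigen (h.mem_domain m) (h.eigen m) fun e => hmn (h.strictMono.injective e)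

theorem integral_sq_pos (h : IsEigenfunctionSequence H E φ) (hV : ContDiffOn ℝ ∞ V (realIoo a b))
    (n : ℕ) : 0 < ∫ x in realIoo a b, φ n x * φ n x := by
  have h0 : 0 ≤ ∫ x in realIoo a b, φ n x * φ n x :=
    integral_nonneg fun x => mul_self_nonneg _
  refine lt_of_le_of_ne h0 fun e => ?_
  rw [eq_comm, integral_eq_zero_iff_of_nonneg (fun x => mul_self_nonneg _)
    ((h.memLp n).integrable_mul (h.memLp n))] at e
  obtain ⟨y, hy, hne⟩ := h.ne_zero n
  have hc := (h.smooth hV n).continuousOn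
  have := eqOn_of_ae_eq_restrict (isOpen_realIoo a b) (hc.mul hc) continuousOn_const e hy
  exact hne (mul_self_eq_zero.1 this)

/-- The eigenvalues are simple. -/
theorem eq_mul_of_eigen (h : IsEigenfunctionSequence H E φ) (hV : ContDiffOn ℝ ∞ V (realIoo a b))
    {f : ℝ → ℝ} (hf : f ∈ H.domain) {n : ℕ}
    (hfc : ∀ x ∈ realIoo a b, schrodingerOp V f x = E n * f x) :
    ∃ c : ℝ, ∀ x ∈ realIoo a b, f x = c * φ n x := by
  have hpos := h.integral_sq_pos hV n
  set c := (∫ x in realIoo a b, f x * φ n x) / ∫ x in realIoo a b, φ n x * φ n x with hc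
  refine ⟨c, ?_⟩
  have hfL := H.memLp f hf
  have hint : ∀ m, ∫ x in realIoo a b, (f x - c * φ n x) * φ m x =
      (∫ x in realIoo a b, f x * φ m x) - c * ∫ x in realIoo a b, φ n x * φ m x := by
    intro m
    rw [← integral_const_mul, ← integral_sub (integrable_mul_of_memLp hfL (h.memLp m))
      ((integrable_mul_of_memLp (h.memLp n) (h.memLp m)).const_mul c)]
    refine integral_congr_ae (Eventually.of_forall fun x => ?_)
    ring
  have hz := h.complete (fun x => f x - c * φ n x) (hfL.sub ((h.memLp n).const_mul c)) fun m => by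
    rw [hint m]
    by_cases hmn : n = m
    · subst hmn
      rw [hc, div_mul_cancel₀ _ hpos.ne', sub_self]
    · rw [h.orthogonal hmn, h.orthogonal_of_eigen hf hfc
        (fun e => hmn (h.strictMono.injective e))]
      simp
  intro x hx
  have := eqOn_of_ae_eq_restrict (isOpen_realIoo a b) ((H.contDiffOn f hf).continuousOn.sub
    (continuousOn_const.mul (h.smooth hV n).continuousOn)) continuousOn_const hz hx
  exact sub_eq_zero.1 this

end IsEigenfunctionSequence

theorem schrodingerOp_comp_neg {V f : ℝ → ℝ} {x : ℝ} (hV : V (-x) = V x) :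
    schrodingerOp V (fun y => f (-y)) x = schrodingerOp V f (-x) := by
  have h1 : deriv (fun y => f (-y)) = fun y => -deriv f (-y) := by
    funext y
    exact deriv_comp_neg f y
  rw [schrodingerOp, schrodingerOp, h1, deriv.fun_neg, deriv_comp_neg, hV]
  ring

/-- Eigenfunctions of a symmetric Hamiltonian with even potential are even or odd. -/
theorem IsEigenfunctionSequence.even_or_odd {V : ℝ → ℝ} {a : EReal} {H : Hamiltonian V (-a) a}
    {E : ℕ → ℝ} {φ : ℕ → ℝ → ℝ} (h : IsEigenfunctionSequence H E φ)
    (hV : ContDiffOn ℝ ∞ V (realIoo (-a) a)) (hVeven : ∀ x ∈ realIoo (-a) a, V (-x) = V x)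
    (hHeven : ∀ f ∈ H.domain, (fun x => f (-x)) ∈ H.domain) (n : ℕ) :
    (∀ x ∈ realIoo (-a) a, φ n (-x) = φ n x) ∨ (∀ x ∈ realIoo (-a) a, φ n (-x) = -φ n x) := by
  obtain ⟨c, hc⟩ := h.eq_mul_of_eigen hV (f := fun x => φ n (-x)) (n := n)
    (hHeven _ (h.mem_domain n)) fun x hx => by
      rw [schrodingerOp_comp_neg (hVeven x hx), h.eigen n _ (neg_mem_realIoo hx)]
  obtain ⟨y, hy, hne⟩ := h.ne_zero n
  have h1 := hc y hy
  have h2 := hc (-y) (neg_mem_realIoo hy)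
  simp only [neg_neg] at h2
  rw [h1, ← mul_assoc] at h2
  have h3 : c * c = 1 := by
    apply mul_right_cancel₀ hne
    rw [← h2, one_mul]
  rcases mul_self_eq_one_iff.1 h3 with rfl | rfl
  · exact Or.inl fun x hx => by simpa using hc x hx
  · exact Or.inr fun x hx => by simpa using hc x hx

/-! ### Cutoffs and boundary Wronskians -/

instance (a : EReal) : (rightEnd a).IsCountablyGenerated := by
  unfold rightEnd; infer_instance

theorem ContDiffOn.hasDerivAt_two {I : Set ℝ} (hI : IsOpen I) {f : ℝ → ℝ}
    (hf : ContDiffOn ℝ 2 f I) {x : ℝ} (hx : x ∈ I) :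
    HasDerivAt f (deriv f x) x ∧ HasDerivAt (deriv f) (deriv (deriv f) x) x :=
  ⟨((hf.contDiffAt (hI.mem_nhds hx)).differentiableAt (by norm_num)).hasDerivAt,
    (((hf.deriv_of_isOpen (m := 1) hI (by norm_num)).contDiffAt (hI.mem_nhds hx)).differentiableAt
      (by norm_num)).hasDerivAt⟩

/-- A smooth step from `0` on `(-∞, -1]` to `1` on `[1, ∞)`. -/
noncomputable def smoothStep (t : ℝ) : ℝ := Real.smoothTransition ((t + 1) / 2)

theorem smoothStep_contDiff : ContDiff ℝ ∞ smoothStep :=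
  Real.smoothTransition.contDiff.comp ((contDiff_id.add contDiff_const).div_const 2)

theorem smoothStep_of_le {t : ℝ} (ht : t ≤ -1) : smoothStep t = 0 :=
  Real.smoothTransition.zero_of_nonpos (by linarith)

theorem smoothStep_of_ge {t : ℝ} (ht : 1 ≤ t) : smoothStep t = 1 :=
  Real.smoothTransition.one_of_one_le (by linarith)

theorem deriv_smoothStep_eq_zero {t : ℝ} (ht : t ∉ Set.Icc (-1 : ℝ) 1) : deriv smoothStep t = 0 := by
  rw [Set.mem_Icc, not_and_or, not_le, not_le] at ht
  rcases ht with ht | ht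
  · have : smoothStep =ᶠ[𝓝 t] fun _ => 0 := by
      filter_upwards [eventually_lt_nhds ht] with s hs using smoothStep_of_le hs.le
    rw [this.deriv_eq]; simp
  · have : smoothStep =ᶠ[𝓝 t] fun _ => 1 := by
      filter_upwards [eventually_gt_nhds ht] with s hs using smoothStep_of_ge hs.le
    rw [this.deriv_eq]; simp

theorem exists_bound_deriv_smoothStep : ∃ C : ℝ, ∀ t, |deriv smoothStep t| ≤ C := by
  have hc : Continuous (deriv smoothStep) := smoothStep_contDiff.continuous_deriv (by simp)
  obtain ⟨C, hC⟩ := (isCompact_Icc (a := (-1 : ℝ)) (b := 1)).exists_bound_of_continuousOn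
    hc.continuousOn
  refine ⟨max C 0, fun t => ?_⟩
  by_cases ht : t ∈ Set.Icc (-1 : ℝ) 1
  · exact (hC t ht).trans (le_max_left _ _)
  · rw [deriv_smoothStep_eq_zero ht]; simp

theorem Hamiltonian.cutoff_mem_of_compact {V : ℝ → ℝ} {a b : EReal} (H : Hamiltonian V a b)
    {f : ℝ → ℝ} (hf : f ∈ H.domain) {χ : ℝ → ℝ} (hχ : ContDiff ℝ ∞ χ) {K : Set ℝ}
    (hK : IsCompact K) (hKI : K ⊆ realIoo a b) (h0 : ∀ x, x ∉ K → deriv χ x = 0) :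
    (fun x => χ x * f x) ∈ H.domain := by
  refine H.cutoff_mem f hf χ hχ (HasCompactSupport.intro hK fun x hx => h0 x hx) ?_
  refine (closure_minimal ?_ hK.isClosed).trans hKI
  intro x hx
  by_contra hxK
  exact hx (h0 x hxK)

theorem Hamiltonian.tendsto_wronskian {V : ℝ → ℝ} {a : EReal} (ha : 0 < a)
    (H : Hamiltonian V (-a) a) {f g : ℝ → ℝ} (hf : f ∈ H.domain) (hg : g ∈ H.domain) :
    Tendsto (fun x => f x * deriv g x - deriv f x * g x) (rightEnd a) (𝓝 0) := by
  have hI := isOpen_realIoo (-a) a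
  have hbot : ⊥ < a := EReal.bot_lt_zero.trans ha
  obtain ⟨r, hr0, hra⟩ := EReal.lt_iff_exists_real_btwn.1 ha
  have hr0' : 0 < r := EReal.coe_pos.1 hr0
  have hmem : ∀ x : ℝ, 0 ≤ x → (x : EReal) < a → x ∈ realIoo (-a) a := fun x h1 h2 =>
    ⟨(EReal.neg_lt_zero.2 ha).trans_le (EReal.coe_nonneg.2 h1), h2⟩
  -- the cutoff rises from `0` to `1` on `[r / 3, r]`
  set χ : ℝ → ℝ := fun x => smoothStep ((x - 2 * r / 3) / (r / 3)) with hχ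
  have hr3 : 0 < r / 3 := by positivity
  have χ0 : ∀ x, x ≤ r / 3 → χ x = 0 := fun x hx => smoothStep_of_le (by
    rw [div_le_iff₀ hr3]; linarith)
  have χ1 : ∀ x, r ≤ x → χ x = 1 := fun x hx => smoothStep_of_ge (by
    rw [le_div_iff₀ hr3]; linarith)
  have hχs : ContDiff ℝ ∞ χ :=
    smoothStep_contDiff.comp ((contDiff_id.sub contDiff_const).div_const _)
  have hu : (fun x => χ x * f x) ∈ H.domain := by
    refine H.cutoff_mem_of_compact hf hχs (K := Set.Icc 0 r) isCompact_Icc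
      (fun x hx => hmem x hx.1 ((EReal.coe_le_coe_iff.2 hx.2).trans_lt hra)) fun x hx => ?_
    rw [Set.mem_Icc, not_and_or, not_le, not_le] at hx
    rcases hx with hx | hx
    · have : χ =ᶠ[𝓝 x] fun _ => 0 := by
        filter_upwards [eventually_lt_nhds hx] with y hy using χ0 y (by linarith)
      rw [this.deriv_eq]; simp
    · have : χ =ᶠ[𝓝 x] fun _ => 1 := by
        filter_upwards [eventually_gt_nhds hx] with y hy using χ1 y hy.le
      rw [this.deriv_eq]; simp
  set u : ℝ → ℝ := fun x => χ x * f x with hu_def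
  have hu0 : ∀ x, x < r / 3 → u =ᶠ[𝓝 x] fun _ => 0 := fun x hx => by
    filter_upwards [eventually_lt_nhds hx] with y hy
    simp [hu_def, χ0 y hy.le]
  have hu1 : ∀ x, r < x → u =ᶠ[𝓝 x] f := fun x hx => by
    filter_upwards [eventually_gt_nhds hx] with y hy
    simp [hu_def, χ1 y hy.le]
  set h : ℝ → ℝ := fun x => schrodingerOp V u x * g x - u x * schrodingerOp V g x with hh
  set w : ℝ → ℝ := fun x => u x * deriv g x - deriv u x * g x with hw
  have i1 := integrable_mul_of_memLp (H.memLp_op u hu) (H.memLp g hg)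
  have i2 := integrable_mul_of_memLp (H.memLp u hu) (H.memLp_op g hg)
  have hint : Integrable h (volume.restrict (realIoo (-a) a)) := i1.sub i2
  have hzero : ∫ x in realIoo (-a) a, h x = 0 := by
    rw [hh, integral_sub i1 i2, H.symm u hu g hg, sub_self]
  have hw' : ∀ x ∈ realIoo (-a) a, HasDerivAt w (h x) x := by
    intro x hx
    obtain ⟨u1, u2⟩ := (H.contDiffOn u hu).hasDerivAt_two hI hx
    obtain ⟨g1, g2⟩ := (H.contDiffOn g hg).hasDerivAt_two hI hx
    refine ((u1.fun_mul g2).fun_sub (u2.fun_mul g1)).congr_deriv ?_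
    simp only [hh, schrodingerOp]
    ring
  have h0 : ∀ x, x < r / 3 → h x = 0 := by
    intro x hx
    have e1 := hu0 x hx
    have e2 : deriv u =ᶠ[𝓝 x] fun _ => 0 := by
      have := e1.deriv
      simpa using this
    simp [hh, schrodingerOp, e1.eq_of_nhds, e2.deriv_eq]
  have w0 : w 0 = 0 := by
    have e1 := hu0 0 hr3
    simp [hw, e1.eq_of_nhds, e1.deriv_eq]
  have hcover : AECover (volume.restrict (realIoo (-a) a)) (rightEnd a) fun X : ℝ => Set.Iic X := by
    refine ⟨?_, fun X => measurableSet_Iic⟩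
    refine (ae_restrict_mem (measurableSet_realIoo _ _)).mono fun x hx => ?_
    refine (eventually_rightEnd_iff hbot).2 ⟨x, hx.2, fun y hy => (mem_realIoo_coe.1 hy).1.le⟩
  have hlim := hcover.integral_tendsto_of_countably_generated hint
  rw [hzero] at hlim
  refine hlim.congr' ?_
  refine (eventually_rightEnd_iff hbot).2 ⟨r, hra, fun X hX => ?_⟩
  have hX' := mem_realIoo_coe.1 hX
  have hsub : Set.Icc 0 X ⊆ realIoo (-a) a := fun x hx =>
    hmem x hx.1 ((EReal.coe_le_coe_iff.2 hx.2).trans_lt hX'.2)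
  have h0X : 0 ≤ X := hr0'.le.trans hX'.1.le
  beta_reduce
  rw [Measure.restrict_restrict measurableSet_Iic]
  rw [setIntegral_eq_of_subset_of_forall_sdiff_eq_zero (s := Set.Ioc 0 X)
    (measurableSet_Iic.inter (measurableSet_realIoo _ _))
    (fun x hx => ⟨hx.2, hsub ⟨hx.1.le, hx.2⟩⟩) (fun x hx => by
      apply h0
      by_contra! hlt
      exact hx.2 ⟨by linarith, hx.1.1⟩)]
  rw [← intervalIntegral.integral_of_le h0X,
    intervalIntegral.integral_eq_sub_of_hasDerivAt (f := w) (fun x hx => hw' x (hsub (by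
      rwa [Set.uIcc_of_le h0X] at hx)))]
  · rw [w0, sub_zero]
    have e1 := hu1 X hX'.1
    simp [hw, e1.eq_of_nhds, e1.deriv_eq]
  · rw [intervalIntegrable_iff_integrableOn_Icc_of_le h0X]
    exact IntegrableOn.mono_set hint hsub

/-! ### Spectral estimates -/

theorem inner_toLp_toLp {μ : Measure ℝ} {f g : ℝ → ℝ} (hf : MemLp f 2 μ)
    (hg : MemLp g 2 μ) : inner ℝ (hf.toLp f) (hg.toLp g) = ∫ x, f x * g x ∂μ := by
  rw [L2.inner_def]
  refine integral_congr_ae ?_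
  filter_upwards [hf.coeFn_toLp, hg.coeFn_toLp] with x h1 h2
  rw [h1, h2]
  simp [mul_comm]

namespace IsEigenfunctionSequence

variable {V : ℝ → ℝ} {a b : EReal} {H : Hamiltonian V a b} {E : ℕ → ℝ} {φ : ℕ → ℝ → ℝ}

/-- The orthonormal basis of eigenfunctions. -/
theorem exists_hilbertBasis (h : IsEigenfunctionSequence H E φ)
    (hV : ContDiffOn ℝ ∞ V (realIoo a b)) :
    ∃ B : HilbertBasis ℕ ℝ (Lp ℝ 2 (volume.restrict (realIoo a b))), ∃ c : ℕ → ℝ,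
      ∀ n, B n = c n • (h.memLp n).toLp (φ n) := by
  set c : ℕ → ℝ := fun n => (Real.sqrt (∫ x in realIoo a b, φ n x * φ n x))⁻¹ with hc
  have hcpos : ∀ n, c n ≠ 0 := fun n =>
    inv_ne_zero (Real.sqrt_ne_zero'.2 (h.integral_sq_pos hV n))
  set v : ℕ → Lp ℝ 2 (volume.restrict (realIoo a b)) :=
    fun n => c n • (h.memLp n).toLp (φ n) with hv
  have hon : Orthonormal ℝ v := by
    rw [orthonormal_iff_ite]
    intro i j
    rw [hv, inner_smul_left, inner_smul_right, inner_toLp_toLp]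
    split_ifs with hij
    · subst hij
      have h1 := Real.mul_self_sqrt (h.integral_sq_pos hV i).le
      simp only [hc, conj_trivial]
      rw [← mul_assoc, ← mul_inv, h1, inv_mul_cancel₀ (h.integral_sq_pos hV i).ne']
    · rw [h.orthogonal hij]; simp
  have hsp : (Submodule.span ℝ (Set.range v))ᗮ = ⊥ := by
    rw [Submodule.eq_bot_iff]
    intro f hf
    have hf' : ∀ n, ∫ x in realIoo a b, f x * φ n x = 0 := by
      intro n
      have h1 := (Submodule.mem_orthogonal _ f).1 hf (v n) (Submodule.subset_span ⟨n, rfl⟩)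
      rw [hv, inner_smul_left, mul_eq_zero] at h1
      have h2 := h1.resolve_left (by simpa using hcpos n)
      rw [L2.inner_def] at h2
      rw [← h2]
      refine integral_congr_ae ?_
      filter_upwards [(h.memLp n).coeFn_toLp] with x h1
      rw [h1]
      simp
    have := h.complete f (Lp.memLp f) hf'
    exact Lp.ext (this.trans (Lp.coeFn_zero ..).symm)
  refine ⟨HilbertBasis.mkOfOrthogonalEqBot hon hsp, c, fun n => ?_⟩
  rw [HilbertBasis.coe_mkOfOrthogonalEqBot]

/-- On the orthogonal complement of `φ 0, …, φ n` the Hamiltonian is bounded below by `E (n+1)`. -/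
theorem le_integral_op (h : IsEigenfunctionSequence H E φ) (hV : ContDiffOn ℝ ∞ V (realIoo a b))
    {u : ℝ → ℝ} (hu : u ∈ H.domain) {n : ℕ}
    (hort : ∀ i ≤ n, ∫ x in realIoo a b, u x * φ i x = 0) :
    E (n + 1) * ∫ x in realIoo a b, u x * u x ≤
      ∫ x in realIoo a b, u x * schrodingerOp V u x := by
  obtain ⟨B, c, hB⟩ := h.exists_hilbertBasis hV
  have hu2 := H.memLp u hu
  have hHu2 := H.memLp_op u hu
  have s1 := B.hasSum_inner_mul_inner (hu2.toLp u) (hHu2.toLp _)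
  have s2 := (B.hasSum_inner_mul_inner (hu2.toLp u) (hu2.toLp u)).mul_left (E (n + 1))
  have s := s1.sub s2
  rw [inner_toLp_toLp, inner_toLp_toLp] at s
  have hnn := s.nonneg fun k => by
    have e1 : inner ℝ (B k) (hHu2.toLp _) = E k * inner ℝ (B k) (hu2.toLp u) := by
      rw [hB, inner_smul_left, inner_smul_left, real_inner_comm, inner_toLp_toLp,
        real_inner_comm, inner_toLp_toLp, h.integral_op_mul hu]
      ring
    have e2 : inner ℝ (hu2.toLp u) (B k) = inner ℝ (B k) (hu2.toLp u) := real_inner_comm _ _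
    rw [e1, e2]
    rcases le_or_gt k n with hk | hk
    · have : inner ℝ (B k) (hu2.toLp u) = 0 := by
        rw [hB, inner_smul_left, real_inner_comm, inner_toLp_toLp, hort k hk, mul_zero]
      rw [this]; simp
    · have : E (n + 1) ≤ E k := h.strictMono.monotone hk
      nlinarith [mul_nonneg (sub_nonneg.2 this) (mul_self_nonneg (inner ℝ (B k) (hu2.toLp u)))]
  linarith

/-- For `u = χ φ n` with a cutoff `χ`, the energy excess over `E n` is `∫ (χ')² (φ n)²`. -/
theorem integral_cutoff (h : IsEigenfunctionSequence H E φ)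
    {χ : ℝ → ℝ} (hχ : ContDiff ℝ ∞ χ) {K : Set ℝ} (hK : IsCompact K) (hKI : K ⊆ realIoo a b)
    (h0 : ∀ x, x ∉ K → deriv χ x = 0) (n : ℕ) :
    ∫ x in realIoo a b, (χ x * φ n x) * schrodingerOp V (fun x => χ x * φ n x) x =
      E n * (∫ x in realIoo a b, (χ x * φ n x) * (χ x * φ n x)) +
        ∫ x in realIoo a b, deriv χ x ^ 2 * φ n x ^ 2 := by
  have hφ := h.mem_domain n
  have hI := isOpen_realIoo a b
  have hu := H.cutoff_mem_of_compact hφ hχ hK hKI h0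
  have hχd : ∀ x, HasDerivAt χ (deriv χ x) x := fun x =>
    (hχ.differentiable (by simp) x).hasDerivAt
  have hχ2 : ContDiff ℝ ∞ fun x => χ x * χ x := hχ.mul hχ
  have hv := H.cutoff_mem_of_compact hφ hχ2 hK hKI fun x hx => by
    rw [((hχd x).fun_mul (hχd x)).deriv, h0 x hx]; ring
  have hχdd : ∀ x, HasDerivAt (deriv χ) (deriv (deriv χ) x) x := fun x =>
    ((contDiff_infty_iff_deriv.1 hχ).2.differentiable (by simp) x).hasDerivAt
  have hop : ∀ ψ : ℝ → ℝ, (∀ x, HasDerivAt ψ (deriv ψ x) x) →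
      (∀ x, HasDerivAt (deriv ψ) (deriv (deriv ψ) x) x) → ∀ x ∈ realIoo a b,
      schrodingerOp V (fun x => ψ x * φ n x) x = -(deriv (deriv ψ) x) * φ n x
        - 2 * deriv ψ x * deriv (φ n) x + ψ x * (E n * φ n x) := by
    intro ψ h1 h2 x hx
    have e1 : deriv (fun x => ψ x * φ n x) =ᶠ[𝓝 x]
        fun x => deriv ψ x * φ n x + ψ x * deriv (φ n) x := by
      filter_upwards [hI.mem_nhds hx] with y hy
      exact ((h1 y).fun_mul ((H.contDiffOn _ hφ).hasDerivAt_two hI hy).1).deriv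
    have hy := (H.contDiffOn _ hφ).hasDerivAt_two hI hx
    rw [schrodingerOp, e1.deriv_eq,
      (((h2 x).fun_mul hy.1).fun_add ((h1 x).fun_mul hy.2)).deriv, ← h.eigen n x hx, schrodingerOp]
    ring
  have hχ2d : deriv (fun x => χ x * χ x) = fun x => 2 * (χ x * deriv χ x) := by
    funext x
    rw [((hχd x).fun_mul (hχd x)).deriv]
    ring
  have hχ2dd : ∀ x, HasDerivAt (deriv fun x => χ x * χ x)
      (2 * (deriv χ x * deriv χ x + χ x * deriv (deriv χ) x)) x := fun x => by
    rw [hχ2d]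
    exact ((hχd x).fun_mul (hχdd x)).const_mul 2
  have i1 := integrable_mul_of_memLp (H.memLp _ hu) (H.memLp_op _ hu)
  have i2 := integrable_mul_of_memLp (H.memLp_op _ hv) (h.memLp n)
  have i3 := integrable_mul_of_memLp (H.memLp _ hu) (H.memLp _ hu)
  have hsym := h.integral_op_mul hv n
  have e3 : ∫ x in realIoo a b, (χ x * χ x * φ n x) * φ n x =
      ∫ x in realIoo a b, (χ x * φ n x) * (χ x * φ n x) :=
    integral_congr_ae (Eventually.of_forall fun x => by ring)
  rw [e3] at hsym
  have key : ∫ x in realIoo a b, deriv χ x ^ 2 * φ n x ^ 2 =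
      ∫ x in realIoo a b, ((χ x * φ n x) * schrodingerOp V (fun x => χ x * φ n x) x -
        1 / 2 * (schrodingerOp V (fun x => χ x * χ x * φ n x) x * φ n x) -
        E n / 2 * ((χ x * φ n x) * (χ x * φ n x))) := by
    refine setIntegral_congr_fun (measurableSet_realIoo a b) fun x hx => ?_
    have a1 := hop χ hχd hχdd x hx
    have a2 := hop (fun x => χ x * χ x)
      (fun x => ((hχd x).fun_mul (hχd x)).differentiableAt.hasDerivAt)
      (fun x => (hχ2dd x).differentiableAt.hasDerivAt) x hx
    rw [(hχ2dd x).deriv, congrFun hχ2d x] at a2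
    rw [a1, a2]
    ring
  have i4 : Integrable (fun x => (χ x * φ n x) * schrodingerOp V (fun x => χ x * φ n x) x -
      1 / 2 * (schrodingerOp V (fun x => χ x * χ x * φ n x) x * φ n x))
      (volume.restrict (realIoo a b)) := i1.sub (i2.const_mul _)
  rw [key, integral_sub i4 (i3.const_mul _), integral_sub i1 (i2.const_mul _), integral_const_mul, integral_const_mul, hsym]
  ring

end IsEigenfunctionSequence

/-! ### The upper bound for the number of zeros -/

/-- A smoothed step function with jumps `b z` at the points `z ∈ T`. -/
noncomputable def stepSum (T : Finset ℝ) (b₀ : ℝ) (b : ℝ → ℝ) (ε x : ℝ) : ℝ :=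
  b₀ + ∑ z ∈ T, b z * smoothStep ((x - z) / ε)

theorem contDiff_smoothStep_div (z ε : ℝ) : ContDiff ℝ ∞ fun x => smoothStep ((x - z) / ε) :=
  smoothStep_contDiff.comp ((contDiff_id.sub contDiff_const).div_const _)

theorem hasDerivAt_smoothStep_div (z ε x : ℝ) :
    HasDerivAt (fun x => smoothStep ((x - z) / ε)) (deriv smoothStep ((x - z) / ε) / ε) x := by
  have h1 : HasDerivAt smoothStep (deriv smoothStep ((x - z) / ε)) ((x - z) / ε) :=
    (smoothStep_contDiff.differentiable (by simp) _).hasDerivAt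
  have h2 : HasDerivAt (fun x : ℝ => (x - z) / ε) (1 / ε) x :=
    ((hasDerivAt_id x).sub_const z).div_const ε
  refine (h1.comp x h2).congr_deriv ?_
  ring

theorem deriv_smoothStep_div_eq_zero {z ε x : ℝ} (hε : 0 < ε) (hx : x ∉ Set.Icc (z - ε) (z + ε)) :
    deriv smoothStep ((x - z) / ε) = 0 := by
  refine deriv_smoothStep_eq_zero fun h => hx ?_
  rw [Set.mem_Icc, le_div_iff₀ hε, div_le_iff₀ hε] at h
  constructor <;> linarith [h.1, h.2]

theorem contDiff_stepSum (T : Finset ℝ) (b₀ : ℝ) (b : ℝ → ℝ) (ε : ℝ) :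
    ContDiff ℝ ∞ (stepSum T b₀ b ε) :=
  contDiff_const.add (ContDiff.sum fun z _ => contDiff_const.mul (contDiff_smoothStep_div z ε))

theorem deriv_stepSum (T : Finset ℝ) (b₀ : ℝ) (b : ℝ → ℝ) (ε x : ℝ) :
    deriv (stepSum T b₀ b ε) x = ∑ z ∈ T, b z * (deriv smoothStep ((x - z) / ε) / ε) := by
  have : HasDerivAt (stepSum T b₀ b ε) (∑ z ∈ T, b z * (deriv smoothStep ((x - z) / ε) / ε)) x :=
    (HasDerivAt.fun_sum fun z _ => (hasDerivAt_smoothStep_div z ε x).const_mul (b z)).const_add b₀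
  exact this.deriv

/-- The jump of a smoothed step function across one of its transition intervals. -/
theorem exists_stepSum_eq {T : Finset ℝ} (b₀ : ℝ) (b : ℝ → ℝ) {ε δ : ℝ} (hε : 0 < ε) (hεδ : ε ≤ δ)
    (hsep : ∀ z ∈ T, ∀ w ∈ T, z ≠ w → 4 * δ ≤ |z - w|) {z : ℝ} (hz : z ∈ T) :
    ∃ c : ℝ, (∀ x ∈ Set.Ioo (z - 2 * δ) (z - δ), stepSum T b₀ b ε x = c) ∧
      ∀ x ∈ Set.Ioo (z + δ) (z + 2 * δ), stepSum T b₀ b ε x = c + b z := by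
  have hother : ∀ w ∈ T.erase z, ∀ x ∈ Set.Ioo (z - 2 * δ) (z + 2 * δ),
      smoothStep ((x - w) / ε) = if w < z then 1 else 0 := by
    intro w hw x hx
    have h1 := hsep z hz w (Finset.mem_of_mem_erase hw) (Finset.ne_of_mem_erase hw).symm
    split_ifs with hwz
    · rw [abs_of_pos (sub_pos.2 hwz)] at h1
      refine smoothStep_of_ge ?_
      rw [le_div_iff₀ hε]
      linarith [hx.1]
    · have hzw : z < w := lt_of_le_of_ne (not_lt.1 hwz) (Finset.ne_of_mem_erase hw).symm
      rw [abs_of_neg (sub_neg.2 hzw)] at h1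
      refine smoothStep_of_le ?_
      rw [div_le_iff₀ hε]
      linarith [hx.2]
  refine ⟨b₀ + ∑ w ∈ T.erase z, b w * if w < z then 1 else 0, fun x hx => ?_, fun x hx => ?_⟩
  · rw [stepSum, ← Finset.add_sum_erase T _ hz, smoothStep_of_le, mul_zero, zero_add]
    · congr 1
      refine Finset.sum_congr rfl fun w hw => ?_
      rw [hother w hw x ⟨hx.1, by linarith [hx.2]⟩]
    · rw [div_le_iff₀ hε]
      linarith [hx.2]
  · rw [stepSum, ← Finset.add_sum_erase T _ hz, smoothStep_of_ge]
    · have : ∑ w ∈ T.erase z, b w * smoothStep ((x - w) / ε) =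
          ∑ w ∈ T.erase z, b w * if w < z then 1 else 0 :=
        Finset.sum_congr rfl fun w hw => by rw [hother w hw x ⟨by linarith [hx.1], hx.2⟩]
      rw [this]
      ring
    · rw [le_div_iff₀ hε]
      linarith [hx.1]

theorem exists_separation {I : Set ℝ} (hI : IsOpen I) (T : Finset ℝ) (hT : ∀ z ∈ T, z ∈ I) :
    ∃ δ > 0, (∀ z ∈ T, Set.Icc (z - 2 * δ) (z + 2 * δ) ⊆ I) ∧
      ∀ z ∈ T, ∀ w ∈ T, z ≠ w → 4 * δ ≤ |z - w| := by
  have h1 : ∀ᶠ δ in 𝓝[>] (0 : ℝ), ∀ z ∈ T, Set.Icc (z - 2 * δ) (z + 2 * δ) ⊆ I := by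
    refine (Filter.eventually_all_finset T).2 fun z hz => ?_
    obtain ⟨r, hr, hrI⟩ := Metric.isOpen_iff.1 hI z (hT z hz)
    filter_upwards [nhdsWithin_le_nhds (eventually_lt_nhds (half_pos hr))] with δ hδ x hx
    refine hrI ?_
    rw [Metric.mem_ball, Real.dist_eq, abs_lt]
    constructor <;> linarith [hx.1, hx.2]
  have h2 : ∀ᶠ δ in 𝓝[>] (0 : ℝ), ∀ z ∈ T, ∀ w ∈ T, z ≠ w → 4 * δ ≤ |z - w| := by
    refine (Filter.eventually_all_finset T).2 fun z _ => (Filter.eventually_all_finset T).2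
      fun w _ => ?_
    by_cases hzw : z = w
    · exact Eventually.of_forall fun δ h => absurd hzw h
    · have : 0 < |z - w| / 4 := by
        have := abs_pos.2 (sub_ne_zero.2 hzw)
        positivity
      filter_upwards [nhdsWithin_le_nhds (eventually_lt_nhds this)] with δ hδ _
      linarith
  obtain ⟨δ, ⟨h3, h4⟩, h5⟩ := ((h1.and h2).and self_mem_nhdsWithin).exists
  exact ⟨δ, h5, h3, h4⟩

theorem Finset.exists_pos_le {T : Finset ℝ} {g : ℝ → ℝ} (hg : ∀ z ∈ T, 0 < g z) :
    ∃ κ > 0, ∀ z ∈ T, κ ≤ g z := by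
  rcases T.eq_empty_or_nonempty with rfl | hne
  · exact ⟨1, one_pos, by simp⟩
  · obtain ⟨z, hz, hmin⟩ := T.exists_min_image g hne
    exact ⟨g z, hg z hz, hmin⟩

namespace IsEigenfunctionSequence

variable {V : ℝ → ℝ} {a b : EReal} {H : Hamiltonian V a b} {E : ℕ → ℝ} {φ : ℕ → ℝ → ℝ}

theorem smoothStep_mul_mem (h : IsEigenfunctionSequence H E φ) {z ε : ℝ} (hε : 0 < ε)
    (hI : Set.Icc (z - ε) (z + ε) ⊆ realIoo a b) (n : ℕ) :
    (fun x => smoothStep ((x - z) / ε) * φ n x) ∈ H.domain := by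
  refine H.cutoff_mem_of_compact (h.mem_domain n) (contDiff_smoothStep_div z ε) isCompact_Icc hI
    fun x hx => ?_
  rw [(hasDerivAt_smoothStep_div z ε x).deriv, deriv_smoothStep_div_eq_zero hε hx, zero_div]

/-- There are more jumps than orthogonality conditions. -/
theorem exists_stepSum_orthogonal (h : IsEigenfunctionSequence H E φ) {T : Finset ℝ} {ε : ℝ}
    (hε : 0 < ε) (hI : ∀ z ∈ T, Set.Icc (z - ε) (z + ε) ⊆ realIoo a b) {n : ℕ} (hn : n < T.card) :
    ∃ (β₀ : ℝ) (β : ℝ → ℝ), (β₀ ≠ 0 ∨ ∃ z ∈ T, β z ≠ 0) ∧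
      ∀ i ≤ n, ∫ x in realIoo a b, stepSum T β₀ β ε x * φ n x * φ i x = 0 := by
  set L : ((Option T) → ℝ) →ₗ[ℝ] (Fin (n + 1) → ℝ) := Matrix.mulVecLin
    (Matrix.of fun (i : Fin (n + 1)) (o : Option T) =>
      o.elim (∫ x in realIoo a b, φ n x * φ i x)
        fun z => ∫ x in realIoo a b, smoothStep ((x - z) / ε) * φ n x * φ i x) with hL
  have hker : LinearMap.ker L ≠ ⊥ := LinearMap.ker_ne_bot_of_finrank_lt (by simp; omega)
  obtain ⟨c, hc, hc0⟩ := (Submodule.ne_bot_iff _).1 hker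
  refine ⟨c none, fun z => if hz : z ∈ T then c (some ⟨z, hz⟩) else 0, ?_, fun i hi => ?_⟩
  · by_contra! h0
    apply hc0
    funext o
    rcases o with _ | ⟨z, hz⟩
    · exact h0.1
    · simpa [hz] using h0.2 z hz
  · have h1 := congrFun (LinearMap.mem_ker.1 hc) ⟨i, Nat.lt_succ_of_le hi⟩
    simp only [hL, Matrix.mulVecLin_apply, Matrix.mulVec, dotProduct, Matrix.of_apply,
      Fintype.sum_option, Option.elim, Pi.zero_apply] at h1
    have i1 := integrable_mul_of_memLp (h.memLp n) (h.memLp i)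
    have i2 : ∀ z ∈ T, Integrable (fun x => smoothStep ((x - z) / ε) * φ n x * φ i x)
        (volume.restrict (realIoo a b)) := fun z hz =>
      integrable_mul_of_memLp (H.memLp _ (h.smoothStep_mul_mem hε (hI z hz) n)) (h.memLp i)
    have e1 : ∀ x, stepSum T (c none) (fun z => if hz : z ∈ T then c (some ⟨z, hz⟩) else 0) ε x *
        φ n x * φ i x = c none * (φ n x * φ i x) + ∑ z ∈ T.attach,
          c (some z) * (smoothStep ((x - z) / ε) * φ n x * φ i x) := by
      intro x
      rw [stepSum, ← Finset.sum_attach, add_mul, add_mul, Finset.sum_mul, Finset.sum_mul]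
      congr 1
      · ring
      · refine Finset.sum_congr rfl fun z _ => ?_
        simp
        ring
    simp_rw [e1]
    have i3 : ∀ z ∈ T.attach, Integrable (fun x => c (some z) *
        (smoothStep ((x - z) / ε) * φ n x * φ i x)) (volume.restrict (realIoo a b)) :=
      fun z _ => (i2 z z.2).const_mul _
    rw [integral_add (i1.const_mul _) (integrable_finsetSum _ i3), integral_const_mul,
      integral_finsetSum _ i3]
    simp_rw [integral_const_mul]
    rw [← h1]
    simp [mul_comm]

/-- The number of zeros of the `n`-th eigenfunction is at most `n`. -/
theorem card_zeros_le (h : IsEigenfunctionSequence H E φ) (hV : ContDiffOn ℝ ∞ V (realIoo a b))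
    {n : ℕ} {T : Finset ℝ} (hT : ∀ z ∈ T, z ∈ realIoo a b ∧ φ n z = 0) : T.card ≤ n := by
  by_contra! hn
  have hI := isOpen_realIoo a b
  have hφs := h.smooth hV n
  obtain ⟨δ, hδ, hδI, hsep⟩ := exists_separation hI T fun z hz => (hT z hz).1
  obtain ⟨C, hC⟩ := exists_bound_deriv_smoothStep
  -- a linear bound for the eigenfunction near its zeros
  have hM : ∃ M : ℝ, ∀ z ∈ T, ∀ x ∈ Set.Icc (z - δ) (z + δ), |φ n x| ≤ M * |x - z| := by
    have hloc : ∀ z, ∃ M : ℝ, 0 ≤ M ∧ (z ∈ T → ∀ x ∈ Set.Icc (z - δ) (z + δ),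
        |φ n x| ≤ M * |x - z|) := by
      intro z
      by_cases hz : z ∈ T
      · have hsub : Set.Icc (z - δ) (z + δ) ⊆ realIoo a b := fun x hx =>
          hδI z hz ⟨by linarith [hx.1], by linarith [hx.2]⟩
        obtain ⟨M, hM⟩ := isCompact_Icc.exists_bound_of_continuousOn
          ((hφs.deriv_smooth hI).continuousOn.mono hsub)
        refine ⟨max M 0, le_max_right _ _, fun _ x hx => ?_⟩
        have := (convex_Icc (z - δ) (z + δ)).norm_image_sub_le_of_norm_deriv_le (f := φ n)
          (C := max M 0)
          (fun y hy => (hφs.hasDerivAt_smooth hI (hsub hy)).differentiableAt)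
          (fun y hy => (hM y hy).trans (le_max_left _ _))
          (x := z) (y := x) ⟨by linarith, by linarith⟩ hx
        rw [(hT z hz).2, sub_zero] at this
        exact this
      · exact ⟨0, le_rfl, fun h => absurd h hz⟩
    choose M hM0 hM using hloc
    refine ⟨∑ z ∈ T, M z, fun z hz x hx => (hM z hz x hx).trans ?_⟩
    exact mul_le_mul_of_nonneg_right (Finset.single_le_sum (fun z _ => hM0 z) hz) (abs_nonneg _)
  obtain ⟨M, hM⟩ := hM
  -- a lower bound for the mass next to the zeros
  have hsq : Integrable (fun x => φ n x * φ n x) (volume.restrict (realIoo a b)) :=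
    integrable_mul_of_memLp (h.memLp n) (h.memLp n)
  have hmass : ∀ p q : ℝ, p < q → Set.Ioo p q ⊆ realIoo a b →
      0 < ∫ x in Set.Ioo p q, φ n x * φ n x := by
    intro p q hpq hsub
    have h0 : 0 ≤ ∫ x in Set.Ioo p q, φ n x * φ n x := integral_nonneg fun x => mul_self_nonneg _
    refine lt_of_le_of_ne h0 fun e => ?_
    rw [eq_comm, integral_eq_zero_iff_of_nonneg (fun x => mul_self_nonneg _)
      (IntegrableOn.mono_set hsq hsub)] at e
    have hc := hφs.continuousOn.mono hsub
    have h1 := eqOn_of_ae_eq_restrict isOpen_Ioo (hc.mul hc) continuousOn_const e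
    obtain ⟨y, hy⟩ := Set.nonempty_Ioo.2 hpq
    refine h.frequentlyNonzero hV n y (hsub hy) ?_
    filter_upwards [isOpen_Ioo.mem_nhds hy] with x hx
    exact not_not.2 (mul_self_eq_zero.1 (h1 hx))
  have hLsub : ∀ z ∈ T, Set.Ioo (z - 2 * δ) (z - δ) ⊆ realIoo a b := fun z hz x hx =>
    hδI z hz ⟨hx.1.le, by linarith [hx.2]⟩
  have hRsub : ∀ z ∈ T, Set.Ioo (z + δ) (z + 2 * δ) ⊆ realIoo a b := fun z hz x hx =>
    hδI z hz ⟨by linarith [hx.1], hx.2.le⟩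
  obtain ⟨κ, hκ, hκT⟩ := Finset.exists_pos_le (T := T)
    (g := fun z => min (∫ x in Set.Ioo (z - 2 * δ) (z - δ), φ n x * φ n x)
      (∫ x in Set.Ioo (z + δ) (z + 2 * δ), φ n x * φ n x))
    fun z hz => lt_min (hmass _ _ (by linarith) (hLsub z hz)) (hmass _ _ (by linarith) (hRsub z hz))
  -- the width of the transitions
  have hE : 0 < E (n + 1) - E n := sub_pos.2 (h.strictMono (Nat.lt_succ_self n))
  set N : ℝ := (T.card : ℝ) with hN
  set R : ℝ := N * C ^ 2 * M ^ 2 * (2 * (N * (4 / κ))) with hR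
  obtain ⟨ε, hε, hεδ, hεE⟩ : ∃ ε > 0, ε ≤ δ ∧ R * ε < E (n + 1) - E n := by
    have h1 : ∀ᶠ ε in 𝓝[>] (0 : ℝ), R * ε < E (n + 1) - E n := by
      have : ContinuousAt (fun ε : ℝ => R * ε) 0 := by fun_prop
      exact nhdsWithin_le_nhds (this.eventually (gt_mem_nhds (by simpa using hE)))
    obtain ⟨ε, ⟨h2, h3⟩, h4⟩ := ((h1.and (nhdsWithin_le_nhds (eventually_lt_nhds hδ))).and
      self_mem_nhdsWithin).exists
    exact ⟨ε, h4, h3.le, h2⟩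
  have hIε : ∀ z ∈ T, Set.Icc (z - ε) (z + ε) ⊆ realIoo a b := fun z hz x hx =>
    hδI z hz ⟨by linarith [hx.1], by linarith [hx.2]⟩
  obtain ⟨b₀, β, hne, hort⟩ := h.exists_stepSum_orthogonal hε hIε hn
  set χ : ℝ → ℝ := stepSum T b₀ β ε with hχ
  have hχs : ContDiff ℝ ∞ χ := contDiff_stepSum T b₀ β ε
  set K : Set ℝ := ⋃ z ∈ T, Set.Icc (z - ε) (z + ε) with hK
  have hKc : IsCompact K := T.isCompact_biUnion fun z _ => isCompact_Icc
  have hKI : K ⊆ realIoo a b := Set.iUnion₂_subset hIε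
  have hK0 : ∀ x, x ∉ K → deriv χ x = 0 := by
    intro x hx
    rw [hχ, deriv_stepSum]
    refine Finset.sum_eq_zero fun z hz => ?_
    rw [deriv_smoothStep_div_eq_zero hε fun h' => hx (Set.mem_biUnion hz h'), zero_div, mul_zero]
  have hu := H.cutoff_mem_of_compact (h.mem_domain n) hχs hKc hKI hK0
  have hlow := h.le_integral_op hV hu hort
  rw [h.integral_cutoff hχs hKc hKI hK0 n] at hlow
  have hu2 : Integrable (fun x => (χ x * φ n x) * (χ x * φ n x))
      (volume.restrict (realIoo a b)) := integrable_mul_of_memLp (H.memLp _ hu) (H.memLp _ hu)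
  set A : ℝ := ∫ x in realIoo a b, (χ x * φ n x) * (χ x * φ n x) with hA
  have hcore : ∀ c p q : ℝ, Set.Ioo p q ⊆ realIoo a b → (∀ x ∈ Set.Ioo p q, χ x = c) →
      κ ≤ (∫ x in Set.Ioo p q, φ n x * φ n x) → κ * c ^ 2 ≤ A := by
    intro c p q hsub hc hκ'
    calc κ * c ^ 2 ≤ (∫ x in Set.Ioo p q, φ n x * φ n x) * c ^ 2 :=
          mul_le_mul_of_nonneg_right hκ' (sq_nonneg c)
      _ = ∫ x in Set.Ioo p q, (χ x * φ n x) * (χ x * φ n x) := by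
          rw [← integral_mul_const]
          refine setIntegral_congr_fun measurableSet_Ioo fun x hx => ?_
          simp only [hc x hx]
          ring
      _ ≤ A := setIntegral_mono_set hu2 (Eventually.of_forall fun x => mul_self_nonneg _)
          hsub.eventuallyLE
  have hβ : ∀ z ∈ T, β z ^ 2 ≤ 4 / κ * A := by
    intro z hz
    obtain ⟨c, hc1, hc2⟩ := exists_stepSum_eq b₀ β hε hεδ hsep hz
    have h1 := hcore c _ _ (hLsub z hz) hc1 ((hκT z hz).trans (min_le_left _ _))
    have h2 := hcore (c + β z) _ _ (hRsub z hz) hc2 ((hκT z hz).trans (min_le_right _ _))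
    have h3 : κ * β z ^ 2 ≤ 4 * A := by
      nlinarith [mul_nonneg hκ.le (sq_nonneg (2 * c + β z))]
    rw [div_mul_eq_mul_div, le_div_iff₀ hκ]
    linarith
  have hA0 : 0 ≤ A := integral_nonneg fun x => mul_self_nonneg _
  -- the excess energy
  have hN0 : 0 ≤ N := Nat.cast_nonneg _
  have hexc : ∫ x in realIoo a b, deriv χ x ^ 2 * φ n x ^ 2 ≤ R * ε * A := by
    have hpt : ∀ x, deriv χ x ^ 2 * φ n x ^ 2 ≤ ∑ z ∈ T, N * C ^ 2 * M ^ 2 * (4 / κ * A) *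
        (Set.Icc (z - ε) (z + ε)).indicator (fun _ => (1 : ℝ)) x := by
      intro x
      rw [hχ, deriv_stepSum]
      calc (∑ z ∈ T, β z * (deriv smoothStep ((x - z) / ε) / ε)) ^ 2 * φ n x ^ 2
          ≤ (N * ∑ z ∈ T, (β z * (deriv smoothStep ((x - z) / ε) / ε)) ^ 2) * φ n x ^ 2 :=
            mul_le_mul_of_nonneg_right sq_sum_le_card_mul_sum_sq (sq_nonneg _)
        _ = ∑ z ∈ T, N * ((β z * (deriv smoothStep ((x - z) / ε) / ε)) ^ 2 * φ n x ^ 2) := by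
            rw [mul_assoc, Finset.sum_mul, Finset.mul_sum]
        _ ≤ _ := by
            refine Finset.sum_le_sum fun z hz => ?_
            by_cases hx : x ∈ Set.Icc (z - ε) (z + ε)
            · rw [Set.indicator_of_mem hx, mul_one]
              have hxz : |x - z| ≤ ε := abs_le.2 ⟨by linarith [hx.1], by linarith [hx.2]⟩
              have h1 : φ n x ^ 2 ≤ M ^ 2 * ε ^ 2 := by
                have h2 := hM z hz x ⟨by linarith [hx.1], by linarith [hx.2]⟩
                have h3 : φ n x ^ 2 ≤ (M * |x - z|) ^ 2 := by
                  rw [← sq_abs (φ n x)]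
                  exact pow_le_pow_left₀ (abs_nonneg _) h2 2
                rw [mul_pow] at h3
                exact h3.trans (mul_le_mul_of_nonneg_left
                  (pow_le_pow_left₀ (abs_nonneg _) hxz 2) (sq_nonneg M))
              have h2 : deriv smoothStep ((x - z) / ε) ^ 2 ≤ C ^ 2 := by
                rw [← sq_abs]
                exact pow_le_pow_left₀ (abs_nonneg _) (hC _) 2
              have h3 := hβ z hz
              calc N * ((β z * (deriv smoothStep ((x - z) / ε) / ε)) ^ 2 * φ n x ^ 2)
                  = N * (β z ^ 2 * deriv smoothStep ((x - z) / ε) ^ 2 * (φ n x ^ 2 / ε ^ 2)) := by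
                    field_simp
                _ ≤ N * ((4 / κ * A) * C ^ 2 * M ^ 2) := by
                    have h4 : φ n x ^ 2 / ε ^ 2 ≤ M ^ 2 := by
                      rw [div_le_iff₀ (by positivity)]
                      exact h1
                    gcongr
                _ = N * C ^ 2 * M ^ 2 * (4 / κ * A) := by ring
            · rw [deriv_smoothStep_div_eq_zero hε hx, Set.indicator_of_notMem hx]
              simp
    have hind : ∀ z ∈ T, Integrable (fun x => N * C ^ 2 * M ^ 2 * (4 / κ * A) *
        (Set.Icc (z - ε) (z + ε)).indicator (fun _ => (1 : ℝ)) x)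
        (volume.restrict (realIoo a b)) := fun z _ => by
      refine Integrable.const_mul (Integrable.restrict ?_) _
      exact (integrable_indicator_iff measurableSet_Icc).2 (integrableOn_const (by simp))
    calc ∫ x in realIoo a b, deriv χ x ^ 2 * φ n x ^ 2
        ≤ ∫ x in realIoo a b, ∑ z ∈ T, N * C ^ 2 * M ^ 2 * (4 / κ * A) *
          (Set.Icc (z - ε) (z + ε)).indicator (fun _ => (1 : ℝ)) x :=
          integral_mono_of_nonneg (Eventually.of_forall fun x => by positivity)
            (integrable_finsetSum _ hind) (Eventually.of_forall hpt)
      _ = ∑ z ∈ T, N * C ^ 2 * M ^ 2 * (4 / κ * A) * (2 * ε) := by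
          rw [integral_finsetSum _ hind]
          refine Finset.sum_congr rfl fun z hz => ?_
          rw [integral_const_mul, integral_indicator measurableSet_Icc,
            Measure.restrict_restrict measurableSet_Icc,
            Set.inter_eq_left.2 (hIε z hz)]
          simp
          left
          rw [max_eq_left (by linarith)]
          ring
      _ = R * ε * A := by
          rw [Finset.sum_const, nsmul_eq_mul, hR]
          ring
  have hAz : A = 0 := by
    by_contra hne
    have hpos := lt_of_le_of_ne hA0 (Ne.symm hne)
    have := mul_lt_mul_of_pos_right hεE hpos
    linarith
  have hβ0 : ∀ z ∈ T, β z = 0 := fun z hz => by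
    have h1 := hβ z hz
    rw [hAz, mul_zero] at h1
    exact pow_eq_zero_iff two_ne_zero |>.1 (le_antisymm h1 (sq_nonneg _))
  have hb₀ : b₀ ≠ 0 := hne.resolve_right fun ⟨z, hz, h'⟩ => h' (hβ0 z hz)
  have hχc : ∀ x, χ x = b₀ := fun x => by
    rw [hχ, stepSum, Finset.sum_eq_zero fun z hz => by rw [hβ0 z hz, zero_mul], add_zero]
  have : A = b₀ ^ 2 * ∫ x in realIoo a b, φ n x * φ n x := by
    rw [hA, ← integral_const_mul]
    refine integral_congr_ae (Eventually.of_forall fun x => ?_)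
    simp only [hχc]
    ring
  rw [hAz] at this
  have h1 := h.integral_sq_pos hV n
  have : 0 < b₀ ^ 2 * ∫ x in realIoo a b, φ n x * φ n x := by positivity
  linarith

end IsEigenfunctionSequence

/-! ### Semi-degenerate eigenfunction sequences -/

theorem strictMono_partitionIndex {ℓ : ℕ} {lam : Fin ℓ → ℕ} (h : Monotone lam) :
    StrictMono (partitionIndex lam) := fun i j hij => by
  have h1 := h hij.le
  have h2 : (i : ℕ) < j := hij
  simp only [partitionIndex]
  omega

theorem exists_partitionIndex_eq {ℓ : ℕ} {k : Fin ℓ → ℕ} (hk : StrictMono k) :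
    ∃ lam : Fin ℓ → ℕ, Monotone lam ∧ partitionIndex lam = k := by
  have hstep : ∀ d : ℕ, ∀ i j : Fin ℓ, (j : ℕ) = i + d → k i + d ≤ k j := by
    intro d
    induction d with
    | zero => intro i j hij; simp [Fin.ext hij.symm]
    | succ d ih =>
      intro i j hij
      have hlt : (i : ℕ) + d < ℓ := by have := j.2; omega
      have h1 := ih i ⟨i + d, hlt⟩ rfl
      have h2 : k ⟨i + d, hlt⟩ < k j := hk (by rw [Fin.lt_def, hij]; exact Nat.lt_succ_self _)
      omega
  have hle : ∀ i : Fin ℓ, (i : ℕ) ≤ k i := fun i => by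
    have := hstep i ⟨0, i.pos⟩ i (by simp)
    omega
  refine ⟨fun i => k i - i, fun i j hij => ?_, funext fun i => Nat.sub_add_cancel (hle i)⟩
  have h1 := hstep (j - i) i j (by have : (i : ℕ) ≤ j := hij; omega)
  have h2 : (i : ℕ) ≤ j := hij
  have := hle i
  dsimp only
  omega

theorem SemiDegenerate.tuple {a : EReal} {φ : ℕ → ℝ → ℝ} (h : SemiDegenerate a φ) :
    TupleSemiDegenerate a φ := by
  intro ℓ k hk m n hm hn hmn
  obtain ⟨lam, hlam, rfl⟩ := exists_partitionIndex_eq hk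
  exact h ℓ lam hlam m n hm hn hmn

theorem hasLead_taylorSeries_of_ne {f : ℝ → ℝ} (h : f 0 ≠ 0) : HasLead (taylorSeries f) 0 (f 0) :=
  ⟨h, taylorSeries f, by simp, by
    rw [← PowerSeries.coeff_zero_eq_constantCoeff_apply]; simp [taylorSeries]⟩

theorem hasLead_taylorSeries_of_deriv_ne {f : ℝ → ℝ} (h0 : f 0 = 0) (h1 : deriv f 0 ≠ 0) :
    HasLead (taylorSeries f) 1 (deriv f 0) := by
  have h2 : PowerSeries.constantCoeff (taylorSeries f) = 0 := by
    rw [← PowerSeries.coeff_zero_eq_constantCoeff_apply]; simp [taylorSeries, h0]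
  obtain ⟨U, hU⟩ := PowerSeries.X_dvd_iff.2 h2
  refine ⟨h1, U, by simpa using hU, ?_⟩
  have h3 : PowerSeries.coeff 1 (taylorSeries f) = deriv f 0 := by simp [taylorSeries]
  rw [← h3, hU, show 1 = 0 + 1 from rfl, PowerSeries.coeff_succ_X_mul,
    PowerSeries.coeff_zero_eq_constantCoeff_apply]

theorem hasRootOfMultiplicity_one {f : ℝ → ℝ} {x : ℝ} (hf : ContDiffAt ℝ ∞ f x) (h0 : f x = 0)
    (h1 : deriv f x ≠ 0) : HasRootOfMultiplicity f x 1 := by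
  refine ⟨hf.of_le (by exact_mod_cast le_top), fun i hi => ?_, by rwa [iteratedDeriv_one]⟩
  obtain rfl : i = 0 := by omega
  rwa [iteratedDeriv_zero]

theorem setOf_neg_and_eq_zero {a : EReal} {f : ℝ → ℝ} {ε : ℝ}
    (h : ∀ x ∈ realIoo (-a) a, f (-x) = ε * f x) :
    {x ∈ {x ∈ realIoo (-a) a | x < 0} | f x = 0} =
      (fun x => -x) '' {x ∈ posHalf a | f x = 0} := by
  ext x
  constructor
  · rintro ⟨⟨hx, hx0⟩, hfx⟩
    exact ⟨-x, ⟨⟨neg_mem_realIoo hx, neg_pos.2 hx0⟩, by rw [h x hx, hfx, mul_zero]⟩, neg_neg x⟩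
  · rintro ⟨y, ⟨⟨hy, hy0⟩, hfy⟩, rfl⟩
    exact ⟨⟨neg_mem_realIoo hy, neg_neg_iff_pos.2 hy0⟩, by rw [h y hy, hfy, mul_zero]⟩

namespace IsEigenfunctionSequence

section

variable {V : ℝ → ℝ} {a b : EReal} {H : Hamiltonian V a b} {E : ℕ → ℝ} {φ : ℕ → ℝ → ℝ}

theorem finite_zeros (h : IsEigenfunctionSequence H E φ) (hV : ContDiffOn ℝ ∞ V (realIoo a b))
    (n : ℕ) : {x ∈ realIoo a b | φ n x = 0}.Finite := by
  by_contra hinf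
  obtain ⟨T, hT, hcard⟩ := Set.Infinite.exists_subset_card_eq hinf (n + 1)
  have := h.card_zeros_le hV (n := n) (T := T) fun z hz => hT hz
  omega

theorem ncard_zeros_le (h : IsEigenfunctionSequence H E φ) (hV : ContDiffOn ℝ ∞ V (realIoo a b))
    (n : ℕ) : {x ∈ realIoo a b | φ n x = 0}.ncard ≤ n := by
  rw [Set.ncard_eq_toFinset_card _ (h.finite_zeros hV n)]
  exact h.card_zeros_le hV fun z hz => by simpa using hz

end

variable {V : ℝ → ℝ} {a : EReal} {H : Hamiltonian V (-a) a} {E : ℕ → ℝ} {φ : ℕ → ℝ → ℝ}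

theorem eventually_ne_zero (h : IsEigenfunctionSequence H E φ) (ha : 0 < a)
    (hV : ContDiffOn ℝ ∞ V (realIoo (-a) a)) (n : ℕ) : ∀ᶠ x in rightEnd a, φ n x ≠ 0 := by
  have hbot : ⊥ < a := EReal.bot_lt_zero.trans ha
  have hin : ∀ᶠ x in rightEnd a, x ∈ realIoo (-a) a := (eventually_rightEnd_iff hbot).2
    ⟨0, ha, fun x hx => ⟨(EReal.neg_lt_zero.2 ha).trans hx.1, hx.2⟩⟩
  have hfin : ∀ᶠ x in rightEnd a, ∀ z ∈ {x ∈ realIoo (-a) a | φ n x = 0}, x ≠ z := by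
    refine (Filter.eventually_all_finite (h.finite_zeros hV n)).2 fun z hz => ?_
    exact (eventually_rightEnd_iff hbot).2 ⟨z, hz.1.2, fun x hx => (mem_realIoo_coe.1 hx).1.ne'⟩
  filter_upwards [hin, hfin] with x hx hne h0 using hne x ⟨hx, h0⟩ rfl

/-- Eigenfunctions of an even Hamiltonian form a system of even and odd functions. -/
theorem exists_paritySystem (h : IsEigenfunctionSequence H E φ) (ha : 0 < a)
    (hV : ContDiffOn ℝ ∞ V (realIoo (-a) a)) (hVeven : ∀ x ∈ realIoo (-a) a, V (-x) = V x)
    (hHeven : ∀ f ∈ H.domain, (fun x => f (-x)) ∈ H.domain) :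
    ∃ e, ParitySystem a V E φ e := by
  have h00 := zero_mem_realIoo ha
  have hex : ∀ n, ∃ e ≤ 1, (∀ x ∈ realIoo (-a) a, φ n (-x) = (-1) ^ e * φ n x) ∧
      ∃ c, HasLead (taylorSeries (φ n)) e c := by
    intro n
    rcases h.even_or_odd hV hVeven hHeven n with hp | hp
    · refine ⟨0, zero_le_one, fun x hx => by simp [hp x hx], _, hasLead_taylorSeries_of_ne ?_⟩
      intro h0
      refine h.not_both_zero hV n h00 h0 ?_
      have := deriv_neg_of_parity (f := φ n) (ε := 1) (fun x hx => by simp [hp x hx]) h00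
      rw [neg_zero] at this
      linarith
    · have h0 : φ n 0 = 0 := by
        have := hp 0 h00
        rw [neg_zero] at this
        linarith
      exact ⟨1, le_rfl, fun x hx => by simp [hp x hx], _,
        hasLead_taylorSeries_of_deriv_ne h0 (h.not_both_zero hV n h00 h0)⟩
  choose e he1 hpar hlead using hex
  exact ⟨e, { h.eigenSystem hV with
    pos := ha
    eventually_ne := h.eventually_ne_zero ha hV
    tendsto_wr := fun n m => H.tendsto_wronskian ha (h.mem_domain n) (h.mem_domain m)
    e_le := he1
    parity := hpar
    lead := hlead }⟩

/-- The zeros of the `n`-th eigenfunction come in pairs, apart from the origin. -/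
theorem two_mul_ncard_add_le (h : IsEigenfunctionSequence H E φ)
    (hV : ContDiffOn ℝ ∞ V (realIoo (-a) a)) {e : ℕ → ℕ} (hp : ParitySystem a V E φ e) (n : ℕ) :
    2 * {x ∈ posHalf a | φ n x = 0}.ncard + e n ≤ n := by
  have hfin := h.finite_zeros hV n
  have hpos : {x ∈ posHalf a | φ n x = 0}.Finite := hfin.subset fun x hx => ⟨hx.1.1, hx.2⟩
  have hneg := setOf_neg_and_eq_zero (hp.parity n)
  have hnfin : {x ∈ {x ∈ realIoo (-a) a | x < 0} | φ n x = 0}.Finite :=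
    hfin.subset fun x hx => ⟨hx.1.1, hx.2⟩
  have hncard : {x ∈ {x ∈ realIoo (-a) a | x < 0} | φ n x = 0}.ncard =
      {x ∈ posHalf a | φ n x = 0}.ncard := by
    rw [hneg, Set.ncard_image_of_injective _ neg_injective]
  obtain ⟨O, hO, hOsub, hOcard⟩ : ∃ O : Set ℝ, O.Finite ∧
      O ⊆ {x ∈ realIoo (-a) a | φ n x = 0} ∩ {0} ∧ O.ncard = e n := by
    rcases hp.e_cases n with he | he
    · exact ⟨∅, Set.finite_empty, Set.empty_subset _, by rw [he, Set.ncard_empty]⟩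
    · obtain ⟨c, hc⟩ := hp.lead n
      rw [he] at hc
      refine ⟨{0}, Set.finite_singleton 0, ?_, by rw [he, Set.ncard_singleton]⟩
      rintro x rfl
      exact ⟨⟨zero_mem_realIoo hp.pos, hc.deriv_of_succ.1⟩, rfl⟩
  have hd1 : Disjoint {x ∈ posHalf a | φ n x = 0}
      {x ∈ {x ∈ realIoo (-a) a | x < 0} | φ n x = 0} :=
    Set.disjoint_left.2 fun x hx hx' => lt_asymm hx.1.2 hx'.1.2
  have hd2 : Disjoint ({x ∈ posHalf a | φ n x = 0} ∪
      {x ∈ {x ∈ realIoo (-a) a | x < 0} | φ n x = 0}) O := by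
    refine Set.disjoint_left.2 fun x hx hx' => ?_
    obtain rfl : x = 0 := (hOsub hx').2
    rcases hx with hx | hx
    · exact lt_irrefl _ hx.1.2
    · exact lt_irrefl _ hx.1.2
  have hsub : {x ∈ posHalf a | φ n x = 0} ∪
      {x ∈ {x ∈ realIoo (-a) a | x < 0} | φ n x = 0} ∪ O ⊆
      {x ∈ realIoo (-a) a | φ n x = 0} := by
    rintro x ((hx | hx) | hx)
    · exact ⟨hx.1.1, hx.2⟩
    · exact ⟨hx.1.1, hx.2⟩
    · exact (hOsub hx).1
  have h1 := Set.ncard_le_ncard hsub hfin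
  rw [Set.ncard_union_eq hd2 (hpos.union hnfin) hO, Set.ncard_union_eq hd1 hpos hnfin, hncard,
    hOcard] at h1
  have h2 := h.ncard_zeros_le hV n
  omega

end IsEigenfunctionSequence

theorem parityDiff_partitionIndex {e : ℕ → ℕ} (he : ∀ n, e n = n % 2) {ℓ : ℕ} (lam : Fin ℓ → ℕ) :
    parityDiff e (partitionIndex lam) = dIndex lam := by
  rw [dIndex, Finset.card_filter, Finset.card_filter, parityDiff]
  push_cast
  rw [← Finset.sum_sub_distrib]
  refine Finset.sum_congr rfl fun j _ => ?_
  rw [he]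
  rcases Nat.even_or_odd (partitionIndex lam j) with hj | hj
  · rw [if_neg (Nat.not_odd_iff_even.2 hj), if_pos hj, Nat.even_iff.1 hj]
    norm_num
  · rw [if_pos hj, if_neg (Nat.not_even_iff_odd.2 hj), Nat.odd_iff.1 hj]
    norm_num

theorem nPlus_eq {ℓ : ℕ} (lam : Fin ℓ → ℕ) :
    nPlus lam = (2 * (altSum (partitionIndex lam) : ℚ) -
      |((dIndex lam + (ℓ : ℤ) % 2 : ℤ) : ℚ)|) / 4 := by
  have h1 : (altSum (partitionIndex lam) : ℚ) =
      ∑ i : Fin ℓ, (-1 : ℚ) ^ (ℓ - ((i : ℕ) + 1)) * (lam i : ℚ) := by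
    simp [altSum, partitionIndex]
  have h2 : (ℓ : ℚ) - 2 * ((ℓ / 2 : ℕ) : ℚ) = (((ℓ : ℤ) % 2 : ℤ) : ℚ) := by
    have : (ℓ : ℤ) - 2 * ((ℓ / 2 : ℕ) : ℤ) = (ℓ : ℤ) % 2 := by omega
    simp only [← this, Int.cast_sub, Int.cast_mul, Int.cast_natCast, Int.cast_ofNat]
  rw [nPlus, h1, h2]
  push_cast
  ring

theorem theorem1p5 (a : EReal) (ha : 0 < a) (V : ℝ → ℝ)
    (hV : ContDiffOn ℝ ∞ V (realIoo (-a) a))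
    (hVeven : ∀ x ∈ realIoo (-a) a, V (-x) = V x)
    (H : Hamiltonian V (-a) a) (hHeven : ∀ f ∈ H.domain, (fun x => f (-x)) ∈ H.domain)
    (E : ℕ → ℝ) (φ : ℕ → ℝ → ℝ)
    (hφ : IsEigenfunctionSequence H E φ) (hsemi : SemiDegenerate a φ)
    (ℓ : ℕ) (lam : Fin ℓ → ℕ) (hlam : Monotone lam) :
    (∃ m : ℕ, (m : ℚ) = (dIndex lam : ℚ) * ((dIndex lam : ℚ) + 1) / 2 ∧
      HasRootOfMultiplicity (wronskianPartition φ lam) 0 m) ∧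
    (∃ N : ℕ, (N : ℚ) = nPlus lam ∧
      HasSimpleRootsIn (wronskianPartition φ lam) {x ∈ realIoo (-a) a | 0 < x} N ∧
      HasSimpleRootsIn (wronskianPartition φ lam) {x ∈ realIoo (-a) a | x < 0} N) := by
  obtain ⟨e, hp⟩ := hφ.exists_paritySystem ha hV hVeven hHeven
  have hs := hsemi.tuple
  have hcard : ∀ n, 2 * {x ∈ posHalf a | φ n x = 0}.ncard + e n = n := fun n =>
    le_antisymm (hφ.two_mul_ncard_add_le hV hp n) (hp.le_zeros hφ.strictMono hs n)
  have he : ∀ n, e n = n % 2 := fun n => by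
    have h1 := hcard n
    have h2 := hp.e_le n
    omega
  have hk := strictMono_partitionIndex hlam
  obtain ⟨p, c, hlead, hpd⟩ := (hp.exists_leadAt ℓ).1 _ hk.injective
  obtain ⟨hfin, hsimple, hcount⟩ := (hp.countAt hφ.strictMono hs
    (fun n => (hφ.finite_zeros hV n).subset fun x hx => ⟨hx.1.1, hx.2⟩) hcard ℓ).1 _ hk
  rw [parityDiff_partitionIndex he] at hpd hcount
  have hsm : ∀ x ∈ realIoo (-a) a, ContDiffAt ℝ ∞ (wronskian φ (partitionIndex lam)) x :=
    fun x hx => (hp.wr_smooth _).contDiffAt (hp.isOpen.mem_nhds hx)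
  have hsign : ((-1 : ℝ) ^ p) ≠ 0 := pow_ne_zero _ (neg_ne_zero.2 one_ne_zero)
  refine ⟨⟨p, ?_, hlead.hasLead.hasRootOfMultiplicity (hp.contDiffAt_zero _)⟩, _, ?_,
    ⟨hfin, rfl, fun x hx h0 => hasRootOfMultiplicity_one (hsm x hx.1) h0 (hsimple x hx h0)⟩, ?_⟩
  · have : (2 * p : ℚ) = dIndex lam * (dIndex lam + 1) := by exact_mod_cast hpd
    linarith
  · rw [nPlus_eq]
    have : (4 * ({x ∈ posHalf a | wronskian φ (partitionIndex lam) x = 0}.ncard : ℚ)) =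
        2 * (altSum (partitionIndex lam) : ℚ) - |((dIndex lam + (ℓ : ℤ) % 2 : ℤ) : ℚ)| := by
      exact_mod_cast hcount
    rw [← this]
    exact (mul_div_cancel_left₀ _ (by norm_num)).symm
  · have himage := setOf_neg_and_eq_zero hlead.parity
    refine ⟨?_, ?_, fun x hx h0 => ?_⟩
    · exact himage ▸ hfin.image _
    · exact (congrArg Set.ncard himage).trans (Set.ncard_image_of_injective _ neg_injective)
    · refine hasRootOfMultiplicity_one (hsm x hx.1) h0 ?_
      have hx' : -x ∈ realIoo (-a) a := neg_mem_realIoo hx.1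
      have h1 := deriv_neg_of_parity hlead.parity hx'
      rw [neg_neg] at h1
      rw [show deriv (wronskianPartition φ lam) x = _ from h1, neg_ne_zero]
      refine mul_ne_zero hsign (hsimple _ ⟨hx', neg_pos.2 hx.2⟩ ?_)
      rw [hlead.parity x hx.1, show wronskian φ (partitionIndex lam) x = 0 from h0, mul_zero]
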